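/- Let $n,k$ be integers with $2\le k<n$, and let $f$ be $\sqrt[k]{S_k}$ or $S_k/S_{k-1}$, where $S_k(\lambda)=\sum_{i_1<\dots<i_k}\lambda_{i_1}\cdots\lambda_{i_k}$ on $\mathbb R^n$. An $f$-translator is a smooth embedded hypersurface of $\mathbb R^{n+1}=\mathbb R^n\times\mathbb R$ such that at each of its points not on the boundary $f(\lambda)=\langle\nu,e_{n+1}\rangle$ for a unit normal $\nu$, where $\lambda=(\lambda_1,\dots,\lambda_n)$ are the principal curvatures with respect to $\nu$ (the eigenvalues of $-d\nu$). Here $\sqrt[k]{\cdot}$ is the real $k$-th root: for odd $k$ it is defined on all of $\mathbb R$; for even $k$ it is the nonnegative root, and the equation includes $S_k(\lambda)\ge 0$; for $f=S_k/S_{k-1}$ the equation includes $S_{k-1}(\lambda)\neq0$. Write $\mathbf e=(1,\dots,1)\in\mathbb R^{n-1}$ and $$P_f(x)=\frac{|x|^2}{2f(0,\mathbf e)}-\frac{\partial f}{\partial\lambda_1}(0,\mathbf e)\,\ln|x| .$$ Then for every $R>0$ and for each of the two functions $f$ there is a non-convex, connected, complete (closed in $\mathbb R^{n+1}$) $f$-translator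 $W_R$, rotationally symmetric about the $x_{n+1}$-axis, whose points $(x,x_{n+1})$ all satisfy $|x|\ge R$ and which contains the sphere $\{|x|=R,\ x_{n+1}=0\}$, with the following properties. 1. (a) If $f=\sqrt[k]{S_k}$ with $k$ even: $W_R$ has no boundary and is the union of the graphs of two functions $W_R^\pm:\{|x|\ge R\}\to\mathbb R$, continuous on $\{|x|\ge R\}$ and smooth with $W_R^-<W_R^+$ on $\{|x|>R\}$, and for some constants $C^\pm$ $$W_R^\pm(x)=\pm\bigl(P_f(x)+C^\pm+O(|x|^{-1})\bigr)\quad\text{as }|x|\to\infty .$$ (b) If $f=\sqrt[k]{S_k}$ with $k$ odd: there are $\rho>R$ and $h\in\mathbb R$ such that $W_R$ is a hypersurface with boundary ($C^1$ up to the boundary, smooth in the interior) whose boundary is the sphere $\{|x|=\rho,\ x_{n+1}=h\}\cong\mathbb S^{n-1}$, and no set containing $W_R$ is a (smooth) $f$-translator near a point of this sphere. $W_R$ is the union of the graph of a function $W_R^+$ over $\{|x|\ge R\}$ and of the graph of a function $W_R^-$ over $\{R\le|x|\le\rho\}$; both functions are continuous, and they are smooth for $|x|>R$ and $R<|x|<\rho$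 respectively; $W_R^-<W_R^+$ for $R<|x|\le\rho$, and $W_R^-=h$ for $|x|=\rho$. For some $R_1>R$, the part of $W_R$ outside the ball $B_{R_1}(0)\subset\mathbb R^{n+1}$ is contained in the graph of $W_R^+$ and equals the part of that graph outside $B_{R_1}(0)$, and for some constant $C$ $$W_R^+(x)=P_f(x)+C+O(|x|^{-1})\quad\text{as }|x|\to\infty .$$ 2. If $f=S_k/S_{k-1}$: $W_R$ has no boundary and is the union of the graphs of two functions $W_R^\pm:\{|x|\ge R\}\to\mathbb R$, continuous on $\{|x|\ge R\}$ and smooth with $W_R^-<W_R^+$ on $\{|x|>R\}$, and for some constant $C^+$ $$W_R^+(x)=P_f(x)+C^++O(|x|^{-1})\quad\text{as }|x|\to\infty,\qquad \lim_{|x|\to\infty}|\nabla W_R^-(x)|=0 .$$ -/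

import Mathlib

open Filter Topology Asymptotics Bornology
open scoped ContDiff

noncomputable section

/-- `ℝⁿ` with its Euclidean norm. -/
abbrev Rn (n : ℕ) : Type := EuclideanSpace ℝ (Fin n)

/-- `ℝⁿ⁺¹ = ℝⁿ × ℝ` with its Euclidean norm; a point is `p = (x, x_{n+1})` with
`x = p.fst` and `x_{n+1} = p.snd`. -/
abbrev Rn1 (n : ℕ) : Type := WithLp 2 (Rn n × ℝ)

/-- The point `(x, t)` of `ℝⁿ × ℝ`. -/
def pt {n : ℕ} (x : Rn n) (t : ℝ) : Rn1 n := WithLp.toLp 2 (x, t)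

/-- The translation direction `e_{n+1}`. -/
def eVert (n : ℕ) : Rn1 n := pt 0 1

/-! ### Speed functions -/

/-- The elementary symmetric polynomial `S_k(λ)`, with `S_0 = 1`. -/
def Sk {n : ℕ} (k : ℕ) (lam : Fin n → ℝ) : ℝ :=
  MvPolynomial.eval lam (MvPolynomial.esymm (Fin n) ℝ k)

/-- The real `k`-th root of `S_k(λ)`. For odd `k` it is defined for every `λ` (the root of a negative
number being negative); for even `k` it is the nonnegative root, and has this meaning on
`rootDomain k` only. -/
def rootSpeed {n : ℕ} (k : ℕ) (lam : Fin n → ℝ) : ℝ :=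
  Real.sign (Sk k lam) * |Sk k lam| ^ ((1 : ℝ) / k)

/-- Where the real `k`-th root of `S_k` exists. -/
def rootDomain {n : ℕ} (k : ℕ) : Set (Fin n → ℝ) := {lam | Even k → 0 ≤ Sk k lam}

/-- The quotient `S_k / S_{k-1}`. -/
def quotSpeed {n : ℕ} (k : ℕ) (lam : Fin n → ℝ) : ℝ := Sk k lam / Sk (k - 1) lam

/-- Where the quotient `S_k / S_{k-1}` is defined. -/
def quotDomain {n : ℕ} (k : ℕ) : Set (Fin n → ℝ) := {lam | Sk (k - 1) lam ≠ 0}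

/-- The vector `(t, 1, …, 1) = (t, 𝐞)` of `ℝⁿ`. -/
def cyl (n : ℕ) (t : ℝ) : Fin n → ℝ := fun i => if (i : ℕ) = 0 then t else 1

/-- The bowl expansion `|x|² / (2 f(0,𝐞)) - ∂f/∂λ₁(0,𝐞) ln |x|`. -/
def bowlExpansion {n : ℕ} (f : (Fin n → ℝ) → ℝ) (x : Rn n) : ℝ :=
  ‖x‖ ^ 2 / (2 * f (cyl n 0)) - deriv (fun t => f (cyl n t)) 0 * Real.log ‖x‖

/-- `w(x) = |x|² / (2 f(0,𝐞)) - ∂f/∂λ₁(0,𝐞) ln |x| + C + O(|x|⁻¹)` as `|x| → ∞`. -/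
def AsymptoticToBowl {n : ℕ} (f : (Fin n → ℝ) → ℝ) (w : Rn n → ℝ) (C : ℝ) : Prop :=
  (fun x => w x - (bowlExpansion f x + C)) =O[cobounded (Rn n)] (fun x => ‖x‖⁻¹)

/-! ### Hypersurfaces and translators -/

/-- Near `p`, the set `W` is a smooth embedded hypersurface (a regular level set `φ = 0`), and `N` is
(a smooth local extension of) a unit normal field of it. -/
def IsUnitNormalNear {n : ℕ} (W : Set (Rn1 n)) (p : Rn1 n) (N : Rn1 n → Rn1 n) : Prop :=
  ∃ U : Set (Rn1 n), IsOpen U ∧ p ∈ U ∧ ∃ φ : Rn1 n → ℝ,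
    ContDiffOn ℝ ∞ φ U ∧ (∀ q ∈ U, gradient φ q ≠ 0) ∧ W ∩ U = {q ∈ U | φ q = 0} ∧
    ContDiffOn ℝ ∞ N U ∧ ∀ q ∈ W ∩ U, ‖N q‖ = 1 ∧ ∃ c : ℝ, N q = c • gradient φ q

/-- `λ₁, …, λₙ` are the principal curvatures at `p` with respect to the unit normal `N`: the
eigenvalues of the shape operator `-dN` on the tangent space `N(p)^⊥`, with multiplicity. They are
positive for the graph of a strictly convex function and the upward normal. -/
def IsPrincipalCurvatures {n : ℕ} (N : Rn1 n → Rn1 n) (p : Rn1 n) (lam : Fin n → ℝ) : Prop :=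
  ∃ b : Fin n → Rn1 n, Orthonormal ℝ b ∧ (∀ i, inner ℝ (b i) (N p) = 0) ∧
    ∀ i, fderiv ℝ N p (b i) = -(lam i • b i)

/-- Near `p ∈ W`, the set `W` is a smooth embedded hypersurface, and at `p` it satisfies the
translator equation `f(λ) = ⟨ν, e_{n+1}⟩` for a unit normal `ν`, where `λ` are the principal
curvatures with respect to `ν`. -/
def IsTranslatorAt {n : ℕ} (f : (Fin n → ℝ) → ℝ) (D : Set (Fin n → ℝ)) (W : Set (Rn1 n))
    (p : Rn1 n) : Prop :=
  p ∈ W ∧ ∃ (N : Rn1 n → Rn1 n) (lam : Fin n → ℝ), IsUnitNormalNear W p N ∧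
    IsPrincipalCurvatures N p lam ∧ lam ∈ D ∧ f lam = inner ℝ (N p) (eVert n)

/-- Near `p`, the set `W` is a `C¹` hypersurface with boundary, `p` being a boundary point. -/
def IsBoundaryPoint {n : ℕ} (W : Set (Rn1 n)) (p : Rn1 n) : Prop :=
  ∃ U : Set (Rn1 n), IsOpen U ∧ p ∈ U ∧ ∃ φ ψ : Rn1 n → ℝ,
    ContDiffOn ℝ 1 φ U ∧ ContDiffOn ℝ 1 ψ U ∧ φ p = 0 ∧ ψ p = 0 ∧
    LinearIndependent ℝ ![gradient φ p, gradient ψ p] ∧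
    W ∩ U = {q ∈ U | φ q = 0 ∧ 0 ≤ ψ q}

/-- `W` is a connected, complete `f`-translator with (possibly empty) boundary `bd`.
`W` is a closed set (hence complete, both for the Euclidean and for the intrinsic distance), all of
its points off `bd` are interior points at which it is an `f`-translator, all points of `bd` are
boundary points, and `W` cannot be continued as an `f`-translator across any point of `bd`. -/
structure IsCompleteTranslator {n : ℕ} (f : (Fin n → ℝ) → ℝ) (D : Set (Fin n → ℝ))
    (W bd : Set (Rn1 n)) : Prop where
  connected : IsConnected W
  closed : IsClosed W
  boundary_subset : bd ⊆ W
  translator : ∀ p ∈ W \ bd, IsTranslatorAt f D W p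
  boundary : ∀ p ∈ bd, IsBoundaryPoint W p
  inextendible : ∀ W' : Set (Rn1 n), W ⊆ W' → ∀ p ∈ bd, ¬ IsTranslatorAt f D W' p

/-- `W` is invariant under the rotations of `ℝⁿ⁺¹` about the `x_{n+1}`-axis. -/
def RotSymmetric {n : ℕ} (W : Set (Rn1 n)) : Prop :=
  ∀ A : Rn n ≃ₗᵢ[ℝ] Rn n, ∀ x : Rn n, ∀ t : ℝ, pt x t ∈ W → pt (A x) t ∈ W

/-- `W` is not convex: at some interior point there are principal curvatures of both signs, that is,
the principal curvatures are not all `≥ 0` for either choice of the unit normal. -/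
def NonConvex {n : ℕ} (W : Set (Rn1 n)) : Prop :=
  ∃ p ∈ W, ∃ (N : Rn1 n → Rn1 n) (lam : Fin n → ℝ), IsUnitNormalNear W p N ∧
    IsPrincipalCurvatures N p lam ∧ ∃ i j, lam i < 0 ∧ 0 < lam j

/-- `W` is a wing-like `f`-translator with boundary `bd` and neck radius `R`: a non-convex complete
rotationally symmetric `f`-translator whose distance from the axis is `R`, attained on the sphere
`|x| = R` at height `0`. -/
structure IsWingLike {n : ℕ} (f : (Fin n → ℝ) → ℝ) (D : Set (Fin n → ℝ)) (R : ℝ)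
    (W bd : Set (Rn1 n)) : Prop where
  complete : IsCompleteTranslator f D W bd
  rotSymmetric : RotSymmetric W
  nonConvex : NonConvex W
  le_dist_axis : ∀ p ∈ W, R ≤ ‖p.fst‖
  neck : ∀ x : Rn n, ‖x‖ = R → pt x 0 ∈ W

/-- The vertical graph of `w` over `A ⊆ ℝⁿ`. -/
def graphOver {n : ℕ} (w : Rn n → ℝ) (A : Set (Rn n)) : Set (Rn1 n) :=
  {p | p.fst ∈ A ∧ p.snd = w p.fst}

/-- `w` is continuous on `R ≤ |x|` and smooth on `R < |x|`. -/
def RegularOutside {n : ℕ} (R : ℝ) (w : Rn n → ℝ) : Prop :=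
  ContinuousOn w {x | R ≤ ‖x‖} ∧ ContDiffOn ℝ ∞ w {x | R < ‖x‖}

/-- `W` consists of an upper branch `wp` and a lower branch `wm`, both graphs over the complement of
the open ball of radius `R` in `ℝⁿ`, which do not meet over `R < |x|`. -/
def HasTwoGraphicalBranches {n : ℕ} (R : ℝ) (W : Set (Rn1 n)) (wp wm : Rn n → ℝ) : Prop :=
  RegularOutside R wp ∧ RegularOutside R wm ∧ (∀ x, R < ‖x‖ → wm x < wp x) ∧
    W = graphOver wp {x | R ≤ ‖x‖} ∪ graphOver wm {x | R ≤ ‖x‖}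

end

/-! ### Scalar differential equations -/

section ODE

open Set

/-! A hypersurface `|x| = r(z)` has one meridian curvature `κ` and `n - 1` equal curvatures `μ`. By
`Sk_axisym`, `S_k(κ, μ, …, μ)` is affine in `κ`, so the translator equation can be solved for `κ`
and becomes `r'' = (1 + r'²) Q(r, r')`. This equation is regular at `r' = 0` and `Q(R, 0) > 0`, so
it has a strictly convex solution with `r(0) = R`, `r'(0) = 0` (`exists_isNeckArc`). That curve is
the neck; there the curvatures are `-Q(R, 0) < 0 < 1 / R`, whence non-convexity.

It remains to continue the two halves of the neck as graphs `z = u(r)`. The slope `v = u'` satisfies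
`v' = -(1 + v²) v Q(r, 1/v)`, and by homogeneity `-v Q(r, 1/v)` is a function `G(v / r)`.

On the upper half, `G` changes sign from `+` to `-` at `q₀ = 1 / f(0, 𝐞)`. The ratio `q = v / r`
then has constant barriers and stays in a compact interval for all `r`
(`IsNeckArc.exists_isBranch_bowl`). Writing `G(q) = (q₀ - q) H(q)`, the quantity `r v - q₀ r²` is
attracted to `-(q₀ H(q₀))⁻¹ = -∂f/∂λ₁(0, 𝐞)`. The deviation is `O(r⁻²)`, and integrating `v` gives
the expansion (`exists_bowl_expansion`).

The lower half is reflected upwards, which replaces `Q(r, p)` by `Q(r, -p)`. For the root with `k`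
even nothing changes. For `k` odd both terms of `Q` become positive and the slope falls to `0` at a
finite radius `ρ`; exchanging the roles of `r` and `v` removes the singularity there
(`IsNeckArc.exists_isBranch_terminating`). For the quotient the logarithmic derivative of `v` lies
between two negative bounds, so `v` stays positive and decays like a power of `r`
(`IsNeckArc.exists_isBranch_decay`).

For odd `k` the wing cannot be continued past `|x| = ρ`. Its tangent plane is horizontal along that
whole sphere, so on any translator containing it at most one principal curvature is nonzero. Then
`S_k = 0`, since `k ≥ 2`, whereas `⟨ν, e_{n+1}⟩ = ±1` (`not_isTranslatorAt_of_horizontal`).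
`isWingLike_wing` assembles neck and branches. -/

theorem hasDerivAt_of_eventually_punctured {f g : ℝ → ℝ} {x : ℝ}
    (h : ∀ᶠ y in 𝓝[≠] x, HasDerivAt f (g y) y) (hf : ContinuousAt f x)
    (hg : ContinuousAt g x) : HasDerivAt f (g x) x := by
  have hr : {y | HasDerivAt f (g y) y} ∈ 𝓝[>] x := nhdsGT_le_nhdsNE x h
  have hl : {y | HasDerivAt f (g y) y} ∈ 𝓝[<] x := nhdsLT_le_nhdsNE x h
  have A : HasDerivWithinAt f (g x) (Ici x) x := by
    refine hasDerivWithinAt_Ici_of_tendsto_deriv (s := {y | HasDerivAt f (g y) y})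
      (fun y hy => hy.differentiableAt.differentiableWithinAt) hf.continuousWithinAt hr ?_
    refine (tendsto_inf_left hg : Tendsto g (𝓝[>] x) (𝓝 (g x))).congr' ?_
    filter_upwards [hr] with y hy using hy.deriv.symm
  have B : HasDerivWithinAt f (g x) (Iic x) x := by
    refine hasDerivWithinAt_Iic_of_tendsto_deriv (s := {y | HasDerivAt f (g y) y})
      (fun y hy => hy.differentiableAt.differentiableWithinAt) hf.continuousWithinAt hl ?_
    refine (tendsto_inf_left hg : Tendsto g (𝓝[<] x) (𝓝 (g x))).congr' ?_
    filter_upwards [hl] with y hy using hy.deriv.symm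
  simpa using B.union A

/-- A function that does not increase while it exceeds `M` never crosses the level `M`. -/
theorem le_of_hasDerivAt_nonpos_above {y : ℝ → ℝ} {a b M : ℝ} (hab : a ≤ b)
    (hc : ContinuousOn y (Icc a b)) (ha : y a ≤ M)
    (hd : ∀ t ∈ Ioo a b, M < y t → ∃ d ≤ 0, HasDerivAt y d t) : y b ≤ M := by
  by_contra! hb
  -- After the last time at which `y ≤ M` the hypothesis makes `y` nonincreasing all the way to `b`.
  set S := {t ∈ Icc a b | y t ≤ M} with hS
  have hSc : IsCompact S := by
    have : IsClosed S := by
      have := hc.preimage_isClosed_of_isClosed isClosed_Icc (isClosed_Iic (a := M))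
      exact this
    exact isCompact_Icc.of_isClosed_subset this (fun t ht => ht.1)
  have hne : S.Nonempty := ⟨a, ⟨le_rfl, hab⟩, ha⟩
  have hs := hSc.sSup_mem hne
  set s := sSup S
  have hsb : s ≤ b := hs.1.2
  have habove : ∀ t ∈ Ioc s b, M < y t := fun t ht => by
    by_contra! h
    exact absurd (le_csSup hSc.bddAbove (show t ∈ S from ⟨⟨hs.1.1.trans ht.1.le, ht.2⟩, h⟩))
      (not_le.2 ht.1)
  have hder : ∀ t ∈ Ioo s b, ∃ d ≤ 0, HasDerivAt y d t := fun t ht =>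
    hd t ⟨hs.1.1.trans_lt ht.1, ht.2⟩ (habove t ⟨ht.1, ht.2.le⟩)
  have hanti : AntitoneOn y (Icc s b) := by
    refine antitoneOn_of_deriv_nonpos (convex_Icc s b)
      (hc.mono (Icc_subset_Icc_left hs.1.1)) ?_ ?_
    · rw [interior_Icc]
      intro t ht
      obtain ⟨d, -, h⟩ := hder t ht
      exact h.differentiableAt.differentiableWithinAt
    · rw [interior_Icc]
      intro t ht
      obtain ⟨d, hd0, h⟩ := hder t ht
      rwa [h.deriv]
  have := hanti ⟨le_rfl, hsb⟩ ⟨hsb, le_rfl⟩ hsb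
  linarith [hs.2]

theorem le_of_hasDerivAt_nonneg_below {y : ℝ → ℝ} {a b m : ℝ} (hab : a ≤ b)
    (hc : ContinuousOn y (Icc a b)) (ha : m ≤ y a)
    (hd : ∀ t ∈ Ioo a b, y t < m → ∃ d, 0 ≤ d ∧ HasDerivAt y d t) : m ≤ y b := by
  have := le_of_hasDerivAt_nonpos_above (y := fun t => -y t) (M := -m) hab hc.neg
    (by simpa using ha) fun t ht h => by
      obtain ⟨d, hd0, hd1⟩ := hd t ht (by simpa using h)
      exact ⟨-d, by simpa using hd0, hd1.neg⟩
  simpa using this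

/-- Bootstrapping: along `y` the right-hand side is as smooth as `y` itself, so each order of
differentiability gives the next. -/
theorem contDiffOn_infty_of_hasDerivAt {E : Type*} [NormedAddCommGroup E] [NormedSpace ℝ E]
    {F : ℝ × E → E} {Ω : Set (ℝ × E)} (hF : ContDiffOn ℝ ∞ F Ω)
    {y : ℝ → E} {I : Set ℝ} (hI : IsOpen I) (hm : ∀ t ∈ I, (t, y t) ∈ Ω)
    (hy : ∀ t ∈ I, HasDerivAt y (F (t, y t)) t) : ContDiffOn ℝ ∞ y I := by
  rw [contDiffOn_infty]
  intro m
  induction m with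
  | zero => exact contDiffOn_zero.2 fun t ht => (hy t ht).continuousAt.continuousWithinAt
  | succ m ih =>
    rw [Nat.cast_add, Nat.cast_one, contDiffOn_succ_iff_deriv_of_isOpen hI]
    refine ⟨fun t ht => (hy t ht).differentiableAt.differentiableWithinAt, by simp, ?_⟩
    have h1 : ContDiffOn ℝ m (fun t => F (t, y t)) I :=
      (hF.of_le (by exact_mod_cast le_top)).comp (contDiffOn_id.prodMk ih) hm
    exact h1.congr fun t ht => (hy t ht).deriv

/-- Existence on a whole time interval, after clamping the unknown to `[m, M]`. -/
theorem exists_hasDerivWithinAt_clamp {F : ℝ × ℝ → ℝ} {t₀ T m M : ℝ} (hT : t₀ ≤ T) (hmM : m ≤ M)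
    (hF : ContDiffOn ℝ 1 F (Icc t₀ T ×ˢ Icc m M)) (y₀ : ℝ) :
    ∃ y : ℝ → ℝ, y t₀ = y₀ ∧ ∀ t ∈ Icc t₀ T,
      HasDerivWithinAt y (F (t, max m (min M (y t)))) (Icc t₀ T) t := by
  have hcpt : IsCompact (Icc t₀ T ×ˢ Icc m M) := isCompact_Icc.prod isCompact_Icc
  obtain ⟨K, hK⟩ := hF.exists_lipschitzOnWith one_ne_zero
    ((convex_Icc t₀ T).prod (convex_Icc m M)) hcpt
  obtain ⟨L, hL⟩ := hcpt.exists_bound_of_continuousOn hF.continuousOn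
  have hmem : ∀ x : ℝ, max m (min M x) ∈ Icc m M := fun x =>
    ⟨le_max_left _ _, max_le hmM (min_le_left _ _)⟩
  have hL0 : 0 ≤ L := (norm_nonneg _).trans (hL (t₀, m) ⟨⟨le_rfl, hT⟩, ⟨le_rfl, hmM⟩⟩)
  have hclamp : LipschitzWith 1 (fun x : ℝ => max m (min M x)) := by
    have := (LipschitzWith.id (α := ℝ)).const_min M |>.const_max m
    simpa using this
  -- The clamped field is bounded by `L`, so a solution cannot leave the ball of radius `L * (T -
  -- t₀)` before time `T`: one application covers the whole interval.
  have hPL : IsPicardLindelof (fun t x => F (t, max m (min M x))) (tmin := t₀) (tmax := T)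
      ⟨t₀, le_rfl, hT⟩ y₀ (Real.toNNReal (L * (T - t₀))) 0 (Real.toNNReal L) K := by
    refine ⟨fun t ht => ?_, fun x _ => ?_, fun t ht x _ => ?_, ?_⟩
    · refine LipschitzOnWith.of_dist_le_mul fun x _ x' _ => ?_
      refine (hK.dist_le_mul _ ⟨ht, hmem x⟩ _ ⟨ht, hmem x'⟩).trans ?_
      refine mul_le_mul_of_nonneg_left ?_ K.2
      simpa [Prod.dist_eq] using hclamp.dist_le_mul x x'
    · exact hF.continuousOn.comp (by fun_prop) fun t ht => ⟨ht, hmem x⟩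
    · rw [Real.coe_toNNReal L hL0]
      exact hL _ ⟨ht, hmem x⟩
    · have : 0 ≤ T - t₀ := by linarith
      simp [Real.coe_toNNReal L hL0, Real.coe_toNNReal _ (mul_nonneg hL0 this), this]
  exact hPL.exists_eq_forall_mem_Icc_hasDerivWithinAt₀

/-- Existence on a compact time interval inside a strip bounded below by a barrier and above by a
bound on the growth. -/
theorem exists_solution_Icc_of_growth {F : ℝ × ℝ → ℝ} {t₀ T m M L : ℝ} (hT : t₀ ≤ T)
    (hF : ContDiffOn ℝ 1 F (Icc t₀ T ×ˢ Icc m M))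
    (hnn : ∀ t ∈ Icc t₀ T, ∀ x ∈ Icc m M, 0 ≤ F (t, x))
    (hL : ∀ t ∈ Icc t₀ T, ∀ x ∈ Icc m M, F (t, x) ≤ L) (hL0 : 0 ≤ L)
    (hM : m + L * (T - t₀) ≤ M) :
    ∃ y : ℝ → ℝ, y t₀ = m ∧ ContinuousOn y (Icc t₀ T) ∧ (∀ t ∈ Icc t₀ T, y t ∈ Icc m M) ∧
      ∀ t ∈ Ioo t₀ T, HasDerivAt y (F (t, y t)) t := by
  have hmM : m ≤ M := by nlinarith [mul_nonneg hL0 (sub_nonneg.2 hT)]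
  obtain ⟨y, hy0, hy⟩ := exists_hasDerivWithinAt_clamp hT hmM hF m
  have hmem : ∀ x : ℝ, max m (min M x) ∈ Icc m M := fun x =>
    ⟨le_max_left _ _, max_le hmM (min_le_left _ _)⟩
  have hcont : ContinuousOn y (Icc t₀ T) := fun t ht => (hy t ht).continuousWithinAt
  have hd : ∀ t ∈ Ioo t₀ T, HasDerivAt y (F (t, max m (min M (y t)))) t := fun t ht =>
    (hy t (Ioo_subset_Icc_self ht)).hasDerivAt (Icc_mem_nhds ht.1 ht.2)
  have hstrip : ∀ t ∈ Icc t₀ T, y t ∈ Icc m M := by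
    intro t ht
    have hc := hcont.mono (Icc_subset_Icc_right ht.2)
    constructor
    · refine le_of_hasDerivAt_nonneg_below ht.1 hc hy0.ge fun s hs _ => ?_
      have hs' : s ∈ Ioo t₀ T := ⟨hs.1, hs.2.trans_le ht.2⟩
      exact ⟨_, hnn s (Ioo_subset_Icc_self hs') _ (hmem _), hd s hs'⟩
    · have : y t - L * (t - t₀) ≤ m := by
        refine le_of_hasDerivAt_nonpos_above (y := fun s => y s - L * (s - t₀)) ht.1
          (hc.sub (by fun_prop)) (by simp [hy0]) fun s hs _ => ?_
        have hs' : s ∈ Ioo t₀ T := ⟨hs.1, hs.2.trans_le ht.2⟩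
        refine ⟨F (s, max m (min M (y s))) - L * 1, ?_,
          (hd s hs').sub (((hasDerivAt_id s).sub_const t₀).const_mul L)⟩
        linarith [hL s (Ioo_subset_Icc_self hs') _ (hmem (y s))]
      nlinarith [ht.2]
  refine ⟨y, hy0, hcont, hstrip, fun t ht => ?_⟩
  have h := hstrip t (Ioo_subset_Icc_self ht)
  have := hd t ht
  rwa [min_eq_right h.2, max_eq_right h.1] at this

/-- Existence on a compact time interval inside a strip between two barriers. -/
theorem exists_solution_Icc_of_barriers {F : ℝ × ℝ → ℝ} {t₀ T m M y₀ : ℝ} (hT : t₀ ≤ T)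
    (hF : ContDiffOn ℝ 1 F (Icc t₀ T ×ˢ Icc m M))
    (hm : ∀ t ∈ Icc t₀ T, 0 ≤ F (t, m)) (hM : ∀ t ∈ Icc t₀ T, F (t, M) ≤ 0)
    (hy₀ : y₀ ∈ Icc m M) :
    ∃ y : ℝ → ℝ, y t₀ = y₀ ∧ ContinuousOn y (Icc t₀ T) ∧ (∀ t ∈ Icc t₀ T, y t ∈ Icc m M) ∧
      ∀ t ∈ Ioo t₀ T, HasDerivAt y (F (t, y t)) t := by
  have hmM : m ≤ M := hy₀.1.trans hy₀.2
  obtain ⟨y, hy0, hy⟩ := exists_hasDerivWithinAt_clamp hT hmM hF y₀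
  have hcont : ContinuousOn y (Icc t₀ T) := fun t ht => (hy t ht).continuousWithinAt
  have hd : ∀ t ∈ Ioo t₀ T, HasDerivAt y (F (t, max m (min M (y t)))) t := fun t ht =>
    (hy t (Ioo_subset_Icc_self ht)).hasDerivAt (Icc_mem_nhds ht.1 ht.2)
  have hstrip : ∀ t ∈ Icc t₀ T, y t ∈ Icc m M := by
    intro t ht
    have hc := hcont.mono (Icc_subset_Icc_right ht.2)
    constructor
    · refine le_of_hasDerivAt_nonneg_below ht.1 hc (hy0 ▸ hy₀.1) fun s hs h => ?_
      have hs' : s ∈ Ioo t₀ T := ⟨hs.1, hs.2.trans_le ht.2⟩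
      refine ⟨_, ?_, hd s hs'⟩
      rw [max_eq_left ((min_le_right _ _).trans h.le)]
      exact hm s (Ioo_subset_Icc_self hs')
    · refine le_of_hasDerivAt_nonpos_above ht.1 hc (hy0 ▸ hy₀.2) fun s hs h => ?_
      have hs' : s ∈ Ioo t₀ T := ⟨hs.1, hs.2.trans_le ht.2⟩
      refine ⟨_, ?_, hd s hs'⟩
      rw [min_eq_left h.le, max_eq_right hmM]
      exact hM s (Ioo_subset_Icc_self hs')
  refine ⟨y, hy0, hcont, hstrip, fun t ht => ?_⟩
  have h := hstrip t (Ioo_subset_Icc_self ht)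
  have := hd t ht
  rwa [min_eq_right h.2, max_eq_right h.1] at this

/-- Existence for all later times inside a strip between two barriers. -/
theorem exists_solution_Ici_of_barriers {F : ℝ × ℝ → ℝ} {t₀ m M y₀ : ℝ}
    (hF : ContDiffOn ℝ 1 F (Ici t₀ ×ˢ Icc m M))
    (hm : ∀ t ∈ Ici t₀, 0 ≤ F (t, m)) (hM : ∀ t ∈ Ici t₀, F (t, M) ≤ 0)
    (hy₀ : y₀ ∈ Icc m M) :
    ∃ y : ℝ → ℝ, y t₀ = y₀ ∧ ContinuousOn y (Ici t₀) ∧ (∀ t ∈ Ici t₀, y t ∈ Icc m M) ∧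
      ∀ t ∈ Ioi t₀, HasDerivAt y (F (t, y t)) t := by
  have hT : ∀ N : ℕ, t₀ ≤ t₀ + N := fun N => by simp
  have hsub : ∀ N : ℕ, Icc t₀ (t₀ + N) ×ˢ Icc m M ⊆ Ici t₀ ×ˢ Icc m M := fun N =>
    prod_mono Icc_subset_Ici_self le_rfl
  choose y hy0 hyc hys hyd using fun N : ℕ => exists_solution_Icc_of_barriers (hT N)
    (hF.mono (hsub N)) (fun t ht => hm t ht.1) (fun t ht => hM t ht.1) hy₀
  have hder : ∀ N : ℕ, ∀ t ∈ Ico t₀ (t₀ + N), HasDerivWithinAt (y N) (F (t, y N t)) (Ici t) t := by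
    intro N t ht
    rcases eq_or_lt_of_le ht.1 with h | h
    · subst h
      have hN : t₀ < t₀ + N := ht.2
      refine hasDerivWithinAt_Ici_of_tendsto_deriv (s := Ioo t₀ (t₀ + N))
        (fun s hs => (hyd N s hs).differentiableAt.differentiableWithinAt)
        ((hyc N t₀ ⟨le_rfl, hT N⟩).mono Ioo_subset_Icc_self) (Ioo_mem_nhdsGT hN) ?_
      have hcont : ContinuousWithinAt (fun s => F (s, y N s)) (Icc t₀ (t₀ + N)) t₀ := by
        have : ContinuousOn (fun s => F (s, y N s)) (Icc t₀ (t₀ + N)) :=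
          hF.continuousOn.comp (continuousOn_id.prodMk (hyc N)) fun s hs => ⟨hs.1, hys N s hs⟩
        exact this t₀ ⟨le_rfl, hT N⟩
      have h1 : Tendsto (fun s => F (s, y N s)) (𝓝[>] t₀) (𝓝 (F (t₀, y N t₀))) := by
        refine hcont.tendsto.mono_left ?_
        rw [← nhdsWithin_Ioo_eq_nhdsGT hN]
        exact nhdsWithin_mono _ Ioo_subset_Icc_self
      refine h1.congr' ?_
      filter_upwards [Ioo_mem_nhdsGT hN] with s hs using (hyd N s hs).deriv.symm
    · exact (hyd N t ⟨h, ht.2⟩).hasDerivWithinAt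
  have hagree : ∀ N N' : ℕ, N ≤ N' → EqOn (y N) (y N') (Icc t₀ (t₀ + N)) := by
    intro N N' hNN
    have hNN' : (t₀ + N : ℝ) ≤ t₀ + N' := by gcongr
    obtain ⟨K, hK⟩ := (hF.mono (hsub N)).exists_lipschitzOnWith one_ne_zero
      ((convex_Icc _ _).prod (convex_Icc m M)) (isCompact_Icc.prod isCompact_Icc)
    refine ODE_solution_unique_of_mem_Icc_right (v := fun t x => F (t, x))
      (s := fun _ => Icc m M) (K := K) ?_ (hyc N) (hder N)
      (fun t ht => hys N t ⟨ht.1, ht.2.le⟩) ((hyc N').mono (Icc_subset_Icc_right hNN'))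
      (fun t ht => hder N' t ⟨ht.1, ht.2.trans_le hNN'⟩)
      (fun t ht => hys N' t ⟨ht.1, ht.2.le.trans hNN'⟩) (by rw [hy0, hy0])
    intro t ht
    refine LipschitzOnWith.of_dist_le_mul fun x hx x' hx' => ?_
    have := hK.dist_le_mul (t, x) ⟨⟨ht.1, ht.2.le⟩, hx⟩ (t, x') ⟨⟨ht.1, ht.2.le⟩, hx'⟩
    simpa [Prod.dist_eq] using this
  -- The extra `1` keeps `t` strictly before the end of the interval on which the chosen solution
  -- lives.
  set Y : ℝ → ℝ := fun t => y (⌈t - t₀⌉₊ + 1) t with hY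
  have hYN : ∀ N : ℕ, EqOn Y (y N) (Icc t₀ (t₀ + N)) := by
    intro N t ht
    have h1 : t ≤ t₀ + (⌈t - t₀⌉₊ + 1 : ℕ) := by
      have := Nat.le_ceil (t - t₀)
      push_cast
      linarith
    rcases le_total (⌈t - t₀⌉₊ + 1) N with h | h
    · exact hagree _ _ h ⟨ht.1, h1⟩
    · exact (hagree _ _ h ht).symm
  have hbig : ∀ t : ℝ, t < t₀ + (⌈t - t₀⌉₊ + 1 : ℕ) := fun t => by
    have := Nat.le_ceil (t - t₀)
    push_cast
    linarith
  refine ⟨Y, ?_, fun t ht => ?_, fun t ht => ?_, fun t ht => ?_⟩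
  · rw [hYN 0 (by simp), hy0]
  · have hn := hbig t
    set N := ⌈t - t₀⌉₊ + 1
    have h1 : ContinuousWithinAt Y (Icc t₀ (t₀ + N)) t :=
      ((hyc N).congr (hYN N)) t ⟨ht, hn.le⟩
    refine h1.mono_of_mem_nhdsWithin ?_
    exact mem_nhdsWithin.2 ⟨Iio (t₀ + N), isOpen_Iio, hn, fun s hs => ⟨hs.2, hs.1.le⟩⟩
  · exact hys _ t ⟨ht, (hbig t).le⟩
  · have hn := hbig t
    have hYt : Y t = y (⌈t - t₀⌉₊ + 1) t := rfl
    set N := ⌈t - t₀⌉₊ + 1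
    refine (hyd N t ⟨ht, hn⟩).congr_of_eventuallyEq ?_
    filter_upwards [Ioo_mem_nhds ht hn] with s hs using hYN N (Ioo_subset_Icc_self hs)

/-- The inverse of a function with positive derivative. -/
theorem exists_inverse_of_hasDerivAt_pos {f f' : ℝ → ℝ} {a b : ℝ} (hab : a < b)
    (hc : ContinuousOn f (Icc a b)) (hd : ∀ t ∈ Ioo a b, HasDerivAt f (f' t) t)
    (hpos : ∀ t ∈ Ioo a b, 0 < f' t) :
    f a < f b ∧ ∃ h : ℝ → ℝ, (∀ t ∈ Icc a b, f t ∈ Icc (f a) (f b) ∧ h (f t) = t) ∧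
      (∀ s ∈ Icc (f a) (f b), h s ∈ Icc a b ∧ f (h s) = s) ∧
      (∀ s ∈ Ioo (f a) (f b), h s ∈ Ioo a b) ∧
      ContinuousOn h (Icc (f a) (f b)) ∧
      ∀ s ∈ Ioo (f a) (f b), HasDerivAt h (f' (h s))⁻¹ s := by
  have hmono : StrictMonoOn f (Icc a b) := by
    refine strictMonoOn_of_deriv_pos (convex_Icc a b) hc fun t ht => ?_
    rw [interior_Icc] at ht
    rw [(hd t ht).deriv]
    exact hpos t ht
  have hA : a ∈ Icc a b := ⟨le_rfl, hab.le⟩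
  have hB : b ∈ Icc a b := ⟨hab.le, le_rfl⟩
  have hlt := hmono hA hB hab
  have hsurj : ∀ s ∈ Icc (f a) (f b), ∃ t ∈ Icc a b, f t = s := fun s hs =>
    intermediate_value_Icc hab.le hc hs
  have hmaps : ∀ t ∈ Icc a b, f t ∈ Icc (f a) (f b) := fun t ht =>
    ⟨hmono.monotoneOn hA ht ht.1, hmono.monotoneOn ht hB ht.2⟩
  set h : ℝ → ℝ := Function.invFunOn f (Icc a b)
  have hinv : ∀ t ∈ Icc a b, h (f t) = t := fun t ht =>
    hmono.injOn.leftInvOn_invFunOn ht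
  have hri : ∀ s ∈ Icc (f a) (f b), h s ∈ Icc a b ∧ f (h s) = s := fun s hs =>
    ⟨Function.invFunOn_mem (hsurj s hs), Function.invFunOn_eq (hsurj s hs)⟩
  have hio : ∀ s ∈ Ioo (f a) (f b), h s ∈ Ioo a b := fun s hs => by
    obtain ⟨h1, h2⟩ := hri s (Ioo_subset_Icc_self hs)
    refine ⟨lt_of_le_of_ne h1.1 ?_, lt_of_le_of_ne h1.2 ?_⟩
    · intro e
      rw [← e] at h2
      exact absurd h2 hs.1.ne
    · intro e
      rw [e] at h2
      exact absurd h2 hs.2.ne'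
  -- The preimage under `h` of a closed set is the image under `f` of a compact set, hence closed.
  have hcont : ContinuousOn h (Icc (f a) (f b)) := by
    rw [continuousOn_iff_isClosed]
    intro C hC
    refine ⟨f '' (Icc a b ∩ C), ?_, ?_⟩
    · exact ((isCompact_Icc.inter_right hC).image_of_continuousOn
        (hc.mono inter_subset_left)).isClosed
    · ext s
      constructor
      · rintro ⟨h1, h2⟩
        exact ⟨⟨h s, ⟨(hri s h2).1, h1⟩, (hri s h2).2⟩, h2⟩
      · rintro ⟨⟨t, ht, rfl⟩, h2⟩
        refine ⟨?_, h2⟩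
        rw [mem_preimage, hinv t ht.1]
        exact ht.2
  refine ⟨hlt, h, fun t ht => ⟨hmaps t ht, hinv t ht⟩, hri, hio, hcont, fun s hs => ?_⟩
  have hsn : Icc (f a) (f b) ∈ 𝓝 s := Icc_mem_nhds hs.1 hs.2
  refine HasDerivAt.of_local_left_inverse (hcont.continuousAt hsn) (hd _ (hio s hs))
    (hpos _ (hio s hs)).ne' ?_
  filter_upwards [hsn] with x hx using (hri x hx).2

end ODE

/-! ### Profile curves -/

section Profile

open Set

/-- A profile curve `r = g(z)` through the neck `g(0) = R`, solving `g'' = (1 + g'²) Q(g, g')`. -/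
structure IsNeckArc (Q : ℝ × ℝ → ℝ) (Ω : Set (ℝ × ℝ)) (R δ : ℝ) (g p : ℝ → ℝ) : Prop where
  g_zero : g 0 = R
  p_zero : p 0 = 0
  mem : ∀ z ∈ Ioo (-δ) δ, (g z, p z) ∈ Ω
  deriv_g : ∀ z ∈ Ioo (-δ) δ, HasDerivAt g (p z) z
  deriv_p : ∀ z ∈ Ioo (-δ) δ, HasDerivAt p ((1 + p z ^ 2) * Q (g z, p z)) z

/-- With `z` as the variable the equation is regular at the neck, whereas a graph over `r` has
infinite slope there. The interval is shrunk so that the solution stays in `Ω`. -/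
theorem exists_isNeckArc {Q : ℝ × ℝ → ℝ} {Ω : Set (ℝ × ℝ)} (hΩ : IsOpen Ω)
    (hQ : ContDiffOn ℝ ∞ Q Ω) {R : ℝ} (hR : (R, 0) ∈ Ω) :
    ∃ δ > 0, ∃ g p, IsNeckArc Q Ω R δ g p ∧ ContDiffOn ℝ ∞ g (Ioo (-δ) δ) := by
  set X : ℝ × ℝ → ℝ × ℝ := fun x => (x.2, (1 + x.2 ^ 2) * Q x) with hX
  have hXs : ContDiffOn ℝ ∞ X Ω :=
    contDiffOn_snd.prodMk ((contDiffOn_const.add (contDiffOn_snd.pow 2)).mul hQ)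
  obtain ⟨α, hα0, ε, hε, hα⟩ :=
    ((hXs.contDiffAt (hΩ.mem_nhds hR)).of_le
      (by simp)).exists_forall_mem_closedBall_exists_eq_forall_mem_Ioo_hasDerivAt₀ 0
  have hcont : ContinuousAt α 0 := (hα 0 (by simp [hε])).continuousAt
  have hnear : ∀ᶠ z in 𝓝 (0 : ℝ), α z ∈ Ω := hcont.eventually_mem (hα0 ▸ hΩ.mem_nhds hR)
  obtain ⟨η, hη, hball⟩ := Metric.eventually_nhds_iff.1 hnear
  have hsub : ∀ z ∈ Ioo (-min ε η) (min ε η), z ∈ Ioo (0 - ε) (0 + ε) ∧ α z ∈ Ω := by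
    intro z hz
    have h := abs_lt.2 hz
    have h1 := abs_lt.1 (h.trans_le (min_le_left _ _))
    refine ⟨by simpa using h1, hball ?_⟩
    simpa using h.trans_le (min_le_right _ _)
  refine ⟨min ε η, lt_min hε hη, fun z => (α z).1, fun z => (α z).2,
    ⟨by simp [hα0], by simp [hα0], fun z hz => (hsub z hz).2, fun z hz => ?_, fun z hz => ?_⟩, ?_⟩
  · exact (hasFDerivAt_fst.comp_hasDerivAt z (hα z (hsub z hz).1) :)
  · exact (hasFDerivAt_snd.comp_hasDerivAt z (hα z (hsub z hz).1) :)
  · have := contDiffOn_infty_of_hasDerivAt (F := fun x : ℝ × (ℝ × ℝ) => X x.2)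
      (Ω := Prod.snd ⁻¹' Ω) (hXs.comp contDiffOn_snd fun x hx => hx) isOpen_Ioo
      (fun z hz => (hsub z hz).2) fun z hz => hα z (hsub z hz).1
    exact contDiffOn_fst.comp this (mapsTo_univ _ _) 

/-- Reflection of a profile curve at the plane of its neck. -/
theorem IsNeckArc.reflect {Q : ℝ × ℝ → ℝ} {Ω : Set (ℝ × ℝ)} {R δ : ℝ} {g p : ℝ → ℝ}
    (h : IsNeckArc Q Ω R δ g p) :
    IsNeckArc (fun x => Q (x.1, -x.2)) {x | (x.1, -x.2) ∈ Ω} R δ (fun z => g (-z))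
      (fun z => -p (-z)) := by
  have hm : ∀ z ∈ Ioo (-δ) δ, -z ∈ Ioo (-δ) δ := fun z hz =>
    ⟨by linarith [hz.2], by linarith [hz.1]⟩
  refine ⟨by simp [h.g_zero], by simp [h.p_zero], fun z hz => by simpa using h.mem _ (hm z hz),
    fun z hz => ?_, fun z hz => ?_⟩
  · convert! (h.deriv_g _ (hm z hz)).scomp z (hasDerivAt_neg z) using 1
    simp
  · convert! ((h.deriv_p _ (hm z hz)).scomp z (hasDerivAt_neg z)).neg using 1
    simp

/-- A half of a profile curve, as the graph of a function `u` of `r ≥ R` with slope `v`, which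
solves the profile equation over `I`, with `(r, v⁻¹)` in the domain `A` of the equation. -/
structure IsBranch (Q : ℝ × ℝ → ℝ) (A : Set (ℝ × ℝ)) (R : ℝ) (I : Set ℝ) (g u v : ℝ → ℝ) :
    Prop where
  u_neck : u R = 0
  cont_u : ContinuousOn u (Ici R)
  cont_v : ContinuousOn v (Ioi R)
  deriv_u : ∀ r > R, HasDerivAt u (v r) r
  v_nonneg : ∀ r > R, 0 ≤ v r
  v_pos : ∀ r ∈ I, 0 < v r
  mem : ∀ r ∈ I, (r, (v r)⁻¹) ∈ A
  deriv_v : ∀ r ∈ I, HasDerivAt v (-((1 + v r ^ 2) * v r * Q (r, (v r)⁻¹))) r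
  near_neck : ∃ ε > 0, ∀ r ≥ R, ∀ z ∈ Ico 0 ε, u r = z ↔ r = g z

theorem continuousAt_ite_lt {f₁ f₂ : ℝ → ℝ} {c : ℝ} (h₁ : ContinuousAt f₁ c)
    (h₂ : ContinuousWithinAt f₂ (Ici c) c) (h : f₁ c = f₂ c) :
    ContinuousAt (fun r => if r < c then f₁ r else f₂ r) c := by
  rw [continuousAt_iff_continuous_left'_right']
  constructor
  · refine (h₁.continuousWithinAt (s := Iio c)).congr (fun r hr => if_pos hr) ?_
    simp [h]
  · refine (h₂.mono Ioi_subset_Ici_self).congr (fun r hr => if_neg (not_lt.2 (le_of_lt hr))) ?_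
    simp

/-- Since `Q > 0`, `p` is strictly increasing, and it vanishes at `0`. -/
theorem IsNeckArc.p_pos {Q : ℝ × ℝ → ℝ} {Ω : Set (ℝ × ℝ)} {R δ : ℝ} {g p : ℝ → ℝ}
    (hQ : ∀ x ∈ Ω, 0 < Q x) (h : IsNeckArc Q Ω R δ g p) : ∀ z ∈ Ioo 0 δ, 0 < p z := by
  intro z hz
  have hδ : 0 < δ := hz.1.trans hz.2
  have hm : StrictMonoOn p (Ioo (-δ) δ) := by
    refine strictMonoOn_of_deriv_pos (convex_Ioo _ _)
      (fun z hz => (h.deriv_p z hz).continuousAt.continuousWithinAt) fun z hz => ?_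
    rw [interior_Ioo] at hz
    rw [(h.deriv_p z hz).deriv]
    exact mul_pos (by positivity) (hQ _ (h.mem z hz))
  have := hm (a := 0) (b := z) ⟨by linarith, hδ⟩ ⟨by linarith [hz.1], hz.2⟩ hz.1
  rwa [h.p_zero] at this

theorem IsNeckArc.lt_g {Q : ℝ × ℝ → ℝ} {Ω : Set (ℝ × ℝ)} {R δ : ℝ} {g p : ℝ → ℝ}
    (hQ : ∀ x ∈ Ω, 0 < Q x) (h : IsNeckArc Q Ω R δ g p) : ∀ z ∈ Ioo 0 δ, R < g z := by
  intro z hz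
  have hm : StrictMonoOn g (Icc 0 z) := by
    refine strictMonoOn_of_deriv_pos (convex_Icc _ _) (fun s hs =>
      (h.deriv_g s ⟨by linarith [hz.1, hz.2, hs.1], hs.2.trans_lt hz.2⟩).continuousAt.continuousWithinAt)
      fun s hs => ?_
    rw [interior_Icc] at hs
    rw [(h.deriv_g s ⟨by linarith [hz.1, hz.2, hs.1], hs.2.trans hz.2⟩).deriv]
    exact h.p_pos hQ s ⟨hs.1, hs.2.trans hz.2⟩
  have := hm (a := 0) (b := z) ⟨le_rfl, hz.1.le⟩ ⟨hz.1.le, le_rfl⟩ hz.1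
  rwa [h.g_zero] at this

/-- A solution `w` of the profile equation on `r ≥ g(ζ)` continues the half neck up to height `ζ`. -/
theorem IsNeckArc.exists_isBranch {Q : ℝ × ℝ → ℝ} {Ω : Set (ℝ × ℝ)} (hΩ : IsOpen Ω)
    (hQc : ContinuousOn Q Ω) (hQ : ∀ x ∈ Ω, 0 < Q x) {R δ ζ : ℝ} {g p w : ℝ → ℝ}
    (h : IsNeckArc Q Ω R δ g p) (hζ : ζ ∈ Ioo 0 δ) {I : Set ℝ} (hI : IsOpen I)
    (hIR : I ⊆ Ioi R) (hw1 : w (g ζ) = (p ζ)⁻¹) (hwc : ContinuousOn w (Ici (g ζ)))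
    (hw0 : ∀ r ≥ g ζ, 0 ≤ w r) (hwpos : ∀ r ∈ I, g ζ < r → 0 < w r)
    {A : Set (ℝ × ℝ)} (hΩA : Ω ⊆ A) (hwA : ∀ r ∈ I, g ζ < r → (r, (w r)⁻¹) ∈ A)
    (hw : ∀ r ∈ I, g ζ < r → HasDerivAt w (-((1 + w r ^ 2) * w r * Q (r, (w r)⁻¹))) r) :
    R < g ζ ∧ ∃ u v, IsBranch Q A R I g u v ∧ EqOn v w (Ici (g ζ)) := by
  have hδ : 0 < δ := hζ.1.trans hζ.2
  have hp := h.p_pos hQ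
  set r₁ := g ζ with hr₁
  -- Inverting `g` slightly beyond `ζ` makes `r₁` an interior point, so the inverse has a two-sided
  -- derivative there.
  obtain ⟨ξ, hξ1, hξ2⟩ := exists_between hζ.2
  have hξ : 0 < ξ := hζ.1.trans hξ1
  have hsub : ∀ z ∈ Icc 0 ξ, z ∈ Ioo (-δ) δ := fun z hz =>
    ⟨by linarith [hz.1], hz.2.trans_lt hξ2⟩
  obtain ⟨-, k, hk1, hk2, hk3, hkc, hkd⟩ := exists_inverse_of_hasDerivAt_pos hξ
    (fun z hz => (h.deriv_g z (hsub z hz)).continuousAt.continuousWithinAt)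
    (fun z hz => h.deriv_g z (hsub z (Ioo_subset_Icc_self hz)))
    (fun z hz => hp z ⟨hz.1, hz.2.trans hξ2⟩)
  rw [h.g_zero] at hk1 hk2 hk3 hkc hkd
  have hmono : StrictMonoOn g (Icc 0 ξ) := by
    refine strictMonoOn_of_deriv_pos (convex_Icc _ _)
      (fun z hz => (h.deriv_g z (hsub z hz)).continuousAt.continuousWithinAt) fun z hz => ?_
    rw [interior_Icc] at hz
    rw [(h.deriv_g z (hsub z (Ioo_subset_Icc_self hz))).deriv]
    exact hp z ⟨hz.1, hz.2.trans hξ2⟩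
  have hRr₁ : R < r₁ := h.lt_g hQ ζ hζ
  have hr₁ξ : r₁ < g ξ := hmono ⟨hζ.1.le, hξ1.le⟩ ⟨hξ.le, le_rfl⟩ hξ1
  have hkζ : k r₁ = ζ := (hk1 ζ ⟨hζ.1.le, hξ1.le⟩).2
  have hio : ∀ r ∈ Ioc R r₁, r ∈ Ioo R (g ξ) := fun r hr => ⟨hr.1, hr.2.trans_lt hr₁ξ⟩
  have hkp : ∀ r ∈ Ioc R r₁, k r ∈ Ioo (-δ) δ ∧ 0 < p (k r) := fun r hr => by
    have := hk3 r (hio r hr)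
    exact ⟨hsub _ (Ioo_subset_Icc_self this), hp _ ⟨this.1, this.2.trans hξ2⟩⟩
  set v : ℝ → ℝ := fun r => if r < r₁ then (p (k r))⁻¹ else w r with hv
  -- Freezing `w` to the left of `r₁` makes the integrand continuous on all of `ℝ`, so the
  -- fundamental theorem of calculus applies at every `r`.
  have hwe : Continuous fun s => w (max r₁ s) :=
    hwc.comp_continuous (by fun_prop) fun s => mem_Ici.2 (le_max_left _ _)
  set u : ℝ → ℝ := fun r => if r < r₁ then k r else ζ + ∫ s in r₁..r, w (max r₁ s) with hu
  have hvl : ∀ r < r₁, v r = (p (k r))⁻¹ := fun r hr => if_pos hr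
  have hvr : ∀ r ≥ r₁, v r = w r := fun r hr => if_neg (not_lt.2 hr)
  have hul : ∀ r < r₁, u r = k r := fun r hr => if_pos hr
  have hint : ∀ r, HasDerivAt (fun r => ζ + ∫ s in r₁..r, w (max r₁ s)) (w (max r₁ r)) r :=
    fun r => ((hwe.integral_hasStrictDerivAt r₁ r).hasDerivAt).const_add ζ
  -- Chain rule with `k' = 1 / p`: the equation `p' = (1 + p²) Q` for the slope over `z` becomes the
  -- equation for its reciprocal, the slope over `r`.
  have hkp' : ∀ r ∈ Ioc R r₁, HasDerivAt (fun r => (p (k r))⁻¹)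
      (-((1 + (p (k r))⁻¹ ^ 2) * (p (k r))⁻¹ * Q (r, p (k r)))) r := by
    intro r hr
    obtain ⟨h1, h2⟩ := hkp r hr
    have h3 := ((h.deriv_p _ h1).comp r (hkd r (hio r hr))).inv h2.ne'
    rw [(hk2 r (Ioo_subset_Icc_self (hio r hr))).2] at h3
    refine HasDerivAt.congr_deriv (f := fun r => (p (k r))⁻¹) h3 ?_
    simp only [Function.comp]
    field_simp
    ring
  have hvl' : ∀ r ∈ Ioo R r₁, v =ᶠ[𝓝 r] fun r => (p (k r))⁻¹ := fun r hr => by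
    filter_upwards [Iio_mem_nhds hr.2] with s hs using hvl s hs
  have hvr' : ∀ r > r₁, v =ᶠ[𝓝 r] w := fun r hr => by
    filter_upwards [Ioi_mem_nhds hr] with s hs using hvr s (le_of_lt hs)
  have hvc1 : ContinuousAt v r₁ := by
    refine continuousAt_ite_lt (hkp' r₁ ⟨hRr₁, le_rfl⟩).continuousAt (hwc r₁ self_mem_Ici) ?_
    rw [hkζ, hw1]
  have hvc : ∀ r > R, ContinuousAt v r := by
    intro r hr
    rcases lt_trichotomy r r₁ with hlt | rfl | hgt
    · exact (hkp' r ⟨hr, hlt.le⟩).continuousAt.congr (hvl' r ⟨hr, hlt⟩).symm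
    · exact hvc1
    · exact ((hwc r (le_of_lt hgt)).continuousAt (Ici_mem_nhds hgt)).congr (hvr' r hgt).symm
  have hud : ∀ r > R, r ≠ r₁ → HasDerivAt u (v r) r := by
    intro r hr hne
    rcases lt_or_gt_of_ne hne with hlt | hgt
    · rw [hvl r hlt]
      refine (hkd r (hio r ⟨hr, hlt.le⟩)).congr_of_eventuallyEq ?_
      filter_upwards [Iio_mem_nhds hlt] with s hs using hul s hs
    · have := hint r
      rw [max_eq_right (le_of_lt hgt), ← hvr r (le_of_lt hgt)] at this
      refine this.congr_of_eventuallyEq ?_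
      filter_upwards [Ioi_mem_nhds hgt] with s hs using if_neg (not_lt.2 (le_of_lt hs))
  -- At the gluing radius only continuity has to be checked: a derivative formula valid on both
  -- sides, with a continuous right-hand side, extends across the point.
  have hud1 : HasDerivAt u (v r₁) r₁ := by
    refine hasDerivAt_of_eventually_punctured ?_ ?_ hvc1
    · filter_upwards [self_mem_nhdsWithin, mem_nhdsWithin_of_mem_nhds (Ioi_mem_nhds hRr₁)]
        with r hr hr' using hud r hr' hr
    · refine continuousAt_ite_lt (hkd r₁ (hio r₁ ⟨hRr₁, le_rfl⟩)).continuousAt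
        (hint r₁).continuousAt.continuousWithinAt ?_
      simp [hkζ]
  have hvd : ∀ r ∈ I, r ≠ r₁ → HasDerivAt v (-((1 + v r ^ 2) * v r * Q (r, (v r)⁻¹))) r := by
    intro r hr hne
    rcases lt_or_gt_of_ne hne with hlt | hgt
    · rw [hvl r hlt, inv_inv]
      exact (hkp' r ⟨hIR hr, hlt.le⟩).congr_of_eventuallyEq (hvl' r ⟨hIR hr, hlt⟩)
    · rw [hvr r (le_of_lt hgt)]
      exact (hw r hr hgt).congr_of_eventuallyEq (hvr' r hgt)
  have hv1 : v r₁ = (p ζ)⁻¹ := by rw [hvr r₁ le_rfl, hw1]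
  have hpζ := hp ζ hζ
  refine ⟨hRr₁, u, v, ⟨?_, ?_, fun r hr => (hvc r hr).continuousWithinAt, ?_, ?_, ?_, ?_, ?_, ?_⟩,
    fun r hr => hvr r hr⟩
  · rw [hul R hRr₁, ← h.g_zero, (hk1 0 ⟨le_rfl, hξ.le⟩).2]
  · intro r hr
    rcases eq_or_lt_of_le (mem_Ici.1 hr) with rfl | hlt
    · have h1 : ContinuousWithinAt k (Ici R) R :=
        (hkc R ⟨le_rfl, (hRr₁.trans hr₁ξ).le⟩).mono_of_mem_nhdsWithin
          (Icc_mem_nhdsGE (hRr₁.trans hr₁ξ))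
      refine h1.congr_of_eventuallyEq ?_ (hul R hRr₁)
      filter_upwards [mem_nhdsWithin_of_mem_nhds (Iio_mem_nhds hRr₁)] with s hs using hul s hs
    · by_cases hne : r = r₁
      · exact (hne ▸ hud1).continuousAt.continuousWithinAt
      · exact (hud r hlt hne).continuousAt.continuousWithinAt
  · intro r hr
    by_cases hne : r = r₁
    · rw [hne]
      exact hud1
    · exact hud r hr hne
  · intro r hr
    rcases lt_or_ge r r₁ with hlt | hge
    · rw [hvl r hlt]
      exact inv_nonneg.2 (hkp r ⟨hr, hlt.le⟩).2.le
    · rw [hvr r hge]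
      exact hw0 r hge
  · intro r hr
    rcases lt_trichotomy r r₁ with hlt | rfl | hgt
    · rw [hvl r hlt]
      exact inv_pos.2 (hkp r ⟨hIR hr, hlt.le⟩).2
    · rw [hv1]
      exact inv_pos.2 hpζ
    · rw [hvr r (le_of_lt hgt)]
      exact hwpos r hr hgt
  · intro r hr
    rcases le_or_gt r r₁ with hle | hgt
    · have h1 := hkp r ⟨hIR hr, hle⟩
      have h2 : v r = (p (k r))⁻¹ := by
        rcases eq_or_lt_of_le hle with rfl | hlt
        · rw [hv1, hkζ]
        · exact hvl r hlt
      rw [h2, inv_inv]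
      have h3 := h.mem _ h1.1
      rw [(hk2 r (Ioo_subset_Icc_self (hio r ⟨hIR hr, hle⟩))).2] at h3
      exact hΩA h3
    · rw [hvr r (le_of_lt hgt)]
      exact hwA r hr hgt
  · intro r hr
    by_cases hne : r = r₁
    · subst hne
      refine hasDerivAt_of_eventually_punctured
        (g := fun r => -((1 + v r ^ 2) * v r * Q (r, (v r)⁻¹))) ?_ hvc1 ?_
      · filter_upwards [self_mem_nhdsWithin, mem_nhdsWithin_of_mem_nhds (hI.mem_nhds hr)]
          with s hs hs' using hvd s hs' hs
      · have hne0 : v r₁ ≠ 0 := by rw [hv1]; exact (inv_pos.2 hpζ).ne'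
        have hmem : (r₁, (v r₁)⁻¹) ∈ Ω := by
          rw [hv1, inv_inv]
          exact h.mem ζ ⟨by linarith [hζ.1], hζ.2⟩
        have h1 : ContinuousAt (fun r => Q (r, (v r)⁻¹)) r₁ :=
          ContinuousAt.comp (f := fun r => (r, (v r)⁻¹)) (hQc.continuousAt (hΩ.mem_nhds hmem))
            (continuousAt_id.prodMk (hvc1.inv₀ hne0))
        exact (((continuousAt_const.add (hvc1.pow 2)).mul hvc1).mul h1).neg
    · exact hvd r hr hne
  -- Up to `r₁` the branch is the inverse of `g`, and beyond `r₁` its height is at least `ζ` because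
  -- `w ≥ 0`.
  · refine ⟨ζ, hζ.1, fun r hr z hz => ⟨fun e => ?_, fun e => ?_⟩⟩
    · have hlt : r < r₁ := by
        by_contra! hge
        have h1 : u r = ζ + ∫ s in r₁..r, w (max r₁ s) := if_neg (not_lt.2 hge)
        have h2 : 0 ≤ ∫ s in r₁..r, w (max r₁ s) :=
          intervalIntegral.integral_nonneg hge fun s _ => hw0 _ (le_max_left _ _)
        linarith [hz.2]
      rw [← e, hul r hlt, (hk2 r ⟨hr, (hlt.trans hr₁ξ).le⟩).2]
    · have hz' : z ∈ Icc 0 ξ := ⟨hz.1, (hz.2.trans hξ1).le⟩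
      have hlt : r < r₁ := e ▸ hmono hz' ⟨hζ.1.le, hξ1.le⟩ hz.2
      rw [hul r hlt, e, (hk1 z hz').2]

end Profile

/-! ### Continuation of the half necks as graphs over the radius -/

section Continuation

open Set

/-- Continuation of a half neck to all `r ≥ R`, with `v / r` in a compact interval: here the profile
equation is `v' = (1 + v²) G(v / r)`, where `G` changes sign from `+` to `-` at `q₀`. -/
theorem IsNeckArc.exists_isBranch_bowl {Q : ℝ × ℝ → ℝ} {Ω : Set (ℝ × ℝ)} (hΩ : IsOpen Ω)
    (hQc : ContinuousOn Q Ω) (hQ : ∀ x ∈ Ω, 0 < Q x) {R δ : ℝ} {g p : ℝ → ℝ} (hR : 0 < R)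
    (hδ : 0 < δ) (h : IsNeckArc Q Ω R δ g p) {G : ℝ → ℝ} {qm q₀ : ℝ} (hqm : 0 ≤ qm)
    (hΩG : ∀ x ∈ Ω, 0 < x.2 → qm < x.2⁻¹ / x.1)
    (hG : ContDiffOn ℝ ∞ G (Ioi qm)) (hG0 : ∀ q ≥ q₀, G q ≤ 0)
    (hGm : ∀ q₁ > qm, ∃ m, qm < m ∧ m ≤ q₁ ∧ m ≤ G m)
    {A : Set (ℝ × ℝ)} (hΩA : Ω ⊆ A) (hA : ∀ r v, 0 < r → qm < v / r → (r, v⁻¹) ∈ A)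
    (hQG : ∀ r v, 0 < r → qm < v / r → -(v * Q (r, v⁻¹)) = G (v / r)) :
    ∃ u v, IsBranch Q A R (Ioi R) g u v ∧ ∃ r₁ > R, ∃ m M, qm < m ∧
      ∀ r ≥ r₁, v r / r ∈ Icc m M := by
  have hζ : δ / 2 ∈ Ioo 0 δ := ⟨by linarith, by linarith⟩
  set ζ := δ / 2
  have hpζ := h.p_pos hQ ζ hζ
  have hmemζ := h.mem ζ ⟨by linarith [hζ.1], hζ.2⟩
  have hgζ : R < g ζ := h.lt_g hQ ζ hζ
  set r₁ := g ζ with hr₁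
  have hr₁0 : 0 < r₁ := hR.trans hgζ
  set q₁ := (p ζ)⁻¹ / r₁ with hq₁
  have hq₁m : qm < q₁ := hΩG _ hmemζ hpζ
  obtain ⟨m, hm1, hm2, hm3⟩ := hGm q₁ hq₁m
  have hm0 : 0 < m := hqm.trans_lt hm1
  set M := max q₁ q₀
  -- This is the equation for `q = v / r`. The constant `m` is a lower barrier because `m ≤ G m`,
  -- and `M` is an upper one because `G ≤ 0` from `q₀` on.
  set F : ℝ × ℝ → ℝ := fun x => ((1 + (x.1 * x.2) ^ 2) * G x.2 - x.2) / x.1 with hF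
  have hFs : ContDiffOn ℝ 1 F (Ici r₁ ×ˢ Icc m M) := by
    have h1 : ContDiffOn ℝ 1 (fun x : ℝ × ℝ => G x.2) (Ici r₁ ×ˢ Icc m M) :=
      (hG.of_le (by simp)).comp contDiffOn_snd fun x hx => hm1.trans_le hx.2.1
    refine ContDiffOn.div (((contDiffOn_const.add
      ((contDiffOn_fst.mul contDiffOn_snd).pow 2)).mul h1).sub contDiffOn_snd) contDiffOn_fst ?_
    exact fun x hx => (hr₁0.trans_le hx.1).ne'
  obtain ⟨q, hq0, hqc, hqs, hqd⟩ := exists_solution_Ici_of_barriers (F := F) (y₀ := q₁) hFs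
    (fun t ht => by
      have ht0 : 0 < t := hr₁0.trans_le ht
      refine div_nonneg ?_ ht0.le
      have : 0 ≤ (t * m) ^ 2 * G m := mul_nonneg (sq_nonneg _) (hm0.le.trans hm3)
      simp only
      linarith)
    (fun t ht => by
      have ht0 : 0 < t := hr₁0.trans_le ht
      refine div_nonpos_of_nonpos_of_nonneg ?_ ht0.le
      have h1 := hG0 M (le_max_right _ _)
      have h2 : 0 < M := hm0.trans_le (hm2.trans (le_max_left _ _))
      have := mul_nonpos_of_nonneg_of_nonpos (by positivity : 0 ≤ 1 + (t * M) ^ 2) h1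
      simp only
      linarith) ⟨hm2, le_max_left _ _⟩
  have hqpos : ∀ r ≥ r₁, 0 < q r := fun r hr => hm0.trans_le (hqs r hr).1
  obtain ⟨-, u, v, hb, hvw⟩ := h.exists_isBranch hΩ hQc hQ hζ (w := fun r => r * q r)
    (I := Ioi R) isOpen_Ioi le_rfl (by rw [← hr₁, hq0, hq₁]; field_simp)
    (continuousOn_id.mul hqc)
    (fun r hr => mul_nonneg (hr₁0.le.trans hr) (hqpos r hr).le)
    (fun r _ hr => mul_pos (hr₁0.trans hr) (hqpos r (le_of_lt hr)))
    hΩA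
    (fun r _ hr => hA r _ (hr₁0.trans hr) (by
      rw [mul_div_cancel_left₀ _ (hr₁0.trans hr).ne']
      exact hm1.trans_le (hqs r (le_of_lt hr)).1))
    (fun r _ hr => by
      have hr0 : 0 < r := hr₁0.trans hr
      have h1 := (hasDerivAt_id r).mul (hqd r hr)
      refine HasDerivAt.congr_deriv (f := fun r => r * q r) h1 ?_
      have h2 := hQG r (r * q r) hr0
        (by rw [mul_div_cancel_left₀ _ hr0.ne']; exact hm1.trans_le (hqs r (le_of_lt hr)).1)
      rw [mul_div_cancel_left₀ _ hr0.ne'] at h2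
      rw [mul_assoc, ← mul_neg, h2]
      simp only [hF, id]
      field_simp
      ring)
  refine ⟨u, v, hb, r₁, hgζ, m, M, hm1, fun r hr => ?_⟩
  have hr0 : 0 < r := hr₁0.trans_le hr
  rw [hvw hr]
  simp only
  rw [mul_div_cancel_left₀ _ hr0.ne']
  exact hqs r hr

/-- Continuation of a half neck to all `r ≥ R`, with a slope tending to `0`. -/
theorem IsNeckArc.exists_isBranch_decay {a b c : ℝ} (ha : 0 < a) (hb : 0 < b) (hc : 0 < c)
    (habc : a * c < b ^ 2) {Q : ℝ × ℝ → ℝ} {Ω : Set (ℝ × ℝ)} (hΩ : IsOpen Ω)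
    (hQc : ContinuousOn Q Ω) (hQ : ∀ x ∈ Ω, 0 < Q x) {R δ : ℝ} {g p : ℝ → ℝ}
    (hδ : 0 < δ) (h : IsNeckArc Q Ω R δ g p) (hΩr : ∀ x ∈ Ω, 0 < x.1)
    {A : Set (ℝ × ℝ)} (hΩA : Ω ⊆ A) (hA : ∀ r v, 0 < r → 0 < v → (r, v⁻¹) ∈ A)
    (hQv : ∀ r v, 0 < r → 0 < v → v * Q (r, v⁻¹) = v * (a * v + b * r) / (r * (b * v + c * r))) :
    ∃ u v, IsBranch Q A R (Ioi R) g u v ∧ Tendsto v atTop (𝓝 0) := by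
  have hζ : δ / 2 ∈ Ioo 0 δ := ⟨by linarith, by linarith⟩
  set ζ := δ / 2
  have hpζ := h.p_pos hQ ζ hζ
  have hr₁0 : 0 < g ζ := hΩr _ (h.mem ζ ⟨by linarith [hζ.1], hζ.2⟩)
  set r₁ := g ζ with hr₁
  set v₁ := (p ζ)⁻¹ with hv₁
  have hv₁0 : 0 < v₁ := inv_pos.2 hpζ
  set F : ℝ × ℝ → ℝ := fun x =>
    -((1 + x.2 ^ 2) * (x.2 * (a * x.2 + b * x.1) / (x.1 * (b * x.2 + c * x.1)))) with hF
  have hFs : ContDiffOn ℝ 1 F (Ici r₁ ×ˢ Icc 0 v₁) := by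
    refine ((contDiffOn_const.add (contDiffOn_snd.pow 2)).mul (ContDiffOn.div ?_ ?_ ?_)).neg
    · exact contDiffOn_snd.mul ((contDiffOn_const.mul contDiffOn_snd).add
        (contDiffOn_const.mul contDiffOn_fst))
    · exact contDiffOn_fst.mul ((contDiffOn_const.mul contDiffOn_snd).add
        (contDiffOn_const.mul contDiffOn_fst))
    · intro x hx
      have h1 : 0 < x.1 := hr₁0.trans_le hx.1
      have h2 : 0 ≤ x.2 := hx.2.1
      positivity
  have hFneg : ∀ t ∈ Ici r₁, ∀ x ≥ 0, F (t, x) ≤ 0 := fun t ht x hx => by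
    have h1 : 0 < t := hr₁0.trans_le ht
    simp only [hF, Left.neg_nonpos_iff]
    positivity
  obtain ⟨w, hw0, hwc, hws, hwd⟩ := exists_solution_Ici_of_barriers (F := F) (y₀ := v₁) hFs
    (fun t ht => by simp [hF]) (fun t ht => hFneg t ht _ hv₁0.le) ⟨hv₁0.le, le_rfl⟩
  -- the two-sided linear control of `F`
  have hlow : ∀ t ∈ Ici r₁, ∀ x ∈ Icc 0 v₁, -((1 + v₁ ^ 2) * (b / c / r₁)) * x ≤ F (t, x) := by
    intro t ht x hx
    have h1 : 0 < t := hr₁0.trans_le ht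
    have hx0 := hx.1
    have e1 : x * (a * x + b * t) / (t * (b * x + c * t)) ≤ b / c / r₁ * x := by
      -- The quotient is a mediant of `a / b` and `b / c`, which are in this order because `a * c <
      -- b ^ 2`. The upper bound serves here, the lower one in `hhigh`.
      have : (a * x + b * t) / (b * x + c * t) ≤ b / c := by
        rw [div_le_div_iff₀ (by positivity) hc]
        nlinarith
      calc x * (a * x + b * t) / (t * (b * x + c * t))
          = ((a * x + b * t) / (b * x + c * t)) / t * x := by field_simp
        _ ≤ b / c / r₁ * x := by
          gcongr
          exact ht
    have e2 : 1 + x ^ 2 ≤ 1 + v₁ ^ 2 := by gcongr; exact hx.2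
    have e3 := mul_le_mul e2 e1 (by positivity) (by positivity)
    simp only [hF]
    linarith
  have hhigh : ∀ t ∈ Ici r₁, ∀ x ∈ Icc 0 v₁, F (t, x) ≤ -(a / b / t) * x := by
    intro t ht x hx
    have h1 : 0 < t := hr₁0.trans_le ht
    have hx0 := hx.1
    have e1 : a / b / t * x ≤ x * (a * x + b * t) / (t * (b * x + c * t)) := by
      have : a / b ≤ (a * x + b * t) / (b * x + c * t) := by
        rw [div_le_div_iff₀ hb (by positivity)]
        nlinarith
      calc a / b / t * x ≤ ((a * x + b * t) / (b * x + c * t)) / t * x := by gcongr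
        _ = _ := by field_simp
    have e2 : 0 ≤ x * (a * x + b * t) / (t * (b * x + c * t)) := by positivity
    simp only [hF]
    nlinarith [mul_nonneg (sq_nonneg x) e2]
  -- By `hlow`, `w r * exp (C * r)` is nondecreasing, so the slope never reaches `0`.
  set C := (1 + v₁ ^ 2) * (b / c / r₁)
  have hwpos : ∀ r ≥ r₁, 0 < w r := by
    intro r hr
    have h1 : v₁ * Real.exp (C * r₁) ≤ w r * Real.exp (C * r) := by
      refine le_of_hasDerivAt_nonneg_below (y := fun r => w r * Real.exp (C * r)) hr
        ((hwc.mono Icc_subset_Ici_self).mul (by fun_prop)) (by simp [hw0]) fun t ht _ => ?_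
      have ht' : t ∈ Ici r₁ := ht.1.le
      refine ⟨_, ?_, (hwd t ht.1).mul (((hasDerivAt_id t).const_mul C).exp)⟩
      have := hlow t ht' (w t) (hws t ht')
      have e := Real.exp_pos (C * t)
      simp only [id, mul_one]
      nlinarith
    have h2 : 0 < w r * Real.exp (C * r) := lt_of_lt_of_le (by positivity) h1
    exact (pos_iff_pos_of_mul_pos h2).2 (Real.exp_pos _)
  -- By `hhigh`, `w' ≤ -(a / b) w / r`, which makes `w r * r ^ (a / b)` nonincreasing.
  have hdecay : ∀ r ≥ r₁, w r * r ^ (a / b) ≤ v₁ * r₁ ^ (a / b) := by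
    intro r hr
    refine le_of_hasDerivAt_nonpos_above (y := fun r => w r * r ^ (a / b)) hr
      ((hwc.mono Icc_subset_Ici_self).mul (ContinuousOn.rpow_const continuousOn_id
        fun t ht => Or.inl (hr₁0.trans_le ht.1).ne')) (by simp [hw0]) fun t ht _ => ?_
    have ht0 : 0 < t := hr₁0.trans ht.1
    have ht' : t ∈ Ici r₁ := ht.1.le
    refine ⟨_, ?_, (hwd t ht.1).mul (Real.hasDerivAt_rpow_const (Or.inl ht0.ne'))⟩
    have h1 := hhigh t ht' (w t) (hws t ht')
    have h2 : t ^ (a / b - 1) = t ^ (a / b) / t := by rw [Real.rpow_sub ht0, Real.rpow_one]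
    rw [h2]
    have h3 : 0 < t ^ (a / b) := Real.rpow_pos_of_pos ht0 _
    calc F (t, w t) * t ^ (a / b) + w t * (a / b * (t ^ (a / b) / t))
        ≤ -(a / b / t) * w t * t ^ (a / b) + w t * (a / b * (t ^ (a / b) / t)) := by gcongr
      _ = 0 := by ring
  obtain ⟨-, u, v, hbr, hvw⟩ := h.exists_isBranch hΩ hQc hQ hζ (w := w)
    (I := Ioi R) isOpen_Ioi le_rfl hw0 hwc (fun r hr => (hws r hr).1)
    (fun r _ hr => hwpos r (le_of_lt hr))
    hΩA (fun r _ hr => hA r _ (hr₁0.trans hr) (hwpos r (le_of_lt hr)))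
    (fun r _ hr => by
      refine (hwd r hr).congr_deriv ?_
      rw [mul_assoc, hQv r (w r) (hr₁0.trans hr) (hwpos r (le_of_lt hr))])
  refine ⟨u, v, hbr, ?_⟩
  have hlim : Tendsto (fun r : ℝ => v₁ * r₁ ^ (a / b) * r ^ (-(a / b))) atTop (𝓝 0) := by
    simpa using (tendsto_rpow_neg_atTop (by positivity : 0 < a / b)).const_mul (v₁ * r₁ ^ (a / b))
  refine tendsto_of_tendsto_of_tendsto_of_le_of_le' tendsto_const_nhds hlim ?_ ?_
  · filter_upwards [eventually_ge_atTop r₁] with r hr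
    rw [hvw hr]
    exact (hwpos r hr).le
  · filter_upwards [eventually_ge_atTop r₁] with r hr
    have hr0 : 0 < r := hr₁0.trans_le hr
    rw [hvw hr, Real.rpow_neg hr0.le, ← div_eq_mul_inv, le_div_iff₀ (Real.rpow_pos_of_pos hr0 _)]
    exact hdecay r hr

/-- Continuation of a half neck up to a radius `ρ` where the slope reaches `0`. -/
theorem IsNeckArc.exists_isBranch_terminating {a b : ℝ} (ha : 0 < a) (hb : 0 < b) {k : ℕ}
    (hk : 2 ≤ k) {Q : ℝ × ℝ → ℝ} {Ω : Set (ℝ × ℝ)} (hΩ : IsOpen Ω)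
    (hQc : ContinuousOn Q Ω) (hQ : ∀ x ∈ Ω, 0 < Q x) {R δ : ℝ} {g p : ℝ → ℝ}
    (hδ : 0 < δ) (h : IsNeckArc Q Ω R δ g p) (hΩr : ∀ x ∈ Ω, 0 < x.1)
    {A : Set (ℝ × ℝ)} (hΩA : Ω ⊆ A) (hA : ∀ r v, 0 < r → 0 < v → (r, v⁻¹) ∈ A)
    (hQv : ∀ r v, 0 < r → 0 < v →
      v * Q (r, v⁻¹) = (a * v ^ k + r ^ k) / (b * r * v ^ (k - 1))) :
    ∃ u v ρ, R < ρ ∧ IsBranch Q A R (Ioo R ρ) g u v ∧ ∀ r ≥ ρ, v r = 0 := by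
  have hζ : δ / 2 ∈ Ioo 0 δ := ⟨by linarith, by linarith⟩
  set ζ := δ / 2
  have hpζ := h.p_pos hQ ζ hζ
  have hr₁0 : 0 < g ζ := hΩr _ (h.mem ζ ⟨by linarith [hζ.1], hζ.2⟩)
  set r₁ := g ζ with hr₁
  set v₁ := (p ζ)⁻¹ with hv₁
  have hv₁0 : 0 < v₁ := inv_pos.2 hpζ
  -- The roles are exchanged: time is the drop `t = v₁ - v` of the slope and the unknown is the
  -- radius. The factor `v ^ (k - 1)`, a denominator in `dv/dr`, is now a numerator, so the field is
  -- smooth up to `v = 0`.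
  set F : ℝ × ℝ → ℝ := fun x =>
    b * x.2 * (v₁ - x.1) ^ (k - 1) / ((1 + (v₁ - x.1) ^ 2) * (a * (v₁ - x.1) ^ k + x.2 ^ k))
    with hF
  -- Upper bound for `F`: the denominator is at least `x ^ k ≥ x * r₁ ^ (k - 1)`. Hence the radius
  -- grows by at most `L * v₁`, which gives `M`.
  set L := b * v₁ ^ (k - 1) / r₁ ^ (k - 1) with hL
  have hL0 : 0 ≤ L := by positivity
  set M := r₁ + L * v₁ with hM
  have hden : ∀ t ∈ Icc 0 v₁, ∀ x ≥ r₁,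
      0 < (1 + (v₁ - t) ^ 2) * (a * (v₁ - t) ^ k + x ^ k) := fun t ht x hx => by
    have h1 : 0 ≤ v₁ - t := sub_nonneg.2 ht.2
    have h2 : 0 < x := hr₁0.trans_le hx
    positivity
  have hFs : ContDiffOn ℝ 1 F (Icc 0 v₁ ×ˢ Icc r₁ M) := by
    refine ContDiffOn.div (by fun_prop) (by fun_prop) ?_
    exact fun x hx => (hden x.1 hx.1 x.2 hx.2.1).ne'
  have hFnn : ∀ t ∈ Icc 0 v₁, ∀ x ∈ Icc r₁ M, 0 ≤ F (t, x) := fun t ht x hx => by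
    have h1 : 0 ≤ v₁ - t := sub_nonneg.2 ht.2
    have h2 : 0 < x := hr₁0.trans_le hx.1
    simp only [hF]
    positivity
  have hFL : ∀ t ∈ Icc 0 v₁, ∀ x ∈ Icc r₁ M, F (t, x) ≤ L := fun t ht x hx => by
    have h1 : 0 ≤ v₁ - t := sub_nonneg.2 ht.2
    have h2 : 0 < x := hr₁0.trans_le hx.1
    have hk1 : x ^ k = x * x ^ (k - 1) := by rw [← pow_succ']; congr 1; omega
    have e1 : x * r₁ ^ (k - 1) ≤ (1 + (v₁ - t) ^ 2) * (a * (v₁ - t) ^ k + x ^ k) := by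
      calc x * r₁ ^ (k - 1) ≤ x * x ^ (k - 1) := by gcongr; exact hx.1
        _ = x ^ k := hk1.symm
        _ ≤ a * (v₁ - t) ^ k + x ^ k := by
          have : 0 ≤ a * (v₁ - t) ^ k := by positivity
          linarith
        _ ≤ _ := by
          have : 0 ≤ a * (v₁ - t) ^ k + x ^ k := by positivity
          nlinarith [mul_nonneg (sq_nonneg (v₁ - t)) this]
    calc F (t, x) ≤ b * x * v₁ ^ (k - 1) / (x * r₁ ^ (k - 1)) := by
          simp only [hF]
          gcongr
          linarith [ht.1]
      _ = L := by
          simp only [hL]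
          field_simp
  obtain ⟨y, hy0, hyc, hys, hyd⟩ := exists_solution_Icc_of_growth (F := F) hv₁0.le hFs hFnn hFL hL0
    (by rw [sub_zero])
  have hFpos : ∀ t ∈ Ioo 0 v₁, 0 < F (t, y t) := fun t ht => by
    have h1 : 0 < v₁ - t := sub_pos.2 ht.2
    have h2 : 0 < y t := hr₁0.trans_le (hys t (Ioo_subset_Icc_self ht)).1
    simp only [hF]
    positivity
  obtain ⟨hρ, j, hj1, hj2, hj3, hjc, hjd⟩ := exists_inverse_of_hasDerivAt_pos hv₁0 hyc hyd hFpos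
  rw [hy0] at hρ hj1 hj2 hj3 hjc hjd
  set ρ := y v₁
  have hj0 : j r₁ = 0 := by simpa [hy0] using (hj1 0 ⟨le_rfl, hv₁0.le⟩).2
  have hjρ : j ρ = v₁ := (hj1 v₁ ⟨hv₁0.le, le_rfl⟩).2
  -- The slope is continued by `0` beyond `ρ`. The height function is then constant there, and
  -- differentiable from both sides at `ρ` with derivative `0`.
  have hmin : ∀ r ∈ Ici r₁, min r ρ ∈ Icc r₁ ρ := fun r hr =>
    ⟨le_min hr hρ.le, min_le_right _ _⟩
  have hpos : ∀ r ∈ Ioo r₁ ρ, 0 < v₁ - j r := fun r hr => sub_pos.2 (hj3 r hr).2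
  have hminr : ∀ r ∈ Ioo r₁ ρ, min r ρ = r := fun r hr => min_eq_left hr.2.le
  have hw : ∀ r ∈ Ioo R ρ, r₁ < r → HasDerivAt (fun r => v₁ - j (min r ρ))
      (-((1 + (v₁ - j (min r ρ)) ^ 2) * (v₁ - j (min r ρ)) * Q (r, (v₁ - j (min r ρ))⁻¹))) r := by
    intro r hr hr1
    have hr' : r ∈ Ioo r₁ ρ := ⟨hr1, hr.2⟩
    have hr0 : 0 < r := hr₁0.trans hr1
    rw [hminr r hr', mul_assoc, hQv r _ hr0 (hpos r hr')]
    have h1 : HasDerivAt (fun r => v₁ - j r) (-(F (j r, y (j r)))⁻¹) r :=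
      (hjd r hr').const_sub v₁
    have h2 : HasDerivAt (fun r => v₁ - j (min r ρ)) (-(F (j r, y (j r)))⁻¹) r := by
      refine h1.congr_of_eventuallyEq ?_
      filter_upwards [Iio_mem_nhds hr.2] with s hs
      rw [min_eq_left (le_of_lt hs)]
    refine h2.congr_deriv ?_
    rw [(hj2 r (Ioo_subset_Icc_self hr')).2]
    simp only [hF, inv_div]
    ring
  obtain ⟨hR₁, u, v, hbr, hvw⟩ := h.exists_isBranch hΩ hQc hQ hζ
    (w := fun r => v₁ - j (min r ρ)) (I := Ioo R ρ) isOpen_Ioo (fun r hr => hr.1)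
    (by rw [← hr₁, min_eq_left hρ.le, hj0, sub_zero])
    (continuousOn_const.sub (hjc.comp (by fun_prop) hmin))
    (fun r hr => sub_nonneg.2 (hj2 _ (hmin r hr)).1.2)
    (fun r hr hr1 => by rw [hminr r ⟨hr1, hr.2⟩]; exact hpos r ⟨hr1, hr.2⟩) hΩA
    (fun r hr hr1 => hA r _ (hr₁0.trans hr1)
      (by rw [hminr r ⟨hr1, hr.2⟩]; exact hpos r ⟨hr1, hr.2⟩)) hw
  refine ⟨u, v, ρ, hR₁.trans hρ, hbr, fun r hr => ?_⟩
  rw [hvw (hρ.le.trans hr)]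
  simp only
  rw [min_eq_right hr, hjρ, sub_self]

end Continuation

/-! ### Asymptotic expansion of the bowl-like branches -/

section BowlAsymptotics

open Set

/-- Once `|X| ≥ K / α`, the term `A X` dominates `B` and drives `X` back towards `0`; so `max |X r₁|
(K / α)` is never exceeded. -/
theorem exists_abs_le_of_hasDerivAt_relaxation {X A B : ℝ → ℝ} {r₁ α K : ℝ} (hr₁ : 0 < r₁)
    (hα : 0 < α) (hc : ContinuousOn X (Ici r₁))
    (hX : ∀ r > r₁, HasDerivAt X (-(r * (A r * X r + B r))) r) (hA : ∀ r > r₁, α ≤ A r)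
    (hB : ∀ r > r₁, |B r| ≤ K) : ∃ L, ∀ r ≥ r₁, |X r| ≤ L := by
  set L := max |X r₁| (K / α) with hL
  have hL1 : |X r₁| ≤ L := le_max_left _ _
  have hL2 : K ≤ α * L := by
    have : K / α ≤ L := le_max_right _ _
    rwa [div_le_iff₀' hα] at this
  have hL0 : 0 ≤ L := (abs_nonneg _).trans hL1
  refine ⟨L, fun r hr => abs_le.2 ⟨?_, ?_⟩⟩
  · refine le_of_hasDerivAt_nonneg_below hr (hc.mono Icc_subset_Ici_self) (abs_le.1 hL1).1
      fun t ht h => ⟨_, ?_, hX t ht.1⟩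
    have h1 := (abs_le.1 (hB t ht.1)).2
    have h2 := hA t ht.1
    have h3 : A t * X t + B t ≤ 0 := by nlinarith
    nlinarith [hr₁.trans ht.1]
  · refine le_of_hasDerivAt_nonpos_above hr (hc.mono Icc_subset_Ici_self) (abs_le.1 hL1).2
      fun t ht h => ⟨_, ?_, hX t ht.1⟩
    have h1 := (abs_le.1 (hB t ht.1)).1
    have h2 := hA t ht.1
    have h3 : 0 ≤ A t * X t + B t := by nlinarith
    nlinarith [hr₁.trans ht.1]

/-- `D + K / r` is nonincreasing and `D - K / r` is nondecreasing, and the constant is squeezed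
between them. -/
theorem exists_abs_sub_le_of_hasDerivAt {D d : ℝ → ℝ} {r₁ K : ℝ} (hr₁ : 0 < r₁)
    (hD : ∀ r ≥ r₁, HasDerivAt D (d r) r) (hd : ∀ r ≥ r₁, |d r| ≤ K / r ^ 2) :
    ∃ C, ∀ r ≥ r₁, |D r - C| ≤ K / r := by
  have hinv : ∀ r ≥ r₁, HasDerivAt (fun r => K / r) (-(K / r ^ 2)) r := fun r hr => by
    have hr0 : r ≠ 0 := (hr₁.trans_le hr).ne'
    simpa [div_eq_mul_inv] using (hasDerivAt_inv hr0).const_mul K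
  have hanti : AntitoneOn (fun r => D r + K / r) (Ici r₁) := by
    refine antitoneOn_of_deriv_nonpos (convex_Ici _)
      (fun r hr => ((hD r hr).add (hinv r hr)).continuousAt.continuousWithinAt) ?_ ?_ <;>
    rw [interior_Ici] <;> intro r hr <;> have h := (hD r (le_of_lt hr)).add (hinv r (le_of_lt hr))
    · exact h.differentiableAt.differentiableWithinAt
    · erw [h.deriv]
      linarith [(abs_le.1 (hd r (le_of_lt hr))).2]
  have hmono : MonotoneOn (fun r => D r - K / r) (Ici r₁) := by
    refine monotoneOn_of_deriv_nonneg (convex_Ici _)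
      (fun r hr => ((hD r hr).sub (hinv r hr)).continuousAt.continuousWithinAt) ?_ ?_ <;>
    rw [interior_Ici] <;> intro r hr <;> have h := (hD r (le_of_lt hr)).sub (hinv r (le_of_lt hr))
    · exact h.differentiableAt.differentiableWithinAt
    · erw [h.deriv]
      linarith [(abs_le.1 (hd r (le_of_lt hr))).1]
  have hK : ∀ r ≥ r₁, 0 ≤ K / r := fun r hr => by
    have h0 : 0 < r := hr₁.trans_le hr
    have := (abs_nonneg _).trans (hd r hr)
    have : K / r = K / r ^ 2 * r := by field_simp
    rw [this]
    positivity
  have hle : ∀ r ∈ Ici r₁, ∀ s ∈ Ici r₁, D r - K / r ≤ D s + K / s := by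
    intro r hr s hs
    rcases le_total r s with h | h
    · have := hmono hr hs h
      simp only at this
      linarith [hK s hs]
    · have := hanti hs hr h
      simp only at this
      linarith [hK r hr]
  have hne : ((fun r => D r - K / r) '' Ici r₁).Nonempty := ⟨_, r₁, mem_Ici.2 le_rfl, rfl⟩
  refine ⟨sSup ((fun r => D r - K / r) '' Ici r₁), fun r hr => abs_le.2 ⟨?_, ?_⟩⟩
  · have : sSup ((fun r => D r - K / r) '' Ici r₁) ≤ D r + K / r :=
      csSup_le hne (by rintro _ ⟨s, hs, rfl⟩; exact hle s hs r hr)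
    linarith
  · have : D r - K / r ≤ sSup ((fun r => D r - K / r) '' Ici r₁) :=
      le_csSup ⟨D r₁ + K / r₁, by rintro _ ⟨s, hs, rfl⟩; exact hle s hs r₁ (mem_Ici.2 le_rfl)⟩ ⟨r, hr, rfl⟩
    linarith

/-- Asymptotic expansion of the solutions of `u'' = (1 + u'²) G(u' / r)` with `u' / r` in a compact
interval, where `G(q) = -(q - q₀) H(q)` with `H > 0`. -/
theorem exists_bowl_expansion {G H u v : ℝ → ℝ} {qm q₀ m M r₁ : ℝ} (hr₁ : 0 < r₁) (hqm : 0 ≤ qm)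
    (hq₀ : qm < q₀) (hm : qm < m) (hH : ContDiffOn ℝ ∞ H (Ioi qm)) (hHpos : ∀ q > qm, 0 < H q)
    (hGH : ∀ q > qm, G q = -((q - q₀) * H q)) (hu : ∀ r ≥ r₁, HasDerivAt u (v r) r)
    (hv : ∀ r ≥ r₁, HasDerivAt v ((1 + v r ^ 2) * G (v r / r)) r)
    (hvr : ∀ r ≥ r₁, v r / r ∈ Icc m M) :
    ∃ C K, ∀ r ≥ r₁, |u r - (q₀ * r ^ 2 / 2 - (q₀ * H q₀)⁻¹ * Real.log r + C)| ≤ K / r := by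
  have hm0 : 0 < m := hqm.trans_lt hm
  have hq₀0 : 0 < q₀ := hqm.trans_lt hq₀
  have hH₀ := hHpos q₀ hq₀
  set m' := min m q₀
  set M' := max M q₀
  have hm' : qm < m' := lt_min hm hq₀
  have hm'0 : 0 < m' := hqm.trans_lt hm'
  have hsub : Icc m' M' ⊆ Ioi qm := fun q hq => hm'.trans_le hq.1
  have hqI : ∀ r ≥ r₁, v r / r ∈ Icc m' M' := fun r hr =>
    ⟨(min_le_left _ _).trans (hvr r hr).1, (hvr r hr).2.trans (le_max_left _ _)⟩
  have hq₀I : q₀ ∈ Icc m' M' := ⟨min_le_right _ _, le_max_right _ _⟩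
  have hHI : ContDiffOn ℝ 1 H (Icc m' M') := (hH.mono hsub).of_le (by simp)
  obtain ⟨h₀, hh₀, hh₀'⟩ : ∃ h₀ > 0, ∀ q ∈ Icc m' M', h₀ ≤ H q := by
    obtain ⟨q, hq, hmin⟩ := isCompact_Icc.exists_isMinOn ⟨q₀, hq₀I⟩ hHI.continuousOn
    exact ⟨H q, hHpos q (hsub hq), fun s hs => hmin hs⟩
  obtain ⟨h₁, hh₁⟩ := isCompact_Icc.exists_bound_of_continuousOn hHI.continuousOn
  set f₁ := (q₀ * H q₀)⁻¹ with hf₁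
  have hf₁0 : 0 < f₁ := by positivity
  obtain ⟨Λ, hΛ⟩ := ((contDiffOn_id.pow 2).mul hHI).exists_lipschitzOnWith one_ne_zero
    (convex_Icc m' M') isCompact_Icc
  have hΛ' : ∀ q ∈ Icc m' M', |q ^ 2 * H q - q₀ ^ 2 * H q₀| ≤ Λ * |q - q₀| := fun q hq => by
    simpa [Real.dist_eq] using hΛ.dist_le_mul q hq q₀ hq₀I
  set A : ℝ → ℝ := fun r => (1 / r ^ 2 + (v r / r) ^ 2) * H (v r / r) with hA
  have hAα : ∀ r > r₁, m' ^ 2 * h₀ ≤ A r := fun r hr => by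
    have h1 := hqI r (le_of_lt hr)
    have h2 := hh₀' _ h1
    have h3 : m' ^ 2 ≤ 1 / r ^ 2 + (v r / r) ^ 2 := by
      have : m' ^ 2 ≤ (v r / r) ^ 2 := by gcongr; exact h1.1
      have : 0 ≤ 1 / r ^ 2 := by positivity
      linarith
    exact mul_le_mul h3 h2 hh₀.le (by positivity)
  -- The error of the leading term `v ≈ q₀ r`, scaled so that it stays bounded: `v / r - q₀ = e /
  -- r²`.
  set e : ℝ → ℝ := fun r => r * v r - q₀ * r ^ 2 with he
  have her : ∀ r ≥ r₁, v r / r - q₀ = e r / r ^ 2 := fun r hr => by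
    have h0 : r ≠ 0 := (hr₁.trans_le hr).ne'
    simp only [he]
    field_simp
  have hvA : ∀ r ≥ r₁, (1 + v r ^ 2) * G (v r / r) = -(A r * e r) := fun r hr => by
    have h0 : r ≠ 0 := (hr₁.trans_le hr).ne'
    rw [hGH _ (hsub (hqI r hr)), her r hr]
    simp only [hA]
    field_simp
  have hed : ∀ r ≥ r₁, HasDerivAt e (-(r * (A r * e r + (2 * q₀ - v r / r)))) r := fun r hr => by
    have h0 : r ≠ 0 := (hr₁.trans_le hr).ne'
    have h1 := ((hasDerivAt_id r).mul (hv r hr)).sub ((hasDerivAt_pow 2 r).const_mul q₀)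
    refine HasDerivAt.congr_deriv (f := e) h1 ?_
    rw [hvA r hr]
    simp only [id]
    field_simp
    push_cast
    ring
  obtain ⟨E, hE⟩ := exists_abs_le_of_hasDerivAt_relaxation (B := fun r => 2 * q₀ - v r / r)
    (K := 2 * q₀ + M') hr₁ (by positivity : 0 < m' ^ 2 * h₀)
    (fun r hr => (hed r hr).continuousAt.continuousWithinAt) (fun r hr => hed r (le_of_lt hr)) hAα
    (fun r hr => by
      have h1 := hqI r (le_of_lt hr)
      exact abs_le.2 ⟨by linarith [h1.2], by linarith [h1.1, h1.2]⟩)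
  have hE0 : 0 ≤ E := (abs_nonneg _).trans (hE r₁ le_rfl)
  -- Heuristically `A → q₀² H(q₀)` and `2 q₀ - v / r → q₀`, so the equation for `e` has the limiting
  -- equilibrium `-f₁`. `X` measures the distance to it, magnified by `r²`, and solves a relaxation
  -- equation of the same type.
  set X : ℝ → ℝ := fun r => r ^ 2 * (e r + f₁) with hX
  set B : ℝ → ℝ := fun r => r ^ 2 * (2 * q₀ - v r / r - A r * f₁) - 2 * (e r + f₁) with hB
  have hXd : ∀ r ≥ r₁, HasDerivAt X (-(r * (A r * X r + B r))) r := fun r hr => by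
    have h1 := (hasDerivAt_pow 2 r).mul ((hed r hr).add_const f₁)
    refine HasDerivAt.congr_deriv (f := X) h1 ?_
    simp only [hX, hB]
    push_cast
    ring
  -- The factor `r²` in `B` meets only differences that vanish at `q = q₀`. They are bounded through
  -- `r² (q - q₀) = e` and the Lipschitz bound for `q² H(q)`; the term `1 / r²` in `A` contributes
  -- the part with `h₁`.
  have hBb : ∀ r > r₁, |B r| ≤ E + f₁ * (Λ * E) + h₁ * f₁ + 2 * (E + f₁) := fun r hr => by
    have hr' : r₁ ≤ r := le_of_lt hr
    have h0 : 0 < r := hr₁.trans hr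
    have hq := hqI r hr'
    have h3 := hE r hr'
    have hq0 : q₀ = q₀ ^ 2 * H q₀ * f₁ := by simp only [hf₁]; field_simp
    have h1 : B r = -e r - f₁ * (r ^ 2 * ((v r / r) ^ 2 * H (v r / r) - q₀ ^ 2 * H q₀))
        - H (v r / r) * f₁ - 2 * (e r + f₁) := by
      have h2 : r ^ 2 * (v r / r - q₀) = e r := by rw [her r hr']; field_simp
      have h4 : A r = 1 / r ^ 2 * H (v r / r) + (v r / r) ^ 2 * H (v r / r) := by
        simp only [hA]; ring
      have h5 : r ^ 2 * (1 / r ^ 2) = 1 := by field_simp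
      simp only [hB, h4]
      linear_combination (-1) * h2 - H (v r / r) * f₁ * h5 + r ^ 2 * hq0
    have h4 : |r ^ 2 * ((v r / r) ^ 2 * H (v r / r) - q₀ ^ 2 * H q₀)| ≤ Λ * E := by
      rw [abs_mul, abs_of_pos (by positivity : 0 < r ^ 2)]
      calc r ^ 2 * |(v r / r) ^ 2 * H (v r / r) - q₀ ^ 2 * H q₀|
          ≤ r ^ 2 * (Λ * |v r / r - q₀|) := by gcongr; exact hΛ' _ hq
        _ = Λ * |e r| := by
            rw [her r hr', abs_div, abs_of_pos (by positivity : 0 < r ^ 2)]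
            field_simp
        _ ≤ Λ * E := by gcongr
    have h5 : |H (v r / r)| ≤ h₁ := hh₁ _ hq
    rw [h1]
    have t1 : |f₁ * (r ^ 2 * ((v r / r) ^ 2 * H (v r / r) - q₀ ^ 2 * H q₀))| ≤ f₁ * (Λ * E) := by
      rw [abs_mul, abs_of_pos hf₁0]
      gcongr
    have t2 : |H (v r / r) * f₁| ≤ h₁ * f₁ := by
      rw [abs_mul, abs_of_pos hf₁0]
      gcongr
    have a1 := abs_le.1 t1
    have a2 := abs_le.1 t2
    have a3 := abs_le.1 h3
    exact abs_le.2 ⟨by linarith [a1.2, a2.2, a3.2], by linarith [a1.1, a2.1, a3.1]⟩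
  obtain ⟨L, hL⟩ := exists_abs_le_of_hasDerivAt_relaxation hr₁ (by positivity : 0 < m' ^ 2 * h₀)
    (fun r hr => (hXd r hr).continuousAt.continuousWithinAt) (fun r hr => hXd r (le_of_lt hr)) hAα
    hBb
  have hL0 : 0 ≤ L := (abs_nonneg _).trans (hL r₁ le_rfl)
  -- By definition of `X`, `v = q₀ r - f₁ / r + X / r³`; the last term is bounded by `(L / r₁) /
  -- r²`.
  obtain ⟨C, hC⟩ := exists_abs_sub_le_of_hasDerivAt (K := L / r₁) hr₁
    (D := fun r => u r - (q₀ * r ^ 2 / 2 - f₁ * Real.log r)) (d := fun r => X r / r ^ 3)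
    (fun r hr => by
      have h0 : r ≠ 0 := (hr₁.trans_le hr).ne'
      have h1 := (hu r hr).sub ((((hasDerivAt_pow 2 r).const_mul q₀).div_const 2).sub
        ((Real.hasDerivAt_log h0).const_mul f₁))
      refine HasDerivAt.congr_deriv
        (f := fun r => u r - (q₀ * r ^ 2 / 2 - f₁ * Real.log r)) h1 ?_
      simp only [hX, he]
      field_simp
      push_cast
      ring)
    (fun r hr => by
      have h0 : 0 < r := hr₁.trans_le hr
      rw [abs_div, abs_of_pos (by positivity : 0 < r ^ 3), div_div]
      have h1 : r₁ * r ^ 2 ≤ r ^ 3 := by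
        have : r ^ 3 = r * r ^ 2 := by ring
        rw [this]
        gcongr
      exact div_le_div₀ hL0 (hL r hr) (by positivity) h1)
  refine ⟨C, L / r₁, fun r hr => ?_⟩
  have := hC r hr
  convert this using 2
  ring

end BowlAsymptotics

/-! ### Unit normals and principal curvatures of rotationally symmetric hypersurfaces -/

noncomputable section Geometry

open Set

variable {n : ℕ}

@[simp] theorem pt_fst (x : Rn n) (t : ℝ) : (pt x t).fst = x := rfl

@[simp] theorem pt_snd (x : Rn n) (t : ℝ) : (pt x t).snd = t := rfl

theorem pt_fst_snd (p : Rn1 n) : pt p.fst p.snd = p := rfl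

theorem inner_rn1 (p q : Rn1 n) : inner ℝ p q = inner ℝ p.fst q.fst + p.snd * q.snd := by
  rw [WithLp.prod_inner_apply]
  congr 1
  exact mul_comm _ _

theorem rn1_ext {p q : Rn1 n} (h₁ : p.fst = q.fst) (h₂ : p.snd = q.snd) : p = q := by
  rw [← pt_fst_snd p, ← pt_fst_snd q, h₁, h₂]

/-- The pairing `(x, t) ↦ (x, t)` as a continuous linear map into `ℝⁿ⁺¹`. -/
def ptL (n : ℕ) : Rn n × ℝ →L[ℝ] Rn1 n :=
  ((WithLp.prodContinuousLinearEquiv 2 ℝ (Rn n) ℝ).symm : Rn n × ℝ →L[ℝ] Rn1 n)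

theorem ptL_apply (x : Rn n) (t : ℝ) : ptL n (x, t) = pt x t := rfl

theorem continuous_rn1_fst : Continuous fun q : Rn1 n => q.fst :=
  (WithLp.fstL 2 ℝ (Rn n) ℝ).continuous

theorem continuous_rn1_snd : Continuous fun q : Rn1 n => q.snd :=
  (WithLp.sndL 2 ℝ (Rn n) ℝ).continuous

theorem contDiff_rn1_fst {m : WithTop ℕ∞} : ContDiff ℝ m fun q : Rn1 n => q.fst :=
  (WithLp.fstL 2 ℝ (Rn n) ℝ).contDiff

theorem contDiff_rn1_snd {m : WithTop ℕ∞} : ContDiff ℝ m fun q : Rn1 n => q.snd :=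
  (WithLp.sndL 2 ℝ (Rn n) ℝ).contDiff

/-- The cylindrical coordinates `(|x|, x_{n+1})` of a point. -/
def cylCoord (q : Rn1 n) : ℝ × ℝ := (‖q.fst‖, q.snd)

theorem continuous_cylCoord : Continuous (cylCoord (n := n)) :=
  continuous_rn1_fst.norm.prodMk continuous_rn1_snd

theorem contDiffAt_cylCoord {m : WithTop ℕ∞} {q : Rn1 n} (hq : 0 < ‖q.fst‖) :
    ContDiffAt ℝ m cylCoord q :=
  (contDiff_rn1_fst.contDiffAt.norm ℝ (norm_pos_iff.1 hq)).prodMk contDiff_rn1_snd.contDiffAt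

theorem hasFDerivAt_norm_of_ne_zero {x : Rn n} (hx : x ≠ 0) :
    HasFDerivAt (fun y : Rn n => ‖y‖) (‖x‖⁻¹ • innerSL ℝ x) x := by
  have h0 : ‖x‖ ≠ 0 := norm_ne_zero_iff.2 hx
  have h := (hasStrictFDerivAt_norm_sq x).hasFDerivAt.sqrt (pow_ne_zero 2 h0)
  have h1 : HasFDerivAt (fun y : Rn n => ‖y‖) _ x := h.congr_of_eventuallyEq
    (Eventually.of_forall fun y => (Real.sqrt_sq (norm_nonneg y)).symm)
  refine h1.congr_fderiv ?_
  rw [Real.sqrt_sq (norm_nonneg x)]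
  ext w
  simp
  field_simp

/-- The derivative of the cylindrical coordinates. -/
def cylCoordDeriv (q : Rn1 n) : Rn1 n →L[ℝ] ℝ × ℝ :=
  ((‖q.fst‖⁻¹ • innerSL ℝ q.fst).comp (WithLp.fstL 2 ℝ (Rn n) ℝ)).prod (WithLp.sndL 2 ℝ (Rn n) ℝ)

theorem cylCoordDeriv_apply (q w : Rn1 n) :
    cylCoordDeriv q w = (‖q.fst‖⁻¹ * inner ℝ q.fst w.fst, w.snd) := rfl

theorem hasFDerivAt_cylCoord {q : Rn1 n} (hq : 0 < ‖q.fst‖) :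
    HasFDerivAt cylCoord (cylCoordDeriv q) q := by
  have h1 : HasFDerivAt (fun q : Rn1 n => q.fst) (WithLp.fstL 2 ℝ (Rn n) ℝ) q :=
    (WithLp.fstL 2 ℝ (Rn n) ℝ).hasFDerivAt
  have h2 : HasFDerivAt (fun q : Rn1 n => q.snd) (WithLp.sndL 2 ℝ (Rn n) ℝ) q :=
    (WithLp.sndL 2 ℝ (Rn n) ℝ).hasFDerivAt
  exact ((hasFDerivAt_norm_of_ne_zero (norm_pos_iff.1 hq)).comp q h1).prodMk h2

/-- The rotationally symmetric unit vector field with angle `Θ(|x|, x_{n+1})` to the vertical. -/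
def radialNormal (Θ : ℝ × ℝ → ℝ) (q : Rn1 n) : Rn1 n :=
  pt ((-(Real.sin (Θ (cylCoord q)) / ‖q.fst‖)) • q.fst) (Real.cos (Θ (cylCoord q)))

theorem norm_radialNormal (Θ : ℝ × ℝ → ℝ) {q : Rn1 n} (hq : 0 < ‖q.fst‖) :
    ‖radialNormal Θ q‖ = 1 := by
  have h : ‖radialNormal Θ q‖ ^ 2 = 1 := by
    rw [← real_inner_self_eq_norm_sq, inner_rn1]
    simp only [radialNormal, pt_fst, pt_snd, inner_smul_left, inner_smul_right,
      real_inner_self_eq_norm_sq, conj_trivial]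
    field_simp
    linarith [Real.sin_sq_add_cos_sq (Θ (cylCoord q))]
  nlinarith [norm_nonneg (radialNormal Θ q)]

theorem contDiffAt_radialNormal {Θ : ℝ × ℝ → ℝ} {q : Rn1 n} (hq : 0 < ‖q.fst‖)
    (hΘ : ContDiffAt ℝ ∞ Θ (cylCoord q)) : ContDiffAt ℝ ∞ (radialNormal Θ) q := by
  have h1 : ContDiffAt ℝ ∞ (fun q : Rn1 n => Θ (cylCoord q)) q :=
    hΘ.comp q (contDiffAt_cylCoord hq)
  have h2 : ContDiffAt ℝ ∞ (fun q : Rn1 n => ‖q.fst‖) q :=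
    contDiff_rn1_fst.contDiffAt.norm ℝ (norm_pos_iff.1 hq)
  exact (ptL n).contDiff.contDiffAt.comp q
    (((h1.sin.div h2 hq.ne').neg.smul contDiff_rn1_fst.contDiffAt).prodMk h1.cos)

/-- The regular level set `Φ(|x|, x_{n+1}) = 0` of a function with gradient parallel to
`(-sin Θ, cos Θ)` has the unit normal `radialNormal Θ`. -/
theorem isUnitNormalNear_radialNormal {W : Set (Rn1 n)} {p : Rn1 n} {V : Set (ℝ × ℝ)}
    (hV : IsOpen V) (hV0 : ∀ x ∈ V, 0 < x.1) (hp : cylCoord p ∈ V) {Φ Θ c : ℝ × ℝ → ℝ}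
    (hΦ : ContDiffOn ℝ ∞ Φ V) (hΘ : ContDiffOn ℝ ∞ Θ V) (hc : ∀ x ∈ V, c x ≠ 0)
    (hΦd : ∀ x ∈ V, HasFDerivAt Φ (c x • (-(Real.sin (Θ x)) • ContinuousLinearMap.fst ℝ ℝ ℝ +
      Real.cos (Θ x) • ContinuousLinearMap.snd ℝ ℝ ℝ)) x)
    (hW : ∀ q, cylCoord q ∈ V → (q ∈ W ↔ Φ (cylCoord q) = 0)) :
    IsUnitNormalNear W p (radialNormal Θ) := by
  have hgrad : ∀ q : Rn1 n, cylCoord q ∈ V →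
      gradient (fun q : Rn1 n => Φ (cylCoord q)) q = c (cylCoord q) • radialNormal Θ q := by
    intro q hq
    have hq0 : 0 < ‖q.fst‖ := hV0 _ hq
    refine HasGradientAt.gradient ?_
    rw [hasGradientAt_iff_hasFDerivAt]
    refine ((hΦd _ hq).comp q (hasFDerivAt_cylCoord hq0)).congr_fderiv ?_
    ext w
    rw [InnerProductSpace.toDual_apply_apply, inner_smul_left, inner_rn1]
    simp only [ContinuousLinearMap.comp_apply, cylCoordDeriv_apply, radialNormal, pt_fst, pt_snd,
      inner_smul_left, conj_trivial, _root_.smul_apply, _root_.add_apply,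
      ContinuousLinearMap.coe_fst', ContinuousLinearMap.coe_snd', smul_eq_mul]
    field_simp
  have hN0 : ∀ q : Rn1 n, cylCoord q ∈ V → radialNormal Θ q ≠ 0 := fun q hq h => by
    have := norm_radialNormal Θ (hV0 _ hq)
    rw [h, norm_zero] at this
    exact zero_ne_one this
  refine ⟨cylCoord ⁻¹' V, hV.preimage continuous_cylCoord, hp, fun q => Φ (cylCoord q), ?_, ?_, ?_,
    ?_, ?_⟩
  · exact fun q hq => ((hΦ.contDiffAt (hV.mem_nhds hq)).comp q
      (contDiffAt_cylCoord (hV0 _ hq))).contDiffWithinAt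
  · intro q hq
    rw [hgrad q hq]
    exact smul_ne_zero (hc _ hq) (hN0 q hq)
  · ext q
    exact ⟨fun h => ⟨h.2, (hW q h.2).1 h.1⟩, fun h => ⟨(hW q h.1).2 h.2, h.1⟩⟩
  · exact fun q hq => (contDiffAt_radialNormal (hV0 _ hq)
      (hΘ.contDiffAt (hV.mem_nhds hq))).contDiffWithinAt
  · rintro q ⟨-, hq⟩
    refine ⟨norm_radialNormal Θ (hV0 _ hq), (c (cylCoord q))⁻¹, ?_⟩
    rw [hgrad q hq, smul_smul, inv_mul_cancel₀ (hc _ hq), one_smul]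

/-- The vector `(κ, μ, …, μ)`. -/
def axisym (n : ℕ) (κ μ : ℝ) : Fin n → ℝ := fun i => if (i : ℕ) = 0 then κ else μ

theorem cyl_eq_axisym (n : ℕ) (t : ℝ) : cyl n t = axisym n t 1 := rfl

theorem fderiv_apply_eq {E F : Type*} [NormedAddCommGroup E] [NormedSpace ℝ E]
    [NormedAddCommGroup F] [NormedSpace ℝ F] {f : E → F} {f' : E →L[ℝ] F} {p w : E} {y : F}
    (h : HasFDerivAt f f' p) (hw : f' w = y) : fderiv ℝ f p w = y := by
  rw [h.fderiv, hw]

theorem HasFDerivAt.real_smul {E F : Type*} [NormedAddCommGroup E] [NormedSpace ℝ E]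
    [NormedAddCommGroup F] [NormedSpace ℝ F] {α : E → ℝ} {ξ : E → F} {A : E →L[ℝ] ℝ}
    {X : E →L[ℝ] F} {p : E} (hα : HasFDerivAt α A p) (hξ : HasFDerivAt ξ X p) :
    HasFDerivAt (fun q => α q • ξ q) (α p • X + A.smulRight (ξ p)) p := hα.smul hξ

theorem fderiv_radialNormal {Θ : ℝ × ℝ → ℝ} {p : Rn1 n} (hp : 0 < ‖p.fst‖) {L : ℝ × ℝ →L[ℝ] ℝ}
    (hΘ : HasFDerivAt Θ L (cylCoord p)) (w : Rn1 n) :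
    fderiv ℝ (radialNormal Θ) p w =
      pt ((-(Real.sin (Θ (cylCoord p)) / ‖p.fst‖)) • w.fst +
        (-(Real.cos (Θ (cylCoord p)) * L (cylCoordDeriv p w) / ‖p.fst‖ -
          Real.sin (Θ (cylCoord p)) * (cylCoordDeriv p w).1 / ‖p.fst‖ ^ 2)) • p.fst)
        (-(Real.sin (Θ (cylCoord p)) * L (cylCoordDeriv p w))) := by
  have hc := hasFDerivAt_cylCoord hp
  have h1 : HasFDerivAt (fun q : Rn1 n => Θ (cylCoord q)) (L.comp (cylCoordDeriv p)) p :=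
    hΘ.comp p hc
  have h2 : HasFDerivAt (fun q : Rn1 n => ‖q.fst‖)
      ((ContinuousLinearMap.fst ℝ ℝ ℝ).comp (cylCoordDeriv p)) p :=
    HasFDerivAt.comp (g := Prod.fst) p hasFDerivAt_fst hc
  obtain ⟨A, hA, hAw⟩ : ∃ A : Rn1 n →L[ℝ] ℝ,
      HasFDerivAt (fun q : Rn1 n => -(Real.sin (Θ (cylCoord q)) / ‖q.fst‖)) A p ∧
      ∀ w, A w = -(Real.cos (Θ (cylCoord p)) * L (cylCoordDeriv p w) / ‖p.fst‖ -
        Real.sin (Θ (cylCoord p)) * (cylCoordDeriv p w).1 / ‖p.fst‖ ^ 2) := by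
    have h6 := h1.sin.mul ((hasDerivAt_inv hp.ne').comp_hasFDerivAt p h2)
    have h7 : HasFDerivAt (fun q : Rn1 n => Real.sin (Θ (cylCoord q)) / ‖q.fst‖) _ p :=
      h6.congr_of_eventuallyEq (Eventually.of_forall fun q => div_eq_mul_inv _ _)
    refine ⟨_, h7.neg, fun w => ?_⟩
    simp only [_root_.neg_apply, _root_.add_apply, _root_.smul_apply,
      ContinuousLinearMap.comp_apply, ContinuousLinearMap.coe_fst', smul_eq_mul,
      Function.comp_apply]
    field_simp
    ring
  have h3 : HasFDerivAt (fun q : Rn1 n => q.fst) (WithLp.fstL 2 ℝ (Rn n) ℝ) p :=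
    (WithLp.fstL 2 ℝ (Rn n) ℝ).hasFDerivAt
  have h4 : HasFDerivAt (fun q : Rn1 n => (-(Real.sin (Θ (cylCoord q)) / ‖q.fst‖)) • q.fst)
      ((-(Real.sin (Θ (cylCoord p)) / ‖p.fst‖)) • (WithLp.fstL 2 ℝ (Rn n) ℝ) + A.smulRight p.fst) p := hA.real_smul h3
  have h4' : HasFDerivAt (fun q : Rn1 n => Real.cos (Θ (cylCoord q)))
    (-Real.sin (Θ (cylCoord p)) • L.comp (cylCoordDeriv p)) p := h1.cos
  have h5 := h4.prodMk h4'
  have h6 := (ptL n).hasFDerivAt.comp p h5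
  have h7 : radialNormal Θ = (ptL n) ∘ fun q : Rn1 n =>
      ((-(Real.sin (Θ (cylCoord q)) / ‖q.fst‖)) • q.fst, Real.cos (Θ (cylCoord q))) := rfl
  rw [h7, ← hAw]
  refine fderiv_apply_eq (E := Rn1 n) (F := Rn1 n) h6 ?_
  rw [ContinuousLinearMap.comp_apply, ContinuousLinearMap.prod_apply, ptL_apply, ← neg_mul]
  rfl

/-- The meridian direction `(cos Θ · x / |x|, sin Θ)` is an eigenvector, because along it the normal
merely turns with the angle `Θ`. For horizontal vectors orthogonal to `x`, both `Θ` and `|x|` are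
stationary and only the factor `x` in the normal varies. -/
theorem isPrincipalCurvatures_radialNormal {Θ : ℝ × ℝ → ℝ} {p : Rn1 n} (hn : 0 < n)
    (hp : 0 < ‖p.fst‖) {L : ℝ × ℝ →L[ℝ] ℝ} (hΘ : HasFDerivAt Θ L (cylCoord p)) :
    IsPrincipalCurvatures (radialNormal Θ) p
      (axisym n (L (Real.cos (Θ (cylCoord p)), Real.sin (Θ (cylCoord p))))
        (Real.sin (Θ (cylCoord p)) / ‖p.fst‖)) := by
  set i₀ : Fin n := ⟨0, hn⟩
  set S := Real.sin (Θ (cylCoord p)) with hS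
  set C := Real.cos (Θ (cylCoord p)) with hC
  have hSC : S ^ 2 + C ^ 2 = 1 := Real.sin_sq_add_cos_sq _
  obtain ⟨B, hB⟩ := Orthonormal.exists_orthonormalBasis_extension_of_card_eq (𝕜 := ℝ)
    (E := Rn n) (ι := Fin n) (by simp) (v := fun _ => ‖p.fst‖⁻¹ • p.fst) (s := {i₀}) (by
      constructor
      · intro i
        simp [Set.domRestrict, norm_smul, hp.ne']
      · intro i j hij
        exact absurd (Subsingleton.elim i j) hij)
  have hB0 : B i₀ = ‖p.fst‖⁻¹ • p.fst := hB i₀ rfl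
  have hBo := B.orthonormal
  have hi : ∀ i : Fin n, (i : ℕ) = 0 ↔ i = i₀ := fun i => by simp [Fin.ext_iff, i₀]
  have hxB : p.fst = ‖p.fst‖ • B i₀ := by rw [hB0, smul_smul, mul_inv_cancel₀ hp.ne', one_smul]
  have hin : ∀ i j, inner ℝ (B i) (B j) = if i = j then (1 : ℝ) else 0 := fun i j =>
    orthonormal_iff_ite.1 hBo i j
  have hxi : ∀ i, inner ℝ p.fst (B i) = if i₀ = i then ‖p.fst‖ else 0 := fun i => by
    nth_rw 1 [hxB]
    rw [inner_smul_left, hin]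
    simp
  refine ⟨fun i => if i = i₀ then pt (C • B i) S else pt (B i) 0, ?_, ?_, ?_⟩
  · rw [orthonormal_iff_ite]
    intro i j
    by_cases h1 : i = i₀ <;> by_cases h2 : j = i₀ <;>
      simp only [h1, h2, if_true, if_false, inner_rn1, pt_fst, pt_snd, inner_smul_left,
        inner_smul_right, hin, conj_trivial, mul_one, mul_zero, zero_mul, add_zero]
    · nlinarith
    · simp [Ne.symm h2]
  · intro i
    by_cases h1 : i = i₀
    · simp only [h1, if_true, inner_rn1, radialNormal, pt_fst, pt_snd,
        inner_smul_right, real_inner_comm p.fst, hxi, ← hS, ← hC]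
      field_simp
      ring
    · simp only [h1, if_false, inner_rn1, radialNormal, pt_fst, pt_snd,
        inner_smul_right, real_inner_comm p.fst, hxi, if_neg (Ne.symm h1)]
      simp
  · intro i
    rw [fderiv_radialNormal hp hΘ]
    by_cases h1 : i = i₀
    · have e : cylCoordDeriv p (pt (C • B i₀) S) = (C, S) := by
        rw [cylCoordDeriv_apply, pt_fst, pt_snd, inner_smul_right, hxi, if_pos rfl]
        congr 1
        field_simp
      simp only [h1, if_true, e, axisym, (hi i₀).2 rfl, ← hS, ← hC]
      refine rn1_ext ?_ ?_
      · change (-(S / ‖p.fst‖)) • C • B i₀ + _ • p.fst = -(_ • C • B i₀)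
        have e2 : ∀ d : ℝ, d • p.fst = (d * ‖p.fst‖) • B i₀ := fun d => by rw [mul_smul, ← hxB]
        rw [e2, smul_smul, smul_smul, ← add_smul, ← neg_smul]
        congr 1
        field_simp
        ring
      · change -(S * _) = -(_ * S)
        ring
    · have e : cylCoordDeriv p (pt (B i) 0) = 0 := by
        rw [cylCoordDeriv_apply, pt_fst, pt_snd, hxi, if_neg (Ne.symm h1), mul_zero]
        rfl
      simp only [h1, if_false, e, axisym, (hi i).not.2 h1, ← hS]
      refine rn1_ext ?_ ?_
      · change (-(S / ‖p.fst‖)) • B i + _ • p.fst = -(_ • B i)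
        simp
      · change -(S * L 0) = -(_ * (0 : ℝ))
        simp

/-- Split the index sets of size `k + 1` according to whether they contain the distinguished index
`0`. -/
theorem Sk_axisym (hn : 0 < n) (k : ℕ) (κ μ : ℝ) :
    Sk (k + 1) (axisym n κ μ) =
      (n - 1).choose (k + 1) * μ ^ (k + 1) + (n - 1).choose k * κ * μ ^ k := by
  classical
  set i₀ : Fin n := ⟨0, hn⟩ with hi₀
  set s : Finset (Fin n) := Finset.univ.erase i₀
  have hs : i₀ ∉ s := Finset.notMem_erase _ _
  have hcard : s.card = n - 1 := by simp [s]
  have hμ : ∀ i ∈ s, axisym n κ μ i = μ := fun i hi => by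
    have : i ≠ i₀ := (Finset.mem_erase.1 hi).1
    exact if_neg fun h => this (Fin.ext h)
  have hκ : axisym n κ μ i₀ = κ := if_pos rfl
  have hprod : ∀ m, ∀ t ∈ s.powersetCard m, ∏ i ∈ t, axisym n κ μ i = μ ^ m := fun m t ht => by
    obtain ⟨h1, h2⟩ := Finset.mem_powersetCard.1 ht
    rw [Finset.prod_congr rfl fun i hi => hμ i (h1 hi), Finset.prod_const, h2]
  have hnot : ∀ m, ∀ t ∈ s.powersetCard m, i₀ ∉ t := fun m t ht h =>
    hs ((Finset.mem_powersetCard.1 ht).1 h)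
  have huniv : (Finset.univ : Finset (Fin n)) = insert i₀ s :=
    (Finset.insert_erase (Finset.mem_univ _)).symm
  rw [Sk, MvPolynomial.esymm, map_sum]
  simp only [map_prod, MvPolynomial.eval_X]
  rw [huniv, Finset.powersetCard_succ_insert hs, Finset.sum_union,
    Finset.sum_congr rfl (hprod (k + 1)), Finset.sum_image,
    Finset.sum_congr (s₁ := s.powersetCard k) rfl (g := fun _ => κ * μ ^ k)]
  · simp only [Finset.sum_const, Finset.card_powersetCard, hcard, nsmul_eq_mul]
    ring
  · intro t ht
    rw [Finset.prod_insert (hnot k t ht), hκ, hprod k t ht]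
  · intro t ht t' ht' e
    have := congrArg (fun u => u.erase i₀) e
    simpa [Finset.erase_insert (hnot k t ht), Finset.erase_insert (hnot k t' ht')] using this
  · rw [Finset.disjoint_left]
    intro t ht ht'
    obtain ⟨t', -, rfl⟩ := Finset.mem_image.1 ht'
    exact hnot _ _ ht (Finset.mem_insert_self _ _)

end Geometry

/-! ### Assembling a hypersurface from the neck and two branches -/

noncomputable section Assembly

open Set

variable {n : ℕ}

/-- Unit normal and principal curvatures of the graph of `u(|x|)`. -/
theorem exists_normal_of_graph {W : Set (Rn1 n)} {p : Rn1 n} (hn : 0 < n) {u v d : ℝ → ℝ}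
    {I Z : Set ℝ} (hI : IsOpen I) (hZ : IsOpen Z) (hI0 : ∀ r ∈ I, 0 < r)
    (hu : ∀ r ∈ I, HasDerivAt u (v r) r) (hv : ∀ r ∈ I, HasDerivAt v (d r) r)
    (hus : ContDiffOn ℝ ∞ u I) (hvs : ContDiffOn ℝ ∞ v I)
    (hW : ∀ q : Rn1 n, ‖q.fst‖ ∈ I → q.snd ∈ Z → (q ∈ W ↔ q.snd = u ‖q.fst‖))
    (hp1 : ‖p.fst‖ ∈ I) (hp2 : p.snd ∈ Z) :
    ∃ N : Rn1 n → Rn1 n, ∃ γ > 0, IsUnitNormalNear W p N ∧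
      IsPrincipalCurvatures N p (axisym n (γ * (d ‖p.fst‖ / (1 + v ‖p.fst‖ ^ 2)))
        (γ * (v ‖p.fst‖ / ‖p.fst‖))) ∧ inner ℝ (N p) (eVert n) = γ := by
  set V : Set (ℝ × ℝ) := I ×ˢ Z
  have hs0 : ∀ t : ℝ, 0 < √(1 + t ^ 2) := fun t => Real.sqrt_pos.2 (by positivity)
  -- With this angle `(-sin Θ, cos Θ)` is the upward normal of a graph of slope `v`, and the
  -- gradient of `z - u(r)` is `√(1 + v²)` times it.
  set Θ : ℝ × ℝ → ℝ := fun x => Real.arctan (v x.1) with hΘ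
  have hp0 := hI0 _ hp1
  have hΘd : HasFDerivAt Θ (((1 / (1 + v ‖p.fst‖ ^ 2)) * d ‖p.fst‖) • ContinuousLinearMap.fst ℝ ℝ ℝ)
      (cylCoord p) :=
    ((hv _ hp1).arctan).comp_hasFDerivAt (f := Prod.fst) (cylCoord p) hasFDerivAt_fst
  refine ⟨radialNormal Θ, (√(1 + v ‖p.fst‖ ^ 2))⁻¹, inv_pos.2 (hs0 _), ?_, ?_, ?_⟩
  · refine isUnitNormalNear_radialNormal (V := V) (hI.prod hZ) (fun x hx => hI0 _ hx.1) ⟨hp1, hp2⟩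
      (Φ := fun x => x.2 - u x.1) (c := fun x => √(1 + v x.1 ^ 2)) ?_ ?_ (fun x _ => (hs0 _).ne')
      ?_ ?_
    · exact contDiffOn_snd.sub (hus.comp contDiffOn_fst fun x hx => hx.1)
    · exact Real.contDiff_arctan.comp_contDiffOn (hvs.comp contDiffOn_fst fun x hx => hx.1)
    · intro x hx
      have h1 : HasFDerivAt (fun x : ℝ × ℝ => u x.1) (v x.1 • ContinuousLinearMap.fst ℝ ℝ ℝ) x :=
        (hu x.1 hx.1).comp_hasFDerivAt (f := Prod.fst) x hasFDerivAt_fst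
      refine (hasFDerivAt_snd.sub h1).congr_fderiv ?_
      have := (hs0 (v x.1)).ne'
      refine ContinuousLinearMap.ext fun w => ?_
      simp only [_root_.sub_apply, _root_.add_apply, _root_.smul_apply,
        ContinuousLinearMap.coe_fst', ContinuousLinearMap.coe_snd', smul_eq_mul, hΘ,
        Real.sin_arctan, Real.cos_arctan]
      field_simp
      ring
    · intro q hq
      rw [hW q hq.1 hq.2, sub_eq_zero]
      rfl
  · have h := isPrincipalCurvatures_radialNormal hn hp0 hΘd
    convert h using 2
    · simp only [hΘ, Real.cos_arctan, cylCoord, _root_.smul_apply, ContinuousLinearMap.coe_fst',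
        smul_eq_mul]
      field_simp
    · simp only [hΘ, Real.sin_arctan, cylCoord]
      field_simp
  · rw [inner_rn1]
    simp [radialNormal, eVert, hΘ, Real.cos_arctan, cylCoord]

/-- Unit normal and principal curvatures of `|x| = g(x_{n+1})` at a critical point of `g`. -/
theorem exists_normal_of_neck {W : Set (Rn1 n)} {p : Rn1 n} (hn : 0 < n) {g g' : ℝ → ℝ} {d : ℝ}
    {Z : Set ℝ} (hZ : IsOpen Z) (hg : ∀ z ∈ Z, HasDerivAt g (g' z) z)
    (hgs : ContDiffOn ℝ ∞ g Z) (hgs' : ContDiffOn ℝ ∞ g' Z)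
    (hW : ∀ q : Rn1 n, 0 < ‖q.fst‖ → q.snd ∈ Z → (q ∈ W ↔ ‖q.fst‖ = g q.snd))
    (hp1 : 0 < ‖p.fst‖) (hp2 : p.snd ∈ Z) (hp3 : g' p.snd = 0) (hp4 : HasDerivAt g' d p.snd) :
    ∃ N : Rn1 n → Rn1 n, IsUnitNormalNear W p N ∧
      IsPrincipalCurvatures N p (axisym n (-d) (1 / ‖p.fst‖)) ∧ inner ℝ (N p) (eVert n) = 0 := by
  set V : Set (ℝ × ℝ) := Ioi 0 ×ˢ Z
  have hs0 : ∀ t : ℝ, 0 < √(1 + t ^ 2) := fun t => Real.sqrt_pos.2 (by positivity)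
  -- The normal is now parallel to `(-1, g')`, the gradient of `g(z) - r`; at a critical point of
  -- `g` it points horizontally towards the axis.
  set Θ : ℝ × ℝ → ℝ := fun x => Real.pi / 2 - Real.arctan (g' x.2) with hΘ
  have hsin : ∀ x, Real.sin (Θ x) = 1 / √(1 + g' x.2 ^ 2) := fun x => by
    rw [hΘ, Real.sin_pi_div_two_sub, Real.cos_arctan]
  have hcos : ∀ x, Real.cos (Θ x) = g' x.2 / √(1 + g' x.2 ^ 2) := fun x => by
    rw [hΘ, Real.cos_pi_div_two_sub, Real.sin_arctan]
  have hΘd : HasFDerivAt Θ (-(((1 / (1 + g' p.snd ^ 2)) * d) • ContinuousLinearMap.snd ℝ ℝ ℝ))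
      (cylCoord p) :=
    (hp4.arctan.comp_hasFDerivAt (f := Prod.snd) (cylCoord p) hasFDerivAt_snd).const_sub _
  refine ⟨radialNormal Θ, ?_, ?_, ?_⟩
  · refine isUnitNormalNear_radialNormal (V := V) (isOpen_Ioi.prod hZ) (fun x hx => hx.1)
      ⟨hp1, hp2⟩ (Φ := fun x => g x.2 - x.1) (c := fun x => √(1 + g' x.2 ^ 2)) ?_ ?_
      (fun x _ => (hs0 _).ne') ?_ ?_
    · exact (hgs.comp contDiffOn_snd fun x hx => hx.2).sub contDiffOn_fst
    · exact contDiffOn_const.sub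
        (Real.contDiff_arctan.comp_contDiffOn (hgs'.comp contDiffOn_snd fun x hx => hx.2))
    · intro x hx
      have h1 : HasFDerivAt (fun x : ℝ × ℝ => g x.2) (g' x.2 • ContinuousLinearMap.snd ℝ ℝ ℝ) x :=
        (hg x.2 hx.2).comp_hasFDerivAt (f := Prod.snd) x hasFDerivAt_snd
      refine (h1.sub hasFDerivAt_fst).congr_fderiv ?_
      have := (hs0 (g' x.2)).ne'
      refine ContinuousLinearMap.ext fun w => ?_
      simp only [_root_.sub_apply, _root_.add_apply, _root_.smul_apply,
        ContinuousLinearMap.coe_fst', ContinuousLinearMap.coe_snd', smul_eq_mul, hsin, hcos]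
      field_simp
      ring
    · intro q hq
      rw [hW q hq.1 hq.2, sub_eq_zero]
      exact eq_comm
  · have h := isPrincipalCurvatures_radialNormal hn hp1 hΘd
    convert h using 2
    · simp [hsin, hcos, cylCoord, hp3]
    · simp [hsin, cylCoord, hp3]
  · rw [inner_rn1]
    simp [radialNormal, eVert, hcos, cylCoord, hp3]

/-- `Q`, with domain `A`, is the right-hand side of the equation `r'' = (1 + r'²) Q(r, r')` of the
rotationally symmetric translators `|x| = r(x_{n+1})` with speed `f`, `D`. -/
structure IsProfileEquation (n : ℕ) (f : (Fin n → ℝ) → ℝ) (D : Set (Fin n → ℝ)) (Q : ℝ × ℝ → ℝ)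
    (A : Set (ℝ × ℝ)) : Prop where
  isOpen : IsOpen A
  smooth : ContDiffOn ℝ ∞ Q A
  graph : ∀ r v γ : ℝ, 0 < γ → v ≠ 0 → (r, v⁻¹) ∈ A →
    axisym n (γ * -(v * Q (r, v⁻¹))) (γ * (v / r)) ∈ D ∧
      f (axisym n (γ * -(v * Q (r, v⁻¹))) (γ * (v / r))) = γ
  neck_mem : ∀ r > 0, (r, 0) ∈ A ∧ 0 < Q (r, 0)
  neck : ∀ r > 0, axisym n (-Q (r, 0)) (1 / r) ∈ D ∧ f (axisym n (-Q (r, 0)) (1 / r)) = 0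

/-- Reflection of a profile equation. -/
def reflectFun (Q : ℝ × ℝ → ℝ) : ℝ × ℝ → ℝ := fun x => Q (x.1, -x.2)

/-- Reflection of a domain of a profile equation. -/
def reflectSet (A : Set (ℝ × ℝ)) : Set (ℝ × ℝ) := {x | (x.1, -x.2) ∈ A}

theorem IsBranch.smooth_v {Q : ℝ × ℝ → ℝ} {A : Set (ℝ × ℝ)} {R : ℝ} {I : Set ℝ} {g u v : ℝ → ℝ}
    (h : IsBranch Q A R I g u v) (hQ : ContDiffOn ℝ ∞ Q A) (hI : IsOpen I) :
    ContDiffOn ℝ ∞ v I := by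
  refine contDiffOn_infty_of_hasDerivAt
    (F := fun x : ℝ × ℝ => -((1 + x.2 ^ 2) * x.2 * Q (x.1, x.2⁻¹)))
    (Ω := {x | x.2 ≠ 0 ∧ (x.1, x.2⁻¹) ∈ A}) ?_ hI
    (fun r hr => ⟨(h.v_pos r hr).ne', h.mem r hr⟩) h.deriv_v
  refine (((contDiffOn_const.add (contDiffOn_snd.pow 2)).mul contDiffOn_snd).mul ?_).neg
  exact hQ.comp (contDiffOn_fst.prodMk (contDiffOn_snd.inv fun x hx => hx.1)) fun x hx => hx.2

theorem contDiffOn_infty_of_deriv {u v : ℝ → ℝ} {I : Set ℝ} (hI : IsOpen I)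
    (hv : ContDiffOn ℝ ∞ v I) (hu : ∀ r ∈ I, HasDerivAt u (v r) r) : ContDiffOn ℝ ∞ u I := by
  rw [contDiffOn_infty_iff_deriv_of_isOpen hI]
  exact ⟨fun r hr => (hu r hr).differentiableAt.differentiableWithinAt,
    hv.congr fun r hr => (hu r hr).deriv⟩

theorem IsBranch.smooth_u {Q : ℝ × ℝ → ℝ} {A : Set (ℝ × ℝ)} {R : ℝ} {I : Set ℝ} {g u v : ℝ → ℝ}
    (h : IsBranch Q A R I g u v) (hQ : ContDiffOn ℝ ∞ Q A) (hI : IsOpen I) (hIR : I ⊆ Ioi R) :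
    ContDiffOn ℝ ∞ u I :=
  contDiffOn_infty_of_deriv hI (h.smooth_v hQ hI) fun r hr => h.deriv_u r (hIR hr)

/-- `u` is nondecreasing from the value `0`, and `near_neck` at height `0` shows that it vanishes at
`R` only. -/
theorem IsBranch.u_pos {Q : ℝ × ℝ → ℝ} {A : Set (ℝ × ℝ)} {R : ℝ} {I : Set ℝ} {g u v : ℝ → ℝ}
    (h : IsBranch Q A R I g u v) (hg : g 0 = R) : ∀ r > R, 0 < u r := by
  intro r hr
  have hm : MonotoneOn u (Ici R) := by
    refine monotoneOn_of_deriv_nonneg (convex_Ici R) h.cont_u ?_ ?_ <;> rw [interior_Ici]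
    · exact fun s hs => (h.deriv_u s hs).differentiableAt.differentiableWithinAt
    · intro s hs
      rw [(h.deriv_u s hs).deriv]
      exact h.v_nonneg s hs
  have h0 : 0 ≤ u r := by
    rw [← h.u_neck]
    exact hm self_mem_Ici (le_of_lt hr) (le_of_lt hr)
  obtain ⟨ε, hε, hn⟩ := h.near_neck
  refine lt_of_le_of_ne h0 fun e => ?_
  have := (hn r (le_of_lt hr) 0 ⟨le_rfl, hε⟩).1 e.symm
  rw [hg] at this
  exact absurd this hr.ne'

theorem isClosed_graphOver_norm {φ : ℝ → ℝ} {J : Set ℝ} (hJ : IsClosed J) (hφ : ContinuousOn φ J) :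
    IsClosed (graphOver (fun x : Rn n => φ ‖x‖) {x | ‖x‖ ∈ J}) := by
  have h1 : IsClosed (J ×ˢ (univ : Set ℝ) ∩ (fun x : ℝ × ℝ => x.2 - φ x.1) ⁻¹' {0}) :=
    (continuousOn_snd.sub (hφ.comp continuousOn_fst
      fun x hx => hx.1)).preimage_isClosed_of_isClosed (hJ.prod isClosed_univ) isClosed_singleton
  have h2 := h1.preimage (continuous_cylCoord (n := n))
  convert h2 using 1
  ext q
  simp [graphOver, cylCoord, sub_eq_zero]

/-- The graph is a continuous image of the unit sphere times `J`; the sphere is connected because `n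
> 1`. -/
theorem isConnected_graphOver_norm (hn : 1 < n) {φ : ℝ → ℝ} {J : Set ℝ} (hJ : IsConnected J)
    (hJ0 : ∀ r ∈ J, 0 < r) (hφ : ContinuousOn φ J) :
    IsConnected (graphOver (fun x : Rn n => φ ‖x‖) {x | ‖x‖ ∈ J}) := by
  have hs : IsConnected (Metric.sphere (0 : Rn n) 1) :=
    isConnected_sphere (by simpa [rank_eq_card_basis (EuclideanSpace.basisFun (Fin n) ℝ).toBasis]
      using hn) 0 zero_le_one
  have himg : graphOver (fun x : Rn n => φ ‖x‖) {x | ‖x‖ ∈ J} =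
      (fun y : Rn n × ℝ => pt (y.2 • y.1) (φ y.2)) '' (Metric.sphere (0 : Rn n) 1 ×ˢ J) := by
    ext q
    constructor
    · rintro ⟨h1, h2⟩
      have h0 : 0 < ‖q.fst‖ := hJ0 _ h1
      refine ⟨(‖q.fst‖⁻¹ • q.fst, ‖q.fst‖), ⟨?_, h1⟩, ?_⟩
      · simp [norm_smul, h0.ne']
      · refine rn1_ext ?_ h2.symm
        simp [smul_smul, h0.ne']
    · rintro ⟨⟨s, t⟩, ⟨h1, h2⟩, rfl⟩
      have h3 : ‖t • s‖ = t := by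
        rw [norm_smul, mem_sphere_zero_iff_norm.1 h1, mul_one, Real.norm_of_nonneg (hJ0 t h2).le]
      refine ⟨?_, ?_⟩
      · simpa [h3] using h2
      · simp [h3]
  rw [himg]
  refine (hs.prod hJ).image _ ?_
  refine (ptL n).continuous.comp_continuousOn ((continuousOn_snd.smul continuousOn_fst).prodMk ?_)
  exact hφ.comp continuousOn_snd fun x hx => hx.2

/-- The rotationally symmetric set with upper branch `a` over `r ≥ R` and lower branch `b` over
`r ∈ J`. -/
def wing (n : ℕ) (R : ℝ) (J : Set ℝ) (a b : ℝ → ℝ) : Set (Rn1 n) :=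
  graphOver (fun x : Rn n => a ‖x‖) {x | R ≤ ‖x‖} ∪ graphOver (fun x => b ‖x‖) {x | ‖x‖ ∈ J}

theorem mem_wing {R : ℝ} {J : Set ℝ} {a b : ℝ → ℝ} {q : Rn1 n} :
    q ∈ wing n R J a b ↔ (R ≤ ‖q.fst‖ ∧ q.snd = a ‖q.fst‖) ∨ (‖q.fst‖ ∈ J ∧ q.snd = b ‖q.fst‖) :=
  Iff.rfl

/-- For the lower branch, `I` is where the equation holds, `J` the domain and `E` the set of
boundary radii. The two uses are `(R, ∞)`, `[R, ∞)`, `∅` and `(R, ρ)`, `[R, ρ]`, `{ρ}`. Away from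
the neck the sign of the height separates the branches, so near each point the set is a single
graph. -/
theorem isWingLike_wing (hn : 2 ≤ n) {f : (Fin n → ℝ) → ℝ} {D : Set (Fin n → ℝ)} {Q : ℝ × ℝ → ℝ}
    {A Ω : Set (ℝ × ℝ)} (hQ : IsProfileEquation n f D Q A) {R δ : ℝ} (hR : 0 < R) (hδ : 0 < δ)
    {g p : ℝ → ℝ} (hΩ : ∀ x ∈ Ω, 0 < Q x) (hg : IsNeckArc Q Ω R δ g p)
    (hgs : ContDiffOn ℝ ∞ g (Ioo (-δ) δ)) {I J E : Set ℝ} (hI : IsOpen I) (hIR : I ⊆ Ioi R)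
    (hJ : IsClosed J) (hJc : IsConnected J) (hJR : J ⊆ Ici R) (hRJ : J ∈ 𝓝[≥] R)
    (hIJ : I ⊆ J) (hJE : ∀ r ∈ J, r = R ∨ r ∈ I ∨ r ∈ E) (hEJ : E ⊆ J)
    {up vp um vm : ℝ → ℝ} (hp : IsBranch Q A R (Ioi R) g up vp)
    (hm : IsBranch (reflectFun Q) (reflectSet A) R I (fun z => g (-z)) um vm) {bd : Set (Rn1 n)}
    (hbd : bd = {q | ‖q.fst‖ ∈ E ∧ q.snd = -um ‖q.fst‖})
    (hbd1 : ∀ q ∈ bd, IsBoundaryPoint (wing n R J up fun r => -um r) q)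
    (hbd2 : ∀ W' : Set (Rn1 n), wing n R J up (fun r => -um r) ⊆ W' → ∀ q ∈ bd,
      ¬ IsTranslatorAt f D W' q) :
    IsWingLike f D R (wing n R J up fun r => -um r) bd := by
  have hn0 : 0 < n := by omega
  set W := wing n R J up fun r => -um r with hW
  have hup := hp.u_pos hg.g_zero
  have hum := hm.u_pos (by simpa using hg.g_zero)
  have hRJ' : R ∈ J := mem_of_mem_nhdsWithin self_mem_Ici hRJ
  have hup0 : ∀ r ≥ R, 0 ≤ up r := fun r hr => by
    rcases eq_or_lt_of_le hr with rfl | h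
    · exact hp.u_neck.ge
    · exact (hup r h).le
  have hum0 : ∀ r ≥ R, 0 ≤ um r := fun r hr => by
    rcases eq_or_lt_of_le hr with rfl | h
    · exact hm.u_neck.ge
    · exact (hum r h).le
  -- the set near the neck
  have hgc : ContinuousAt g 0 := (hg.deriv_g 0 ⟨by linarith, hδ⟩).continuousAt
  -- In a thin slab around height `0` both halves together form the smooth curve `r = g(z)`, which
  -- describes the set across the vertical tangent at the neck.
  obtain ⟨ε, hε, hεδ, hneck⟩ : ∃ ε > 0, ε ≤ δ ∧ ∀ q : Rn1 n, q.snd ∈ Ioo (-ε) ε →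
      (q ∈ W ↔ ‖q.fst‖ = g q.snd) := by
    obtain ⟨ε₁, hε₁, h₁⟩ := hp.near_neck
    obtain ⟨ε₂, hε₂, h₂⟩ := hm.near_neck
    have hev : ∀ᶠ z in 𝓝 (0 : ℝ), g z ∈ Ici R → g z ∈ J := by
      have : ∀ᶠ r in 𝓝 (g 0), r ∈ Ici R → r ∈ J := by
        rw [hg.g_zero]
        exact eventually_nhdsWithin_iff.1 hRJ
      exact hgc.eventually this
    obtain ⟨ε₃, hε₃, h₃⟩ := Metric.eventually_nhds_iff.1 hev
    refine ⟨min (min ε₁ ε₂) (min ε₃ δ), lt_min (lt_min hε₁ hε₂) (lt_min hε₃ hδ),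
      (min_le_right _ _).trans (min_le_right _ _), fun q hq => ?_⟩
    have habs := abs_lt.2 hq
    have a1 := abs_lt.1 (habs.trans_le ((min_le_left _ _).trans (min_le_left _ _)))
    have a2 := abs_lt.1 (habs.trans_le ((min_le_left _ _).trans (min_le_right _ _)))
    have a3 := habs.trans_le ((min_le_right _ _).trans (min_le_left _ _))
    have a4 := abs_lt.1 (habs.trans_le ((min_le_right _ _).trans (min_le_right _ _)))
    have hgR : R ≤ g q.snd := by
      rcases lt_trichotomy q.snd 0 with h | h | h
      · have h5 := IsNeckArc.lt_g (fun x (hx : x ∈ {x : ℝ × ℝ | (x.1, -x.2) ∈ Ω}) =>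
          hΩ (x.1, -x.2) hx) hg.reflect (-q.snd) ⟨by linarith, by linarith [a4.1]⟩
        simpa using h5.le
      · rw [h, hg.g_zero]
      · exact (hg.lt_g hΩ q.snd ⟨h, a4.2⟩).le
    have hgJ : g q.snd ∈ J := h₃ (by simpa using a3) hgR
    rw [hW, mem_wing]
    constructor
    · rintro (⟨h5, h6⟩ | ⟨h5, h6⟩)
      · exact (h₁ _ h5 q.snd ⟨h6 ▸ hup0 _ h5, a1.2⟩).1 h6.symm
      · have h7 := (h₂ _ (hJR h5) (-q.snd)
          ⟨by rw [h6, neg_neg]; exact hum0 _ (hJR h5), by linarith [a2.1]⟩).1 (by rw [h6, neg_neg])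
        simpa using h7
    · intro h5
      rcases le_total 0 q.snd with h | h
      · left
        refine ⟨h5 ▸ hgR, ?_⟩
        exact ((h₁ _ (h5 ▸ hgR) q.snd ⟨h, a1.2⟩).2 h5).symm
      · right
        refine ⟨h5 ▸ hgJ, ?_⟩
        have := (h₂ ‖q.fst‖ (h5 ▸ hgR) (-q.snd) ⟨by linarith, by linarith [a2.1]⟩).2
          (by rw [neg_neg]; exact h5)
        linarith
  have hpsm : ContDiffOn ℝ ∞ p (Ioo (-δ) δ) := by
    have := (contDiffOn_infty_iff_deriv_of_isOpen isOpen_Ioo).1 hgs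
    exact this.2.congr fun z hz => (hg.deriv_g z hz).deriv.symm
  have hneckN : ∀ q : Rn1 n, ‖q.fst‖ = R → q.snd = 0 → ∃ N : Rn1 n → Rn1 n,
      IsUnitNormalNear W q N ∧ IsPrincipalCurvatures N q (axisym n (-Q (R, 0)) (1 / R)) ∧
      inner ℝ (N q) (eVert n) = 0 := by
    intro q hq1 hq2
    have hsub : Ioo (-ε) ε ⊆ Ioo (-δ) δ := Ioo_subset_Ioo (by linarith) hεδ
    have hd := hg.deriv_p 0 ⟨by linarith, hδ⟩
    rw [hg.p_zero, hg.g_zero] at hd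
    have := exists_normal_of_neck (W := W) (p := q) hn0 (g := g) (g' := p) (Z := Ioo (-ε) ε)
      (d := Q (R, 0)) isOpen_Ioo (fun z hz => hg.deriv_g z (hsub hz)) (hgs.mono hsub)
      (hpsm.mono hsub) (fun x _ hx => hneck x hx) (by rw [hq1]; exact hR)
      (by rw [hq2]; exact ⟨by linarith, hε⟩) (by rw [hq2, hg.p_zero])
      (by rw [hq2]; simpa using hd)
    rwa [hq1] at this
  have hpt : ∃ x : Rn n, ‖x‖ = R := ⟨EuclideanSpace.single ⟨0, hn0⟩ R, by
    simp [abs_of_pos hR]⟩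
  have hneckW : ∀ x : Rn n, ‖x‖ = R → pt x 0 ∈ W := fun x hx =>
    Or.inl ⟨hx.ge, by simp [hx, hp.u_neck]⟩
  refine ⟨⟨?_, ?_, ?_, ?_, hbd1, hbd2⟩, ?_, ?_, ?_, hneckW⟩
  · -- connected
    obtain ⟨x, hx⟩ := hpt
    have h1 : IsConnected (graphOver (fun x : Rn n => up ‖x‖) {x | ‖x‖ ∈ Ici R}) :=
      isConnected_graphOver_norm (by omega) isConnected_Ici (fun r hr => hR.trans_le hr) hp.cont_u
    have h2 : IsConnected (graphOver (fun x : Rn n => -um ‖x‖) {x | ‖x‖ ∈ J}) :=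
      isConnected_graphOver_norm (φ := fun r => -um r) (by omega) hJc
        (fun r hr => hR.trans_le (hJR hr)) (hm.cont_u.mono hJR).neg
    refine IsConnected.union ⟨pt x 0, ⟨?_, ?_⟩, ?_, ?_⟩ h1 h2
    · exact hx.ge
    · simp [hx, hp.u_neck]
    · simpa [hx] using hRJ'
    · simp [hx, hm.u_neck]
  · exact (isClosed_graphOver_norm isClosed_Ici hp.cont_u).union
      (isClosed_graphOver_norm (φ := fun r => -um r) hJ (hm.cont_u.mono hJR).neg)
  · rw [hbd]
    exact fun q hq => Or.inr ⟨hEJ hq.1, hq.2⟩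
  · -- translator equation
    rintro q ⟨hqW, hqbd⟩
    refine ⟨hqW, ?_⟩
    have hcase : (‖q.fst‖ = R ∧ q.snd = 0) ∨ (R < ‖q.fst‖ ∧ q.snd = up ‖q.fst‖) ∨
        (‖q.fst‖ ∈ I ∧ q.snd = -um ‖q.fst‖) := by
      rcases mem_wing.1 hqW with ⟨h1, h2⟩ | ⟨h1, h2⟩
      · rcases eq_or_lt_of_le h1 with h | h
        · exact Or.inl ⟨h.symm, by rw [h2, ← h, hp.u_neck]⟩
        · exact Or.inr (Or.inl ⟨h, h2⟩)
      · rcases hJE _ h1 with h | h | h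
        · exact Or.inl ⟨h, by rw [h2, h, hm.u_neck, neg_zero]⟩
        · exact Or.inr (Or.inr ⟨h, h2⟩)
        · exact absurd (hbd ▸ ⟨h, h2⟩ : q ∈ bd) hqbd
    rcases hcase with ⟨h1, h2⟩ | ⟨h1, h2⟩ | ⟨h1, h2⟩
    · obtain ⟨N, hN1, hN2, hN3⟩ := hneckN q h1 h2
      obtain ⟨h3, h4⟩ := hQ.neck R hR
      exact ⟨N, _, hN1, hN2, h3, by rw [h4, hN3]⟩
    · obtain ⟨N, γ, hγ, hN1, hN2, hN3⟩ := exists_normal_of_graph (W := W) (p := q) hn0 (u := up)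
        (v := vp) (I := Ioi R) (Z := Ioi 0) isOpen_Ioi isOpen_Ioi (fun r hr => hR.trans hr)
        hp.deriv_u hp.deriv_v (hp.smooth_u hQ.smooth isOpen_Ioi le_rfl)
        (hp.smooth_v hQ.smooth isOpen_Ioi)
        (fun x hx hx' => by
          constructor
          · rintro (⟨-, h⟩ | ⟨h3, h⟩)
            · exact h
            · have h4 := hum0 _ (hJR h3)
              have h5 : 0 < x.snd := hx'
              simp only at h
              linarith
          · exact fun h => mem_wing.2 (Or.inl ⟨le_of_lt hx, h⟩))
        h1 (by rw [h2]; exact hup _ h1)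
      have hv := hp.v_pos _ h1
      obtain ⟨h3, h4⟩ := hQ.graph ‖q.fst‖ (vp ‖q.fst‖) γ hγ hv.ne' (hp.mem _ h1)
      have e : -((1 + vp ‖q.fst‖ ^ 2) * vp ‖q.fst‖ * Q (‖q.fst‖, (vp ‖q.fst‖)⁻¹)) /
          (1 + vp ‖q.fst‖ ^ 2) = -(vp ‖q.fst‖ * Q (‖q.fst‖, (vp ‖q.fst‖)⁻¹)) := by
        have : 1 + vp ‖q.fst‖ ^ 2 ≠ 0 := by positivity
        field_simp
      rw [e] at hN2
      exact ⟨N, _, hN1, hN2, h3, by rw [h4, hN3]⟩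
    · have hsm : ContDiffOn ℝ ∞ (reflectFun Q) (reflectSet A) :=
        hQ.smooth.comp (contDiffOn_fst.prodMk contDiffOn_snd.neg) fun x hx => hx
      obtain ⟨N, γ, hγ, hN1, hN2, hN3⟩ := exists_normal_of_graph (W := W) (p := q) hn0
        (u := fun r => -um r) (v := fun r => -vm r) (I := I) (Z := Iio 0) hI isOpen_Iio
        (fun r hr => hR.trans (hIR hr)) (fun r hr => (hm.deriv_u r (hIR hr)).neg)
        (fun r hr => (hm.deriv_v r hr).neg) (hm.smooth_u hsm hI hIR).neg (hm.smooth_v hsm hI).neg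
        (fun x hx hx' => by
          constructor
          · rintro (⟨h3, h⟩ | ⟨-, h⟩)
            · have h4 := hup0 _ h3
              have h5 : x.snd < 0 := hx'
              simp only at h
              linarith
            · exact h
          · exact fun h => Or.inr ⟨hIJ hx, h⟩)
        h1 (by rw [h2]; exact neg_lt_zero.2 (hum _ (hIR h1)))
      have hv := hm.v_pos _ h1
      have hmem : (‖q.fst‖, (-vm ‖q.fst‖)⁻¹) ∈ A := by
        rw [inv_neg]
        exact hm.mem _ h1
      obtain ⟨h3, h4⟩ := hQ.graph ‖q.fst‖ (-vm ‖q.fst‖) γ hγ (neg_ne_zero.2 hv.ne') hmem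
      -- The upward normal is kept on the lower branch, whose slope is `-vm`; the reflected equation
      -- for `vm` is the original one for `-vm`.
      have e : - -((1 + vm ‖q.fst‖ ^ 2) * vm ‖q.fst‖ * reflectFun Q (‖q.fst‖, (vm ‖q.fst‖)⁻¹)) /
          (1 + (-vm ‖q.fst‖) ^ 2) = -(-vm ‖q.fst‖ * Q (‖q.fst‖, (-vm ‖q.fst‖)⁻¹)) := by
        have : 1 + vm ‖q.fst‖ ^ 2 ≠ 0 := by positivity
        rw [neg_sq, inv_neg, reflectFun]
        field_simp
      rw [e] at hN2
      exact ⟨N, _, hN1, hN2, h3, by rw [h4, hN3]⟩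
  · intro T x t h
    simpa only [hW, mem_wing, pt_fst, pt_snd, LinearIsometryEquiv.norm_map] using h
  · obtain ⟨x, hx⟩ := hpt
    obtain ⟨N, hN1, hN2, -⟩ := hneckN (pt x 0) hx rfl
    -- At the neck the meridian curvature is `-Q(R, 0) < 0` and the others are `1 / R > 0`.
    refine ⟨pt x 0, hneckW x hx, N, _, hN1, hN2, ⟨0, hn0⟩, ⟨1, by omega⟩, ?_, ?_⟩
    · simpa [axisym] using (hQ.neck_mem R hR).2
    · simpa [axisym] using hR
  · rintro q (⟨h, -⟩ | ⟨h, -⟩)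
    · exact h
    · exact hJR h

end Assembly

/-! ### The boundary sphere for odd `k`: regularity and inextendibility -/

noncomputable section Boundary

open Set

variable {n : ℕ}

/-- One-sided information suffices: a closed ball is convex with nonempty interior, so derivatives
within it are unique even at its boundary points. -/
theorem fderiv_comp_eq_zero_of_eventually_eq_zero {E F : Type*} [NormedAddCommGroup E]
    [NormedSpace ℝ E] [NormedAddCommGroup F] [NormedSpace ℝ F] {φ : F → ℝ} {G : E → F}
    {L : E →L[ℝ] F} {y : E} (hφ : DifferentiableAt ℝ φ (G y)) (hG : HasFDerivAt G L y) {ρ : ℝ}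
    (hρ : 0 < ρ) (hy : ‖y‖ ≤ ρ) (hz : ∀ᶠ x in 𝓝[Metric.closedBall 0 ρ] y, φ (G x) = 0) (X : E) :
    fderiv ℝ φ (G y) (L X) = 0 := by
  have hyB : y ∈ Metric.closedBall (0 : E) ρ := by simpa using hy
  have huniq : UniqueDiffWithinAt ℝ (Metric.closedBall (0 : E) ρ) y := by
    refine uniqueDiffOn_convex (convex_closedBall 0 ρ) ?_ y hyB
    rw [interior_closedBall 0 hρ.ne']
    exact ⟨0, by simpa using hρ⟩
  have heq := huniq.eq (hφ.hasFDerivAt.comp y hG).hasFDerivWithinAt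
    ((hasFDerivWithinAt_const (0 : ℝ) y _).congr_of_eventuallyEq hz (hz.self_of_nhdsWithin hyB))
  exact congrArg (fun T => T X) heq

theorem inner_gradient_eq {φ : Rn1 n → ℝ} {q : Rn1 n} {L : Rn1 n →L[ℝ] ℝ} (h : HasFDerivAt φ L q)
    (w : Rn1 n) : inner ℝ (gradient φ q) w = L w := by
  have h1 := (hasGradientAt_iff_hasFDerivAt.2
    (show HasFDerivAt φ (InnerProductSpace.toDual ℝ (Rn1 n)
      ((InnerProductSpace.toDual ℝ (Rn1 n)).symm L)) q by
      rwa [LinearIsometryEquiv.apply_symm_apply])).gradient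
  rw [h1, InnerProductSpace.toDual_symm_apply]

/-- Where the lower branch ends with horizontal tangent, the wing has a boundary point. -/
theorem isBoundaryPoint_wing {R ρ : ℝ} (hR : 0 < R) (hRρ : R < ρ) {up um vm : ℝ → ℝ}
    (hup : ∀ r ≥ R, 0 ≤ up r) (hum : ∀ r > R, 0 < um r) (hd : ∀ r > R, HasDerivAt um (vm r) r)
    (hvc : ContinuousOn vm (Ioi R)) (hv0 : vm ρ = 0) {q : Rn1 n} (hq1 : ‖q.fst‖ = ρ)
    (hq2 : q.snd = -um ρ) :
    IsBoundaryPoint (wing n R (Icc R ρ) up fun r => -um r) q := by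
  have hρ : 0 < ρ := hR.trans hRρ
  have hUo : IsOpen {q : Rn1 n | R < ‖q.fst‖ ∧ q.snd < 0} :=
    (isOpen_lt continuous_const continuous_rn1_fst.norm).inter
      (isOpen_lt continuous_rn1_snd continuous_const)
  -- Because `um` is also defined beyond `ρ`, with continuous slope, `z + um(|x|)` is `C¹` on a full
  -- neighbourhood of the boundary sphere; `ρ - |x|` then cuts out the correct side.
  have hum1 : ContDiffOn ℝ 1 um (Ioi R) := by
    have := contDiffOn_succ_iff_deriv_of_isOpen (𝕜 := ℝ) (n := 0) (f := um) (isOpen_Ioi (a := R))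
    rw [zero_add] at this
    refine this.2 ⟨fun r hr => (hd r hr).differentiableAt.differentiableWithinAt, by simp, ?_⟩
    exact contDiffOn_zero.2 (hvc.congr fun r hr => (hd r hr).deriv)
  have hnorm1 : ContDiffOn ℝ 1 (fun q : Rn1 n => ‖q.fst‖) {q : Rn1 n | R < ‖q.fst‖ ∧ q.snd < 0} :=
    fun q hq => (contDiff_rn1_fst.contDiffAt.norm ℝ
      (norm_pos_iff.1 (hR.trans hq.1))).contDiffWithinAt
  have hq0 : 0 < ‖q.fst‖ := hq1 ▸ hρ
  have hcyl := hasFDerivAt_cylCoord hq0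
  have hd' : HasFDerivAt (fun x : ℝ × ℝ => x.2 + um x.1)
      (ContinuousLinearMap.snd ℝ ℝ ℝ + (0 : ℝ) • ContinuousLinearMap.fst ℝ ℝ ℝ) (cylCoord q) := by
    have h1 : HasDerivAt um 0 ((cylCoord q).1) := by
      have := hd ρ hRρ
      rw [hv0] at this
      change HasDerivAt um 0 ‖q.fst‖
      rwa [hq1]
    exact hasFDerivAt_snd.add (h1.comp_hasFDerivAt (f := Prod.fst) (cylCoord q) hasFDerivAt_fst)
  have hψ' : HasFDerivAt (fun x : ℝ × ℝ => ρ - x.1) (-ContinuousLinearMap.fst ℝ ℝ ℝ)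
      (cylCoord q) := hasFDerivAt_fst.const_sub ρ
  have hgφ : ∀ w : Rn1 n, inner ℝ (gradient (fun q : Rn1 n => q.snd + um ‖q.fst‖) q) w = w.snd := by
    intro w
    refine (inner_gradient_eq (φ := fun q : Rn1 n => q.snd + um ‖q.fst‖)
      (HasFDerivAt.comp q hd' hcyl) w).trans ?_
    simp [cylCoordDeriv_apply]
  have hgψ : ∀ w : Rn1 n, inner ℝ (gradient (fun q : Rn1 n => ρ - ‖q.fst‖) q) w =
      -(‖q.fst‖⁻¹ * inner ℝ q.fst w.fst) := by
    intro w
    refine (inner_gradient_eq (φ := fun q : Rn1 n => ρ - ‖q.fst‖)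
      (HasFDerivAt.comp (g := fun x : ℝ × ℝ => ρ - x.1) (f := cylCoord) q hψ' hcyl) w).trans ?_
    simp [cylCoordDeriv_apply]
  refine ⟨{q : Rn1 n | R < ‖q.fst‖ ∧ q.snd < 0}, hUo, ⟨hq1 ▸ hRρ, by
    rw [hq2]; exact neg_lt_zero.2 (hum ρ hRρ)⟩, fun q => q.snd + um ‖q.fst‖,
    fun q => ρ - ‖q.fst‖, ?_, contDiffOn_const.sub hnorm1, by simp [hq1, hq2], by simp [hq1],
    ?_, ?_⟩
  · exact contDiff_rn1_snd.contDiffOn.add (hum1.comp hnorm1 fun q hq => hq.1)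
  · rw [LinearIndependent.pair_iff]
    intro s t hst
    have h1 : ∀ w : Rn1 n, s * w.snd + t * (-(‖q.fst‖⁻¹ * inner ℝ q.fst w.fst)) = 0 := by
      intro w
      have := congrArg (fun z => inner ℝ z w) hst
      simpa only [inner_add_left, inner_smul_left, hgφ, hgψ, inner_zero_left, conj_trivial]
        using this
    have h2 := h1 (pt 0 1)
    have h3 := h1 (pt q.fst 0)
    simp only [pt_fst, pt_snd, inner_zero_right, real_inner_self_eq_norm_sq] at h2 h3
    refine ⟨by simpa using h2, ?_⟩
    have h4 : ‖q.fst‖⁻¹ * ‖q.fst‖ ^ 2 = ‖q.fst‖ := by field_simp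
    rw [h4, mul_zero, zero_add, mul_neg, neg_eq_zero] at h3
    exact (mul_eq_zero.1 h3).resolve_right hq0.ne'
  · ext x
    simp only [mem_inter_iff, mem_wing, mem_ofPred_eq, mem_Icc]
    constructor
    · rintro ⟨⟨h1, h2⟩ | ⟨h1, h2⟩, h3, h4⟩
      · exact absurd (hup _ h1) (by rw [← h2]; exact not_le.2 h4)
      · exact ⟨⟨h3, h4⟩, by rw [h2]; ring, by linarith [h1.2]⟩
    · rintro ⟨⟨h3, h4⟩, h5, h6⟩
      exact ⟨Or.inr ⟨⟨h3.le, by linarith⟩, by linarith⟩, h3, h4⟩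

/-- A function that vanishes on a ring `R < |x| ≤ ρ` of a rotationally symmetric graph with
horizontal tangent plane along `|x| = ρ` has a vertical gradient there. -/
theorem gradient_fst_eq_zero_of_horizontal {R ρ : ℝ} (hR : 0 < R) (hRρ : R < ρ) {w : ℝ → ℝ}
    (hw : HasDerivAt w 0 ρ) {U : Set (Rn1 n)} (hU : IsOpen U) {y : Rn n} (hy : ‖y‖ = ρ)
    (hyU : pt y (w ρ) ∈ U) {φ : Rn1 n → ℝ} (hφ : DifferentiableAt ℝ φ (pt y (w ρ)))
    (hzero : ∀ x : Rn n, R < ‖x‖ → ‖x‖ ≤ ρ → pt x (w ‖x‖) ∈ U → φ (pt x (w ‖x‖)) = 0) :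
    (gradient φ (pt y (w ρ))).fst = 0 := by
  have hρ : 0 < ρ := hR.trans hRρ
  have hRy : R < ‖y‖ := hy.symm ▸ hRρ
  have hy0 : y ≠ 0 := norm_pos_iff.1 (hy ▸ hρ)
  have hφd := hφ.hasFDerivAt
  have hwy : HasFDerivAt (fun x : Rn n => w ‖x‖) ((0 : ℝ) • (‖y‖⁻¹ • innerSL ℝ y)) y :=
    HasDerivAt.comp_hasFDerivAt y (hy.symm ▸ hw) (hasFDerivAt_norm_of_ne_zero hy0)
  rw [zero_smul] at hwy
  have hG : HasFDerivAt (fun x : Rn n => pt x (w ‖x‖))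
      ((ptL n).comp ((ContinuousLinearMap.id ℝ (Rn n)).prod 0)) y :=
    HasFDerivAt.comp (g := ptL n) y (ptL n).hasFDerivAt ((hasFDerivAt_id y).prodMk hwy)
  have hGc : ContinuousAt (fun x : Rn n => pt x (w ‖x‖)) y :=
    ContinuousAt.comp (g := ptL n) (ptL n).continuous.continuousAt
      (continuousAt_id.prodMk hwy.continuousAt)
  have hz : ∀ᶠ x in 𝓝[Metric.closedBall 0 ρ] y, φ (pt x (w ‖x‖)) = 0 := by
    have h1 : ∀ᶠ x in 𝓝 y, R < ‖x‖ := continuous_norm.continuousAt.eventually_const_lt hRy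
    have h2 : ∀ᶠ x in 𝓝 y, pt x (w ‖x‖) ∈ U :=
      hGc.eventually_mem (hU.mem_nhds (by rwa [hy]))
    filter_upwards [mem_nhdsWithin_of_mem_nhds h1, mem_nhdsWithin_of_mem_nhds h2,
      self_mem_nhdsWithin] with x a1 a2 a3
    exact hzero x a1 (by simpa using a3) a2
  refine ext_inner_right ℝ fun X => ?_
  have h1 := inner_gradient_eq hφd (pt X 0)
  have h2 : fderiv ℝ φ (pt y (w ρ)) (pt X 0) = 0 := by
    have := fderiv_comp_eq_zero_of_eventually_eq_zero (E := Rn n) (F := Rn1 n) (φ := φ)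
      (G := fun x : Rn n => pt x (w ‖x‖)) (by rwa [hy]) hG hρ hy.le hz X
    rwa [hy] at this
  rw [h2, inner_rn1] at h1
  simpa using h1

/-- Differentiate `T N = 0` and `(S N)² = 1` along the curve; in the second identity `S N ≠ 0` can
be cancelled. -/
theorem clm_fderiv_eq_zero_of_constant {E F : Type*} [NormedAddCommGroup E] [NormedSpace ℝ E]
    [NormedAddCommGroup F] [NormedSpace ℝ F] (P : E × ℝ →L[ℝ] F) (T : F →L[ℝ] E) (S : F →L[ℝ] ℝ)
    {N : F → F} {y : ℝ → E} {X : E} {h : ℝ} (hN : DifferentiableAt ℝ N (P (y 0, h)))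
    (hy : HasDerivAt y X 0) {U : Set F} (hU : U ∈ 𝓝 (P (y 0, h)))
    (hv : ∀ t, P (y t, h) ∈ U → T (N (P (y t, h))) = 0 ∧ S (N (P (y t, h))) ^ 2 = 1) :
    T (fderiv ℝ N (P (y 0, h)) (P (X, 0))) = 0 ∧ S (fderiv ℝ N (P (y 0, h)) (P (X, 0))) = 0 := by
  have hγ : HasDerivAt (fun t => P (y t, h)) (P (X, 0)) 0 :=
    P.hasFDerivAt.comp_hasDerivAt 0 (hy.prodMk (hasDerivAt_const 0 h))
  have hNγ := hN.hasFDerivAt.comp_hasDerivAt 0 hγ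
  have hev : ∀ᶠ t in 𝓝 (0 : ℝ), P (y t, h) ∈ U := hγ.continuousAt.eventually_mem hU
  constructor
  · refine (T.hasFDerivAt.comp_hasDerivAt 0 hNγ).unique
      ((hasDerivAt_const (0 : ℝ) (0 : E)).congr_of_eventuallyEq ?_)
    filter_upwards [hev] with t ht using (hv t ht).1
  · have h1 := ((S.hasFDerivAt.comp_hasDerivAt 0 hNγ).pow 2).unique
      ((hasDerivAt_const (0 : ℝ) (1 : ℝ)).congr_of_eventuallyEq (by
        filter_upwards [hev] with t ht using (hv t ht).2))
    have h2 := (hv 0 (mem_of_mem_nhds hU)).2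
    have h3 : S (N (P (y 0, h))) ≠ 0 := fun h => by
      rw [h] at h2
      norm_num at h2
    have h4 : S (fderiv ℝ N (P (y 0, h)) (P (X, 0))) = 0 ∨ S (N (P (y 0, h))) = 0 := by
      simpa [or_comm] using h1
    exact h4.resolve_right h3

/-- A vector field that is vertical of length one along the curve `y`, at constant height, has a
vanishing derivative along it. -/
theorem fderiv_eq_zero_of_vertical {N : Rn1 n → Rn1 n} {y : ℝ → Rn n} {X : Rn n} {h : ℝ}
    (hN : DifferentiableAt ℝ N (pt (y 0) h)) (hy : HasDerivAt y X 0) {U : Set (Rn1 n)}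
    (hU : U ∈ 𝓝 (pt (y 0) h))
    (hv : ∀ t, pt (y t) h ∈ U → (N (pt (y t) h)).fst = 0 ∧ (N (pt (y t) h)).snd ^ 2 = 1) :
    fderiv ℝ N (pt (y 0) h) (pt X 0) = 0 := by
  have := clm_fderiv_eq_zero_of_constant (E := Rn n) (F := Rn1 n) (ptL n)
    (WithLp.fstL 2 ℝ (Rn n) ℝ) (WithLp.sndL 2 ℝ (Rn n) ℝ) hN hy hU hv
  exact rn1_ext this.1 this.2

/-- A translator whose speed vanishes when at most one principal curvature does not vanish cannot
contain a ring `R < |x| ≤ ρ` whose tangent plane is horizontal along `|x| = ρ`. -/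
theorem not_isTranslatorAt_of_horizontal {f : (Fin n → ℝ) → ℝ} {D : Set (Fin n → ℝ)}
    (hf : ∀ lam : Fin n → ℝ, (∀ i j, i ≠ j → lam i = 0 ∨ lam j = 0) → f lam = 0)
    {R ρ : ℝ} (hR : 0 < R) (hRρ : R < ρ) {w : ℝ → ℝ} (hw : HasDerivAt w 0 ρ) {W : Set (Rn1 n)}
    (hW : ∀ x : Rn n, R < ‖x‖ → ‖x‖ ≤ ρ → pt x (w ‖x‖) ∈ W) {q : Rn1 n} (hq1 : ‖q.fst‖ = ρ)
    (hq2 : q.snd = w ρ) : ¬ IsTranslatorAt f D W q := by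
  have hρ : 0 < ρ := hR.trans hRρ
  rintro ⟨-, N, lam, ⟨U, hU, hqU, φ, hφ, -, hWU, hNs, hN⟩, ⟨b, hbo, hbN, hbd⟩, -, hfl⟩
  have hvert : ∀ y : Rn n, ‖y‖ = ρ → pt y (w ρ) ∈ U → (gradient φ (pt y (w ρ))).fst = 0 := by
    intro y hy hyU
    refine gradient_fst_eq_zero_of_horizontal hR hRρ hw hU hy hyU
      ((hφ.contDiffAt (hU.mem_nhds hyU)).differentiableAt (by simp)) fun x h1 h2 h3 => ?_
    have : pt x (w ‖x‖) ∈ W ∩ U := ⟨hW x h1 h2, h3⟩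
    rw [hWU] at this
    exact this.2
  have hWsphere : ∀ y : Rn n, ‖y‖ = ρ → pt y (w ρ) ∈ W := fun y hy => by
    have := hW y (hy ▸ hRρ) hy.le
    rwa [hy] at this
  have hNv : ∀ y : Rn n, ‖y‖ = ρ → pt y (w ρ) ∈ U →
      (N (pt y (w ρ))).fst = 0 ∧ (N (pt y (w ρ))).snd ^ 2 = 1 := by
    intro y hy hyU
    obtain ⟨h1, c, h2⟩ := hN _ ⟨hWsphere y hy, hyU⟩
    have h3 : (N (pt y (w ρ))).fst = 0 := by
      rw [h2, WithLp.smul_fst, hvert y hy hyU, smul_zero]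
    refine ⟨h3, ?_⟩
    have h4 := inner_rn1 (N (pt y (w ρ))) (N (pt y (w ρ)))
    rw [h3, real_inner_self_eq_norm_sq, h1, inner_zero_left] at h4
    linarith
  have hqpt : pt q.fst (w ρ) = q := rn1_ext rfl hq2.symm
  have hNq := hNv q.fst hq1 (hqpt.symm ▸ hqU)
  rw [hqpt] at hNq
  have hs0 : (N q).snd ≠ 0 := fun h => by
    have := hNq.2
    rw [h] at this
    norm_num at this
  -- the differential of the normal vanishes in the directions tangent to the sphere
  have hzero' : ∀ X : Rn n, ‖X‖ = ρ → inner ℝ q.fst X = 0 → fderiv ℝ N q (pt X 0) = 0 := by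
    intro X hX hXq
    -- A great circle of the sphere `|x| = ρ` through `q.fst` with initial velocity `X`.
    set y : ℝ → Rn n := fun t => Real.cos t • q.fst + Real.sin t • X with hy
    have hyn : ∀ t, ‖y t‖ = ρ := fun t => by
      have : ‖y t‖ ^ 2 = ρ ^ 2 := by
        rw [hy, norm_add_sq_real, norm_smul, norm_smul, inner_smul_left, inner_smul_right, hXq,
          hq1, hX, Real.norm_eq_abs, Real.norm_eq_abs, mul_pow, mul_pow, sq_abs, sq_abs]
        linear_combination ρ ^ 2 * Real.sin_sq_add_cos_sq t
      exact (sq_eq_sq₀ (norm_nonneg _) hρ.le).1 this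
    have hyd : HasDerivAt y X 0 := by
      have := ((Real.hasDerivAt_cos 0).smul_const q.fst).add
        ((Real.hasDerivAt_sin 0).smul_const X)
      exact HasDerivAt.congr_deriv (f := y) this (by simp)
    have hγ0 : pt (y 0) (w ρ) = q := by
      rw [← hqpt]
      simp [hy]
    have := fderiv_eq_zero_of_vertical (N := N) (y := y) (h := w ρ) (U := U)
      (by rw [hγ0]; exact (hNs.contDiffAt (hU.mem_nhds hqU)).differentiableAt (by simp)) hyd
      (by rw [hγ0]; exact hU.mem_nhds hqU) fun t ht => hNv _ (hyn t) ht
    rwa [hγ0] at this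
  have hzero : ∀ X : Rn n, inner ℝ q.fst X = 0 → fderiv ℝ N q (pt X 0) = 0 := by
    intro X hXq
    rcases eq_or_ne X 0 with rfl | hX
    · have : (pt (0 : Rn n) 0 : Rn1 n) = 0 := rfl
      rw [this, map_zero]
    · have hX0 : 0 < ‖X‖ := norm_pos_iff.2 hX
      have h1 := hzero' ((ρ / ‖X‖) • X) (by
        rw [norm_smul, Real.norm_of_nonneg (by positivity)]
        field_simp) (by rw [inner_smul_right, hXq, mul_zero])
      have h2 : pt ((ρ / ‖X‖) • X) 0 = (ρ / ‖X‖) • pt X 0 := by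
        refine rn1_ext rfl ?_
        rw [WithLp.smul_snd, pt_snd, pt_snd, smul_zero]
      rw [h2, map_smul] at h1
      exact (smul_eq_zero.1 h1).resolve_left (by positivity)
  have hbs : ∀ i, (b i).snd = 0 := fun i => by
    have := hbN i
    rw [inner_rn1, hNq.1, inner_zero_right, zero_add] at this
    exact (mul_eq_zero.1 this).resolve_right hs0
  have hbpt : ∀ i, pt (b i).fst 0 = b i := fun i => rn1_ext rfl (hbs i).symm
  have hbi : ∀ i j, inner ℝ (b i) (b j) = if i = j then (1 : ℝ) else 0 := fun i j =>
    orthonormal_iff_ite.1 hbo i j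
  have hlam : ∀ i j, i ≠ j → lam i = 0 ∨ lam j = 0 := by
    intro i j hij
    by_contra! hne
    -- The combination `α b_i - β b_j` is orthogonal to the radial direction, so `dN` annihilates
    -- it. With `lam i ≠ 0` this forces `α = 0`; then `b j` is itself orthogonal to the radial
    -- direction and `lam j = 0`.
    set α := inner ℝ q.fst (b j).fst with hα
    set β := inner ℝ q.fst (b i).fst with hβ
    have h1 := hzero (α • (b i).fst - β • (b j).fst) (by
      rw [inner_sub_right, inner_smul_right, inner_smul_right, ← hα, ← hβ]
      ring)
    have h2 : pt (α • (b i).fst - β • (b j).fst) 0 = α • b i - β • b j := by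
      refine rn1_ext rfl ?_
      rw [WithLp.sub_snd, WithLp.smul_snd, WithLp.smul_snd, hbs, hbs, pt_snd]
      simp
    rw [h2, map_sub, map_smul, map_smul, hbd, hbd] at h1
    have h3 := congrArg (fun z => inner ℝ z (b i)) h1
    simp only [inner_sub_left, inner_smul_left, inner_neg_left, hbi, conj_trivial, if_true,
      if_neg hij.symm, inner_zero_left] at h3
    have hα0 : α = 0 := by
      have : α * lam i = 0 := by linarith
      exact (mul_eq_zero.1 this).resolve_right hne.1
    have h4 := hzero (b j).fst hα0
    rw [hbpt, hbd] at h4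
    have h5 := congrArg (fun z => inner ℝ z (b j)) h4
    simp only [inner_smul_left, inner_neg_left, hbi, conj_trivial, if_true, inner_zero_left] at h5
    exact hne.2 (by linarith)
  -- The speed is `0`, but the vertical unit normal has `⟨N, e_{n+1}⟩ ≠ 0`.
  rw [hf lam hlam, inner_rn1] at hfl
  simp only [hNq.1, eVert, pt_fst, pt_snd, inner_zero_left, mul_one, zero_add] at hfl
  exact hs0 hfl.symm

/-- Each monomial of `S_k` has at least two distinct factors, one of which vanishes. -/
theorem rootSpeed_eq_zero {k : ℕ} (hk : 2 ≤ k) (lam : Fin n → ℝ)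
    (h : ∀ i j, i ≠ j → lam i = 0 ∨ lam j = 0) : rootSpeed k lam = 0 := by
  have h0 : Sk k lam = 0 := by
    rw [Sk, MvPolynomial.esymm, map_sum]
    refine Finset.sum_eq_zero fun t ht => ?_
    have hcard := (Finset.mem_powersetCard.1 ht).2
    obtain ⟨i, hi, j, hj, hij⟩ := Finset.one_lt_card.1 (by omega : 1 < t.card)
    simp only [map_prod, MvPolynomial.eval_X]
    rcases h i j hij with h | h
    · exact Finset.prod_eq_zero hi h
    · exact Finset.prod_eq_zero hj h
  simp [rootSpeed, h0]

end Boundary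

/-! ### The profile equations of the two speeds, and their data at the cylinder -/

noncomputable section Profiles

open Set

variable {n : ℕ}

/-- Strict log-concavity of binomial coefficients, read off from the ratios of consecutive ones. It
makes the determinant `b² - a c` of the quotient equation positive. -/
theorem choose_mul_choose_lt_sq {N m : ℕ} (h : m + 2 ≤ N) :
    (N.choose (m + 2) : ℝ) * N.choose m < (N.choose (m + 1) : ℝ) ^ 2 := by
  have h1 := Nat.choose_succ_right_eq N m
  have h2 := Nat.choose_succ_right_eq N (m + 1)
  obtain ⟨d, rfl⟩ := Nat.exists_eq_add_of_le h
  have e1 : m + 2 + d - m = d + 2 := by omega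
  have e2 : m + 2 + d - (m + 1) = d + 1 := by omega
  rw [e1] at h1
  rw [e2] at h2
  have p0 : 0 < (m + 2 + d).choose m := Nat.choose_pos (by omega)
  have p1 : 0 < (m + 2 + d).choose (m + 1) := Nat.choose_pos (by omega)
  generalize (m + 2 + d).choose m = x at *
  generalize (m + 2 + d).choose (m + 1) = y at *
  have h2' : (m + 2 + d).choose (m + 2) * (m + 2) = y * (d + 1) := h2
  generalize (m + 2 + d).choose (m + 2) = z at *
  have h3 : z * x * ((m + 2) * (d + 2)) < y ^ 2 * ((m + 2) * (d + 2)) := by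
    calc z * x * ((m + 2) * (d + 2)) = (z * (m + 2)) * (x * (d + 2)) := by ring
      _ = y ^ 2 * ((d + 1) * (m + 1)) := by rw [h2', ← h1]; ring
      _ < y ^ 2 * ((m + 2) * (d + 2)) := by
        refine Nat.mul_lt_mul_of_pos_left ?_ (by positivity)
        nlinarith
  exact_mod_cast Nat.lt_of_mul_lt_mul_right h3

/-- The profile equation of the translators with speed `√[k]{S_k}`. -/
def rootProfile (a b : ℝ) (k : ℕ) (x : ℝ × ℝ) : ℝ := (a / x.1 - x.1 ^ (k - 1) * x.2 ^ k) / b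

/-- The profile equation of the translators with speed `S_k / S_{k-1}`. -/
def quotProfile (a b c : ℝ) (x : ℝ × ℝ) : ℝ :=
  (a - b * (x.1 * x.2)) / (x.1 * (b - c * (x.1 * x.2)))

/-- The domain of `quotProfile`. -/
def quotProfileDomain (b c : ℝ) : Set (ℝ × ℝ) := {x | 0 < x.1 ∧ 0 < b - c * (x.1 * x.2)}

theorem rootSpeed_of_Sk_eq {k : ℕ} {lam : Fin n → ℝ} {s : ℝ} (hs : 0 < s)
    (h : Sk k lam = s) : rootSpeed k lam = s ^ ((1 : ℝ) / k) := by
  rw [rootSpeed, h, Real.sign_of_pos hs, one_mul, abs_of_pos hs]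

/-- `-(v Q)` depends on `q = v / r` only: it is the solution `κ` of `a q ^ k + b κ q ^ (k - 1) = 1`.
-/
theorem mul_rootProfile (a : ℝ) {b r v : ℝ} (hb : b ≠ 0) (hr : r ≠ 0) (hv : v ≠ 0) {k : ℕ}
    (hk : k ≠ 0) :
    v * rootProfile a b k (r, v⁻¹) = (a * (v / r) ^ k - 1) / (b * (v / r) ^ (k - 1)) := by
  obtain ⟨m, rfl⟩ := Nat.exists_eq_succ_of_ne_zero hk
  simp only [rootProfile, Nat.succ_eq_add_one, Nat.add_sub_cancel, div_pow, inv_pow]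
  field_simp
  ring

/-- Here `-(v Q)` is the solution `κ` of `q (a q + b κ) = b q + c κ`, again a function of `q = v /
r` only. -/
theorem mul_quotProfile (a : ℝ) {b c r v : ℝ} (hr : r ≠ 0) (hv : v ≠ 0) :
    v * quotProfile a b c (r, v⁻¹) =
      v / r * (a * (v / r) - b) / (b * (v / r) - c) := by
  have h1 : a - b * (r * v⁻¹) = (a * (v / r) - b) * (r / v) := by field_simp
  have h2 : b - c * (r * v⁻¹) = (b * (v / r) - c) * (r / v) := by field_simp
  have h3 : r / v ≠ 0 := div_ne_zero hr hv
  simp only [quotProfile, h1, h2]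
  rw [← mul_assoc, mul_div_mul_right _ _ h3]
  field_simp

/-- By homogeneity the common factor `γ` comes out of `S_k` as a power, and the profile equation
makes the rest equal to `1`. -/
theorem isProfileEquation_root (hn : 0 < n) (m : ℕ) (ha : 0 < (n - 1).choose (m + 2))
    (hb : 0 < (n - 1).choose (m + 1)) :
    IsProfileEquation n (rootSpeed (m + 2)) (rootDomain (m + 2))
      (rootProfile ((n - 1).choose (m + 2)) ((n - 1).choose (m + 1)) (m + 2)) {x | 0 < x.1} := by
  have ha' : (0 : ℝ) < (n - 1).choose (m + 2) := by exact_mod_cast ha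
  have hb' : (0 : ℝ) < (n - 1).choose (m + 1) := by exact_mod_cast hb
  have hS := fun κ μ => Sk_axisym hn (m + 1) κ μ
  simp only [show m + 1 + 1 = m + 2 from rfl] at hS
  generalize ((n - 1).choose (m + 2) : ℝ) = a at *
  generalize ((n - 1).choose (m + 1) : ℝ) = b at *
  refine ⟨isOpen_lt continuous_const continuous_fst, ?_, ?_, ?_, ?_⟩
  · refine ContDiffOn.div_const (ContDiffOn.sub (contDiffOn_const.div contDiffOn_fst
      fun x hx => (ne_of_gt hx)) (by fun_prop)) _
  · intro r v γ hγ hv hr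
    replace hr : 0 < r := hr
    have h : Sk (m + 2) (axisym n (γ * -(v * rootProfile a b (m + 2) (r, v⁻¹))) (γ * (v / r))) =
        γ ^ (m + 2) := by
      rw [hS, mul_rootProfile a hb'.ne' hr.ne' hv (by omega)]
      have hq : v / r ≠ 0 := div_ne_zero hv hr.ne'
      generalize v / r = q at *
      simp only [show m + 2 - 1 = m + 1 from rfl, mul_pow]
      field_simp
      ring
    refine ⟨fun _ => by rw [h]; positivity, ?_⟩
    rw [rootSpeed_of_Sk_eq (pow_pos hγ _) h, one_div,
      Real.pow_rpow_inv_natCast hγ.le (by omega)]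
  · intro r hr
    refine ⟨hr, ?_⟩
    simp only [rootProfile, ne_eq, Nat.add_eq_zero_iff, OfNat.ofNat_ne_zero, and_false,
      not_false_eq_true, zero_pow, mul_zero, sub_zero]
    positivity
  · intro r hr
    have h : Sk (m + 2) (axisym n (-rootProfile a b (m + 2) (r, 0)) (1 / r)) = 0 := by
      rw [hS, rootProfile]
      simp only [ne_eq, Nat.add_eq_zero_iff, OfNat.ofNat_ne_zero, and_false,
        not_false_eq_true, zero_pow, mul_zero, sub_zero, one_div, inv_pow]
      field_simp
      ring
    exact ⟨fun _ => h.ge, by rw [rootSpeed, h]; simp⟩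

theorem isProfileEquation_quot (hn : 0 < n) (m : ℕ) (h : m + 2 ≤ n - 1) :
    IsProfileEquation n (quotSpeed (m + 2)) (quotDomain (m + 2))
      (quotProfile ((n - 1).choose (m + 2)) ((n - 1).choose (m + 1)) ((n - 1).choose m))
      (quotProfileDomain ((n - 1).choose (m + 1)) ((n - 1).choose m)) := by
  have ha : (0 : ℝ) < (n - 1).choose (m + 2) := by exact_mod_cast Nat.choose_pos h
  have hb : (0 : ℝ) < (n - 1).choose (m + 1) := by exact_mod_cast Nat.choose_pos (by omega)
  have hc : (0 : ℝ) < (n - 1).choose m := by exact_mod_cast Nat.choose_pos (by omega)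
  have habc := choose_mul_choose_lt_sq h
  have hS := fun κ μ => Sk_axisym hn (m + 1) κ μ
  have hT := fun κ μ => Sk_axisym hn m κ μ
  simp only [show m + 1 + 1 = m + 2 from rfl] at hS
  generalize ((n - 1).choose (m + 2) : ℝ) = a at *
  generalize ((n - 1).choose (m + 1) : ℝ) = b at *
  generalize ((n - 1).choose m : ℝ) = c at *
  have hd : b ^ 2 - a * c ≠ 0 := by linarith
  refine ⟨?_, ?_, ?_, ?_, ?_⟩
  · exact (isOpen_lt continuous_const continuous_fst).inter
      (isOpen_lt continuous_const (continuous_const.sub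
        (continuous_const.mul (continuous_fst.mul continuous_snd))))
  · refine ContDiffOn.div (by fun_prop) (by fun_prop) fun x hx => ?_
    exact (mul_pos hx.1 hx.2).ne'
  · rintro r v γ hγ hv ⟨hr, hA⟩
    dsimp only at hr hA
    have hA' : b - c * (r * v⁻¹) ≠ 0 := hA.ne'
    set q := v / r with hq
    have hq0 : q ≠ 0 := div_ne_zero hv hr.ne'
    have hD : b * q - c ≠ 0 := by
      have : b * q - c = q * (b - c * (r * v⁻¹)) := by
        rw [hq]
        field_simp
      rw [this]
      exact mul_ne_zero hq0 hA'
    have hκ : -(v * quotProfile a b c (r, v⁻¹)) * (b * q - c) = q * (b - a * q) := by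
      rw [mul_quotProfile a hr.ne' hv, ← hq, neg_mul, div_mul_cancel₀ _ hD]
      ring
    generalize -(v * quotProfile a b c (r, v⁻¹)) = κ at *
    -- The equation for `κ` makes the reduced numerator and denominator of the speed equal. Their
    -- common value is nonzero because `b² ≠ a c`; so `S_{k-1} ≠ 0`, and the quotient is `γ`.
    have e1 : b * q + c * κ = q ^ 2 * (b ^ 2 - a * c) / (b * q - c) := by
      rw [eq_div_iff hD]
      linear_combination c * hκ
    have e2 : a * q ^ 2 + b * κ * q = q ^ 2 * (b ^ 2 - a * c) / (b * q - c) := by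
      rw [eq_div_iff hD]
      linear_combination b * q * hκ
    have h1 : Sk (m + 1) (axisym n (γ * κ) (γ * q)) =
        (γ * q) ^ m * (γ * (q ^ 2 * (b ^ 2 - a * c) / (b * q - c))) := by
      rw [hT, ← e1]
      ring
    have h2 : Sk (m + 2) (axisym n (γ * κ) (γ * q)) =
        γ * ((γ * q) ^ m * (γ * (q ^ 2 * (b ^ 2 - a * c) / (b * q - c)))) := by
      rw [hS, ← e2]
      ring
    have h3 : (γ * q) ^ m * (γ * (q ^ 2 * (b ^ 2 - a * c) / (b * q - c))) ≠ 0 := by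
      positivity
    refine ⟨?_, ?_⟩
    · change Sk (m + 1) _ ≠ 0
      rwa [h1]
    · change Sk (m + 2) _ / Sk (m + 1) _ = γ
      rw [h1, h2, mul_div_assoc, div_self h3, mul_one]
  · intro r hr
    refine ⟨⟨hr, by simpa using hb⟩, ?_⟩
    simp only [quotProfile, mul_zero, sub_zero]
    positivity
  · intro r hr
    have h1 : Sk (m + 1) (axisym n (-quotProfile a b c (r, 0)) (1 / r)) =
        (1 / r) ^ m * ((b ^ 2 - a * c) / (b * r)) := by
      rw [hT, quotProfile]
      simp only [mul_zero, sub_zero, one_div, inv_pow]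
      field_simp
      ring
    have h2 : Sk (m + 2) (axisym n (-quotProfile a b c (r, 0)) (1 / r)) = 0 := by
      rw [hS, quotProfile]
      simp only [mul_zero, sub_zero, one_div, inv_pow]
      field_simp
      ring
    refine ⟨?_, ?_⟩
    · change Sk (m + 1) _ ≠ 0
      rw [h1]
      positivity
    · change Sk (m + 2) _ / Sk (m + 1) _ = 0
      rw [h2, zero_div]

theorem rootSpeed_cyl_zero (hn : 0 < n) (m : ℕ) (ha : 0 < (n - 1).choose (m + 2)) :
    rootSpeed (m + 2) (cyl n 0) =
      ((n - 1).choose (m + 2) : ℝ) ^ ((1 : ℝ) / (m + 2 : ℕ)) := by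
  refine rootSpeed_of_Sk_eq (by exact_mod_cast ha) ?_
  rw [cyl_eq_axisym, Sk_axisym hn]
  simp

theorem deriv_rootSpeed_cyl (hn : 0 < n) (m : ℕ) (ha : 0 < (n - 1).choose (m + 2)) :
    deriv (fun t => rootSpeed (m + 2) (cyl n t)) 0 = (n - 1).choose (m + 1) *
      ((n - 1).choose (m + 2) : ℝ) ^ ((1 : ℝ) / (m + 2 : ℕ)) /
        ((n - 1).choose (m + 2) * (m + 2 : ℕ)) := by
  have ha' : (0 : ℝ) < (n - 1).choose (m + 2) := by exact_mod_cast ha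
  have hS : ∀ t, Sk (m + 2) (cyl n t) = (n - 1).choose (m + 2) + (n - 1).choose (m + 1) * t :=
    fun t => by simp [cyl_eq_axisym, Sk_axisym hn (m + 1)]
  generalize ((n - 1).choose (m + 2) : ℝ) = a at *
  generalize ((n - 1).choose (m + 1) : ℝ) = b at *
  have h1 : HasDerivAt (fun t : ℝ => a + b * t) b 0 := by
    simpa using ((hasDerivAt_id (0 : ℝ)).const_mul b).const_add a
  have h2 := h1.rpow_const (p := (1 : ℝ) / (m + 2 : ℕ)) (Or.inl (by simpa using ha'.ne'))
  have h3 : ∀ᶠ t in 𝓝 (0 : ℝ), 0 < a + b * t :=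
    h1.continuousAt.eventually_const_lt (by simpa using ha')
  refine (HasDerivAt.congr_of_eventuallyEq h2 ?_).deriv.trans ?_
  · filter_upwards [h3] with t ht
    rw [rootSpeed_of_Sk_eq ht (hS t)]
  · rw [mul_zero, add_zero, Real.rpow_sub ha', Real.rpow_one]
    field_simp

theorem quotSpeed_cyl (hn : 0 < n) (m : ℕ) (t : ℝ) :
    quotSpeed (m + 2) (cyl n t) =
      ((n - 1).choose (m + 2) + (n - 1).choose (m + 1) * t) /
        ((n - 1).choose (m + 1) + (n - 1).choose m * t) := by
  change Sk (m + 2) (cyl n t) / Sk (m + 1) (cyl n t) = _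
  simp [cyl_eq_axisym, Sk_axisym hn]

theorem deriv_quotSpeed_cyl (hn : 0 < n) (m : ℕ) (hb : 0 < (n - 1).choose (m + 1)) :
    deriv (fun t => quotSpeed (m + 2) (cyl n t)) 0 =
      (((n - 1).choose (m + 1) : ℝ) ^ 2 - (n - 1).choose (m + 2) * (n - 1).choose m) /
        ((n - 1).choose (m + 1) : ℝ) ^ 2 := by
  have hb' : (0 : ℝ) < (n - 1).choose (m + 1) := by exact_mod_cast hb
  simp only [quotSpeed_cyl hn]
  have h1 : ∀ a b : ℝ, HasDerivAt (fun t : ℝ => a + b * t) b 0 := fun a b => by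
    simpa using ((hasDerivAt_id (0 : ℝ)).const_mul b).const_add a
  rw [((h1 _ _).fun_div (h1 _ _) (by simpa using hb'.ne')).deriv]
  simp only [mul_zero, add_zero]
  ring

end Profiles

/-! ### Bowl-like branches for both speeds, and wings with two entire branches -/

noncomputable section Wings

open Set

variable {n : ℕ}

/-- `u(r) = r² / (2s) - L log r + C + O(r⁻¹)`. -/
def HasBowlExpansion (u : ℝ → ℝ) (s L : ℝ) : Prop :=
  ∃ C K r₁, ∀ r ≥ r₁, |u r - (r ^ 2 / (2 * s) - L * Real.log r + C)| ≤ K / r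

theorem HasBowlExpansion.asymptoticToBowl {u : ℝ → ℝ} {f : (Fin n → ℝ) → ℝ}
    (h : HasBowlExpansion u (f (cyl n 0)) (deriv (fun t => f (cyl n t)) 0)) :
    ∃ C, AsymptoticToBowl f (fun x => u ‖x‖) C := by
  obtain ⟨C, K, r₁, h⟩ := h
  refine ⟨C, IsBigO.of_bound K ?_⟩
  filter_upwards [tendsto_norm_cobounded_atTop.eventually (eventually_ge_atTop r₁)] with x hx
  rw [norm_inv, norm_norm, ← div_eq_mul_inv, Real.norm_eq_abs]
  exact h _ hx

/-- Continuation of a half neck to an entire graph that is asymptotic to a bowl. -/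
theorem IsNeckArc.exists_isBranch_bowlExpansion {Q : ℝ × ℝ → ℝ} {Ω : Set (ℝ × ℝ)}
    (hΩ : IsOpen Ω) (hQc : ContinuousOn Q Ω) (hQ : ∀ x ∈ Ω, 0 < Q x) {R δ : ℝ} {g p : ℝ → ℝ}
    (hR : 0 < R) (hδ : 0 < δ) (h : IsNeckArc Q Ω R δ g p) {H : ℝ → ℝ} {qm q₀ : ℝ} (hqm : 0 ≤ qm)
    (hq₀ : qm < q₀) (hΩG : ∀ x ∈ Ω, 0 < x.2 → qm < x.2⁻¹ / x.1) (hH : ContDiffOn ℝ ∞ H (Ioi qm))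
    (hHpos : ∀ q > qm, 0 < H q) (hGm : ∀ q₁ > qm, ∃ m, qm < m ∧ m ≤ q₁ ∧ m ≤ (q₀ - m) * H m)
    {A : Set (ℝ × ℝ)} (hΩA : Ω ⊆ A) (hA : ∀ r v, 0 < r → qm < v / r → (r, v⁻¹) ∈ A)
    (hQG : ∀ r v, 0 < r → qm < v / r → -(v * Q (r, v⁻¹)) = (q₀ - v / r) * H (v / r)) :
    ∃ u v, IsBranch Q A R (Ioi R) g u v ∧ HasBowlExpansion u q₀⁻¹ (q₀ * H q₀)⁻¹ := by
  obtain ⟨u, v, hb, r₁, hr₁, m, M, hm, hv⟩ := h.exists_isBranch_bowl hΩ hQc hQ hR hδ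
    (G := fun q => (q₀ - q) * H q) (q₀ := q₀) hqm hΩG ((contDiffOn_const.sub contDiffOn_id).mul hH)
    (fun q hq => mul_nonpos_of_nonpos_of_nonneg (sub_nonpos.2 hq) (hHpos q (hq₀.trans_le hq)).le)
    hGm hΩA hA hQG
  have hr₁0 : 0 < r₁ := hR.trans hr₁
  obtain ⟨C, K, hCK⟩ := exists_bowl_expansion (G := fun q => (q₀ - q) * H q) hr₁0 hqm hq₀ hm hH
    hHpos (fun q _ => by ring) (fun r hr => hb.deriv_u r (hr₁.trans_le hr)) (fun r hr => by
      refine (hb.deriv_v r (hr₁.trans_le hr)).congr_deriv ?_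
      rw [← hQG r (v r) (hr₁0.trans_le hr) (hm.trans_le (hv r hr).1)]
      ring) hv
  refine ⟨u, v, hb, C, K, r₁, fun r hr => ?_⟩
  convert hCK r hr using 5
  rw [div_eq_mul_inv, mul_inv, inv_inv]
  ring

/-- Here `G(q) = (1 - a q ^ k) / (b q ^ (k - 1))` on `q > 0`, with zero `q₀ = a ^ (-1/k)`. -/
theorem IsNeckArc.exists_isBranch_root {a b : ℝ} (ha : 0 < a) (hb : 0 < b) {k : ℕ} (hk : k ≠ 0)
    {Ω : Set (ℝ × ℝ)} (hΩ : IsOpen Ω) (hΩA : Ω ⊆ {x | 0 < x.1})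
    (hQc : ContinuousOn (rootProfile a b k) Ω) (hQ : ∀ x ∈ Ω, 0 < rootProfile a b k x)
    {R δ : ℝ} {g p : ℝ → ℝ} (hR : 0 < R) (hδ : 0 < δ)
    (h : IsNeckArc (rootProfile a b k) Ω R δ g p) :
    ∃ u v, IsBranch (rootProfile a b k) {x | 0 < x.1} R (Ioi R) g u v ∧
      HasBowlExpansion u (a ^ ((1 : ℝ) / k)) (b * a ^ ((1 : ℝ) / k) / (a * k)) := by
  set s := a ^ ((1 : ℝ) / k) with hs
  have hs0 : 0 < s := Real.rpow_pos_of_pos ha _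
  have hsk : s ^ k = a := by rw [hs, one_div, Real.rpow_inv_natCast_pow ha.le hk]
  set H : ℝ → ℝ := fun q =>
    a * (∑ i ∈ Finset.range k, s⁻¹ ^ i * q ^ (k - 1 - i)) / (b * q ^ (k - 1)) with hH
  have hk0 : (0 : ℝ) < k := by exact_mod_cast Nat.pos_of_ne_zero hk
  have hG : ∀ q, (s⁻¹ - q) * H q = (1 - a * q ^ k) / (b * q ^ (k - 1)) := fun q => by
    -- Since `a s⁻¹ ^ k = 1`, the numerator is `a (s⁻¹ ^ k - q ^ k)`, and the geometric sum splits
    -- off the factor `s⁻¹ - q`.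
    have h1 := (Commute.all s⁻¹ q).mul_geom_sum₂ k
    have h2 : a * s⁻¹ ^ k = 1 := by rw [inv_pow, hsk, mul_inv_cancel₀ ha.ne']
    rw [← h2, ← mul_sub, ← h1]
    simp only [hH]
    ring
  have key : ∃ u v, IsBranch (rootProfile a b k) {x | 0 < x.1} R (Ioi R) g u v ∧
      HasBowlExpansion u s⁻¹⁻¹ (s⁻¹ * H s⁻¹)⁻¹ := by
    refine h.exists_isBranch_bowlExpansion hΩ hQc hQ hR hδ le_rfl (inv_pos.2 hs0)
      (fun x hx hx2 => div_pos (inv_pos.2 hx2) (hΩA hx)) ?_ ?_ ?_ hΩA (fun r v hr _ => hr) ?_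
    · refine ContDiffOn.div (by fun_prop) (by fun_prop) fun q hq => ?_
      have : 0 < q := hq
      positivity
    · intro q hq
      have : 0 < ∑ i ∈ Finset.range k, s⁻¹ ^ i * q ^ (k - 1 - i) :=
        Finset.sum_pos (fun i _ => by positivity) (Finset.nonempty_range_iff.2 hk)
      simp only [hH]
      positivity
    · intro q₁ hq₁
      -- `t ≤ G t` amounts to `(a + b) t ^ k ≤ 1`, which follows from `t ≤ 1` and `(a + b) t ≤ 1`.
      refine ⟨min q₁ (min 1 (1 / (a + b))), lt_min hq₁ (lt_min one_pos (by positivity)),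
        min_le_left _ _, ?_⟩
      set t := min q₁ (min 1 (1 / (a + b))) with ht
      have ht0 : 0 < t := lt_min hq₁ (lt_min one_pos (by positivity))
      have ht1 : t ≤ 1 := (min_le_right _ _).trans (min_le_left _ _)
      have ht2 : t * (a + b) ≤ 1 := by
        rw [← le_div_iff₀ (by positivity)]
        exact (min_le_right _ _).trans (min_le_right _ _)
      have htk : t ^ k ≤ t := pow_le_of_le_one ht0.le ht1 hk
      have htk' : t * t ^ (k - 1) = t ^ k := by
        rw [← pow_succ']
        congr 1
        omega
      rw [hG, le_div_iff₀ (by positivity)]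
      calc t * (b * t ^ (k - 1)) = b * t ^ k := by rw [← htk']; ring
        _ ≤ 1 - a * t ^ k := by nlinarith
    · intro r v hr hv
      have hv0 : 0 < v := (div_pos_iff_of_pos_right hr).1 hv
      rw [hG, mul_rootProfile a hb.ne' hr.ne' hv0.ne' hk]
      ring
  obtain ⟨u, v, hbr, hexp⟩ := key
  refine ⟨u, v, hbr, ?_⟩
  have hH0 : H s⁻¹ = a * k / b := by
    have : ∀ i ∈ Finset.range k, s⁻¹ ^ i * s⁻¹ ^ (k - 1 - i) = s⁻¹ ^ (k - 1) := fun i hi => by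
      rw [← pow_add]
      congr 1
      have := Finset.mem_range.1 hi
      omega
    simp only [hH]
    rw [Finset.sum_congr rfl this, Finset.sum_const, Finset.card_range, nsmul_eq_mul]
    have : s⁻¹ ^ (k - 1) ≠ 0 := by positivity
    field_simp
  rw [inv_inv, hH0] at hexp
  convert hexp using 1
  field_simp

/-- Here `G(q) = q (b - a q) / (b q - c)`, with pole `c / b` as the lower end and zero `q₀ = b / a`;
the pole lies below the zero because `a c < b²`. -/
theorem IsNeckArc.exists_isBranch_quot {a b c : ℝ} (ha : 0 < a) (hb : 0 < b) (hc : 0 < c)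
    (habc : a * c < b ^ 2) {Ω : Set (ℝ × ℝ)} (hΩ : IsOpen Ω) (hΩA : Ω ⊆ quotProfileDomain b c)
    (hQc : ContinuousOn (quotProfile a b c) Ω) (hQ : ∀ x ∈ Ω, 0 < quotProfile a b c x)
    {R δ : ℝ} {g p : ℝ → ℝ} (hR : 0 < R) (hδ : 0 < δ)
    (h : IsNeckArc (quotProfile a b c) Ω R δ g p) :
    ∃ u v, IsBranch (quotProfile a b c) (quotProfileDomain b c) R (Ioi R) g u v ∧
      HasBowlExpansion u (a / b) ((b ^ 2 - a * c) / b ^ 2) := by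
  have hd : 0 < b ^ 2 - a * c := sub_pos.2 habc
  have hden : ∀ q > c / b, 0 < b * q - c := fun q hq => by
    rw [gt_iff_lt, div_lt_iff₀ hb] at hq
    linarith
  have hcb : 0 < c / b := div_pos hc hb
  have hq₀ : c / b < b / a := by
    rw [div_lt_div_iff₀ hb ha]
    linarith
  set H : ℝ → ℝ := fun q => a * q / (b * q - c) with hH
  have key : ∃ u v, IsBranch (quotProfile a b c) (quotProfileDomain b c) R (Ioi R) g u v ∧
      HasBowlExpansion u (b / a)⁻¹ (b / a * H (b / a))⁻¹ := by
    refine h.exists_isBranch_bowlExpansion hΩ hQc hQ hR hδ hcb.le hq₀ ?_ ?_ ?_ ?_ hΩA ?_ ?_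
    · intro x hx hx2
      obtain ⟨h1, h2⟩ := hΩA hx
      rw [div_lt_div_iff₀ hb h1, lt_inv_mul_iff₀ hx2]
      linarith
    · exact ContDiffOn.div (by fun_prop) (by fun_prop) fun q hq => (hden q hq).ne'
    · intro q hq
      have := hden q hq
      have := hcb.trans hq
      positivity
    · intro q₁ hq₁
      have h1 : c / b < (b + c) / (a + b) := by
        rw [div_lt_div_iff₀ hb (by positivity)]
        nlinarith
      -- `t ≤ G t` reduces to `b t - c ≤ b - a t`; the bound `(b + c) / (a + b)` is a mediant of `b
      -- / a` and `c / b`, hence lies above `c / b`.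
      refine ⟨min q₁ ((b + c) / (a + b)), lt_min hq₁ h1, min_le_left _ _, ?_⟩
      set t := min q₁ ((b + c) / (a + b))
      have ht : c / b < t := lt_min hq₁ h1
      have ht2 : t * (a + b) ≤ b + c := by
        rw [← le_div_iff₀ (by positivity)]
        exact min_le_right _ _
      rw [← mul_div_assoc, le_div_iff₀ (hden t ht)]
      have h2 : (b / a - t) * (a * t) = t * (b - a * t) := by field_simp
      rw [h2]
      exact mul_le_mul_of_nonneg_left (by linarith) (hcb.trans ht).le
    · intro r v hr hv
      have hv0 : 0 < v := (div_pos_iff_of_pos_right hr).1 (hcb.trans hv)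
      refine ⟨hr, ?_⟩
      have h1 : b - c * (r * v⁻¹) = (b * (v / r) - c) * (r / v) := by field_simp
      change 0 < b - c * (r * v⁻¹)
      rw [h1]
      exact mul_pos (hden _ hv) (div_pos hr hv0)
    · intro r v hr hv
      have hv0 : 0 < v := (div_pos_iff_of_pos_right hr).1 (hcb.trans hv)
      have := hden _ hv
      rw [mul_quotProfile a hr.ne' hv0.ne']
      generalize v / r = q at *
      field_simp
      ring
  obtain ⟨u, v, hbr, hexp⟩ := key
  refine ⟨u, v, hbr, ?_⟩
  rw [inv_div] at hexp
  convert hexp using 1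
  have h1 : b * (b / a) - c = (b ^ 2 - a * c) / a := by field_simp
  simp only [hH, h1]
  field_simp

/-- Restricting the domain to `Q > 0` makes the neck arc strictly convex, as the continuation lemmas
require. -/
theorem IsProfileEquation.exists_isNeckArc {f : (Fin n → ℝ) → ℝ} {D : Set (Fin n → ℝ)}
    {Q : ℝ × ℝ → ℝ} {A : Set (ℝ × ℝ)} (h : IsProfileEquation n f D Q A) {R : ℝ} (hR : 0 < R) :
    ∃ Ω ⊆ A, IsOpen Ω ∧ (∀ x ∈ Ω, 0 < Q x) ∧ ∃ δ > 0, ∃ g p, IsNeckArc Q Ω R δ g p ∧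
      ContDiffOn ℝ ∞ g (Ioo (-δ) δ) := by
  have hΩ : IsOpen (A ∩ Q ⁻¹' Ioi 0) :=
    h.smooth.continuousOn.isOpen_inter_preimage h.isOpen isOpen_Ioi
  exact ⟨_, inter_subset_left, hΩ, fun x hx => hx.2,
    _root_.exists_isNeckArc hΩ (h.smooth.mono inter_subset_left) (h.neck_mem R hR)⟩

theorem isOpen_reflectSet {A : Set (ℝ × ℝ)} (h : IsOpen A) : IsOpen (reflectSet A) :=
  h.preimage (by fun_prop)

theorem reflectSet_mono {A B : Set (ℝ × ℝ)} (h : A ⊆ B) : reflectSet A ⊆ reflectSet B :=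
  fun x hx => h (show (x.1, -x.2) ∈ A from hx)

theorem contDiffOn_reflectFun {Q : ℝ × ℝ → ℝ} {A : Set (ℝ × ℝ)} (h : ContDiffOn ℝ ∞ Q A) :
    ContDiffOn ℝ ∞ (reflectFun Q) (reflectSet A) :=
  h.comp (by fun_prop) fun _ hx => hx

theorem continuousOn_comp_norm {u : ℝ → ℝ} {J : Set ℝ} (h : ContinuousOn u J) :
    ContinuousOn (fun x : Rn n => u ‖x‖) {x | ‖x‖ ∈ J} :=
  h.comp continuous_norm.continuousOn fun _ hx => hx

theorem contDiffOn_comp_norm {u : ℝ → ℝ} {I : Set ℝ} (h : ContDiffOn ℝ ∞ u I)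
    (hI : ∀ r ∈ I, 0 < r) : ContDiffOn ℝ ∞ (fun x : Rn n => u ‖x‖) {x | ‖x‖ ∈ I} := by
  refine h.comp (fun x hx => ?_) fun _ hx => hx
  exact (contDiffAt_norm ℝ (norm_pos_iff.1 (hI _ hx))).contDiffWithinAt

theorem IsBranch.regularOutside {Q : ℝ × ℝ → ℝ} {A : Set (ℝ × ℝ)} {R : ℝ} {g u v : ℝ → ℝ}
    (h : IsBranch Q A R (Ioi R) g u v) (hQ : ContDiffOn ℝ ∞ Q A) (hR : 0 < R) :
    RegularOutside R (fun x : Rn n => u ‖x‖) :=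
  ⟨continuousOn_comp_norm h.cont_u,
    contDiffOn_comp_norm (h.smooth_u hQ isOpen_Ioi subset_rfl) fun _ hr => hR.trans hr⟩

/-- Two entire branches that continue the two halves of a neck form a wing-like translator. -/
theorem isWingLike_of_entire_branches (hn : 2 ≤ n) {f : (Fin n → ℝ) → ℝ} {D : Set (Fin n → ℝ)}
    {Q : ℝ × ℝ → ℝ} {A Ω : Set (ℝ × ℝ)} (hQ : IsProfileEquation n f D Q A) {R δ : ℝ} (hR : 0 < R)
    (hδ : 0 < δ) {g p : ℝ → ℝ} (hΩ : ∀ x ∈ Ω, 0 < Q x) (hg : IsNeckArc Q Ω R δ g p)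
    (hgs : ContDiffOn ℝ ∞ g (Ioo (-δ) δ)) {up vp um vm : ℝ → ℝ}
    (hp : IsBranch Q A R (Ioi R) g up vp)
    (hm : IsBranch (reflectFun Q) (reflectSet A) R (Ioi R) (fun z => g (-z)) um vm) :
    IsWingLike f D R (wing n R (Ici R) up fun r => -um r) ∅ ∧
      HasTwoGraphicalBranches R (wing n R (Ici R) up fun r => -um r) (fun x => up ‖x‖)
        (fun x => -um ‖x‖) := by
  refine ⟨isWingLike_wing hn hQ hR hδ hΩ hg hgs (I := Ioi R) (E := ∅) isOpen_Ioi subset_rfl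
    isClosed_Ici isConnected_Ici subset_rfl self_mem_nhdsWithin Ioi_subset_Ici_self
    (fun r hr => ?_) (empty_subset _) hp hm (by simp) (by simp) (by simp),
    hp.regularOutside hQ.smooth hR, ?_, fun x hx => ?_, rfl⟩
  · rcases eq_or_lt_of_le (mem_Ici.1 hr) with h | h
    · exact Or.inl h.symm
    · exact Or.inr (Or.inl h)
  · have := hm.regularOutside (n := n) (contDiffOn_reflectFun hQ.smooth) hR
    exact ⟨this.1.neg, this.2.neg⟩
  · linarith [hp.u_pos hg.g_zero _ hx, hm.u_pos (by simpa using hg.g_zero) _ hx]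

end Wings

/-! ### Existence of the wings in the three cases -/

noncomputable section Existence

open Set

variable {n : ℕ}

theorem exists_root_wing_even {k : ℕ} (hk : 2 ≤ k) (hkn : k < n) {R : ℝ} (hR : 0 < R)
    (he : Even k) : ∃ (W : Set (Rn1 n)) (wp wm : Rn n → ℝ),
      IsWingLike (rootSpeed k) (rootDomain k) R W ∅ ∧
      HasTwoGraphicalBranches R W wp wm ∧
      (∃ C : ℝ, AsymptoticToBowl (rootSpeed k) wp C) ∧
      (∃ C : ℝ, AsymptoticToBowl (rootSpeed k) (fun x => -wm x) C) := by
  obtain ⟨m, rfl⟩ := Nat.exists_eq_add_of_le' hk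
  have hn : 0 < n := by omega
  have ha : 0 < (n - 1).choose (m + 2) := Nat.choose_pos (by omega)
  have hb : 0 < (n - 1).choose (m + 1) := Nat.choose_pos (by omega)
  have hQ := isProfileEquation_root hn m ha hb
  obtain ⟨Ω, hΩA, hΩ, hΩQ, δ, hδ, g, p, hg, hgs⟩ := hQ.exists_isNeckArc hR
  have hra : reflectSet {x : ℝ × ℝ | 0 < x.1} = {x | 0 < x.1} := rfl
  -- For even `k` the profile equation is even in the slope, so the lower half continues to a
  -- bowl-like branch as well.
  have hrf : reflectFun (rootProfile ((n - 1).choose (m + 2)) ((n - 1).choose (m + 1)) (m + 2)) =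
      rootProfile ((n - 1).choose (m + 2)) ((n - 1).choose (m + 1)) (m + 2) := by
    funext x
    simp only [reflectFun, rootProfile, he.neg_pow]
  have hgr : IsNeckArc (reflectFun (rootProfile _ _ (m + 2))) (reflectSet Ω) R δ _ _ := hg.reflect
  have hΩr : reflectSet Ω ⊆ {x | 0 < x.1} := reflectSet_mono hΩA
  have hΩQr : ∀ x ∈ reflectSet Ω, 0 < reflectFun (rootProfile _ _ (m + 2)) x := fun x hx => hΩQ _ hx
  rw [hrf] at hgr hΩQr
  have ha' : (0 : ℝ) < (n - 1).choose (m + 2) := by exact_mod_cast ha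
  have hb' : (0 : ℝ) < (n - 1).choose (m + 1) := by exact_mod_cast hb
  have hQc := hQ.smooth.continuousOn
  obtain ⟨up, vp, hp, hup⟩ := hg.exists_isBranch_root ha' hb' (by omega) hΩ hΩA (hQc.mono hΩA) hΩQ
    hR hδ
  obtain ⟨um, vm, hm, hum⟩ := hgr.exists_isBranch_root ha' hb' (by omega) (isOpen_reflectSet hΩ)
    hΩr (hQc.mono hΩr) hΩQr hR hδ
  rw [← rootSpeed_cyl_zero hn m ha] at hup hum
  have hm' := hm
  rw [← hrf, ← hra] at hm'
  obtain ⟨h1, h2⟩ := isWingLike_of_entire_branches (by omega) hQ hR hδ hΩQ hg hgs hp hm'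
  have hL := deriv_rootSpeed_cyl hn m ha
  rw [← rootSpeed_cyl_zero hn m ha] at hL
  rw [← hL] at hup hum
  refine ⟨_, _, _, h1, h2, hup.asymptoticToBowl, ?_⟩
  simpa only [neg_neg] using hum.asymptoticToBowl

theorem exists_root_wing_odd {k : ℕ} (hk : 2 ≤ k) (hkn : k < n) {R : ℝ} (hR : 0 < R)
    (ho : Odd k) : ∃ (W : Set (Rn1 n)) (wp wm : Rn n → ℝ) (ρ h : ℝ), R < ρ ∧
      IsWingLike (rootSpeed k) (rootDomain k) R W {p | ‖p.fst‖ = ρ ∧ p.snd = h} ∧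
      RegularOutside R wp ∧
      ContinuousOn wm {x | R ≤ ‖x‖ ∧ ‖x‖ ≤ ρ} ∧
      ContDiffOn ℝ ∞ wm {x | R < ‖x‖ ∧ ‖x‖ < ρ} ∧
      (∀ x, R < ‖x‖ → ‖x‖ ≤ ρ → wm x < wp x) ∧
      (∀ x, ‖x‖ = ρ → wm x = h) ∧
      W = graphOver wp {x | R ≤ ‖x‖} ∪ graphOver wm {x | R ≤ ‖x‖ ∧ ‖x‖ ≤ ρ} ∧
      (∃ R₁ > R, W \ Metric.ball 0 R₁ = graphOver wp {x | R ≤ ‖x‖} \ Metric.ball 0 R₁) ∧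
      (∃ C : ℝ, AsymptoticToBowl (rootSpeed k) wp C) := by
  have hk' := hk
  obtain ⟨m, rfl⟩ := Nat.exists_eq_add_of_le' hk
  have hn : 0 < n := by omega
  have ha : 0 < (n - 1).choose (m + 2) := Nat.choose_pos (by omega)
  have hb : 0 < (n - 1).choose (m + 1) := Nat.choose_pos (by omega)
  have hQ := isProfileEquation_root hn m ha hb
  obtain ⟨Ω, hΩA, hΩ, hΩQ, δ, hδ, g, p, hg, hgs⟩ := hQ.exists_isNeckArc hR
  have hL := deriv_rootSpeed_cyl hn m ha
  rw [← rootSpeed_cyl_zero hn m ha] at hL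
  have hs := rootSpeed_cyl_zero hn m ha
  have ha' : (0 : ℝ) < (n - 1).choose (m + 2) := by exact_mod_cast ha
  have hb' : (0 : ℝ) < (n - 1).choose (m + 1) := by exact_mod_cast hb
  generalize ((n - 1).choose (m + 2) : ℝ) = a at *
  generalize ((n - 1).choose (m + 1) : ℝ) = b at *
  have hgr : IsNeckArc (reflectFun (rootProfile a b (m + 2))) (reflectSet Ω) R δ _ _ := hg.reflect
  have hΩr : reflectSet Ω ⊆ reflectSet {x | 0 < x.1} := reflectSet_mono hΩA
  have hQc := hQ.smooth.continuousOn
  have hQs := contDiffOn_reflectFun hQ.smooth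
  obtain ⟨up, vp, hp, hup⟩ := hg.exists_isBranch_root ha' hb' (by omega) hΩ hΩA (hQc.mono hΩA) hΩQ
    hR hδ
  rw [← hs, ← hL] at hup
  -- For odd `k` the reflection changes the sign of the term with `p ^ k`, so both terms of the
  -- numerator of `Q` are positive and the slope comes down to `0`.
  obtain ⟨um, vm, ρ, hRρ, hm, hvm⟩ := hgr.exists_isBranch_terminating ha' hb' hk'
    (isOpen_reflectSet hΩ) (hQs.continuousOn.mono hΩr) (fun x hx => hΩQ _ hx) hδ
    (fun x hx => hΩr hx) hΩr (fun r v hr _ => hr) fun r v hr hv => by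
      simp only [reflectFun, rootProfile, ho.neg_pow, inv_pow, show m + 2 - 1 = m + 1 from rfl]
      field_simp
      ring
  have hg0 : g (-0) = R := by rw [neg_zero, hg.g_zero]
  have hup0 := hp.u_pos hg.g_zero
  have hum0 := hm.u_pos hg0
  have hcl : ∀ r ≥ R, 0 ≤ up r := fun r hr => by
    rcases eq_or_lt_of_le hr with rfl | hr
    · exact hp.u_neck.ge
    · exact (hup0 r hr).le
  have hmono : MonotoneOn um (Ici R) := by
    refine monotoneOn_of_deriv_nonneg (convex_Ici R) hm.cont_u ?_ ?_
    · rw [interior_Ici]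
      exact fun r hr => (hm.deriv_u r hr).differentiableAt.differentiableWithinAt
    · rw [interior_Ici]
      exact fun r hr => (hm.deriv_u r hr).deriv ▸ hm.v_nonneg r hr
  have hbdd : ∀ r ∈ Icc R ρ, 0 ≤ um r ∧ um r ≤ um ρ := fun r hr =>
    ⟨hm.u_neck ▸ hmono self_mem_Ici hr.1 hr.1, hmono hr.1 hRρ.le hr.2⟩
  have hρ : 0 < ρ := hR.trans hRρ
  have hW : wing n R (Icc R ρ) up (fun r => -um r) = graphOver (fun x => up ‖x‖) {x | R ≤ ‖x‖} ∪
      graphOver (fun x => -um ‖x‖) {x | R ≤ ‖x‖ ∧ ‖x‖ ≤ ρ} := rfl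
  have hderiv : HasDerivAt (fun r => -um r) 0 ρ := by
    have := (hm.deriv_u ρ hRρ).neg
    rwa [hvm ρ le_rfl, neg_zero] at this
  refine ⟨wing n R (Icc R ρ) up fun r => -um r, fun x => up ‖x‖, fun x => -um ‖x‖, ρ, -um ρ, hRρ,
    ?_, hp.regularOutside hQ.smooth hR, ?_, ?_, ?_, ?_, hW, ?_, hup.asymptoticToBowl⟩
  · refine isWingLike_wing (by omega) hQ hR hδ hΩQ hg hgs (I := Ioo R ρ) (E := {ρ}) isOpen_Ioo
      (fun r hr => hr.1) isClosed_Icc (isConnected_Icc hRρ.le) (fun r hr => hr.1)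
      (Icc_mem_nhdsGE hRρ) Ioo_subset_Icc_self (fun r hr => ?_)
      (singleton_subset_iff.2 ⟨hRρ.le, le_rfl⟩) hp hm ?_ ?_ ?_
    · rcases eq_or_lt_of_le hr.1 with h | h
      · exact Or.inl h.symm
      · rcases eq_or_lt_of_le hr.2 with h' | h'
        · exact Or.inr (Or.inr h')
        · exact Or.inr (Or.inl ⟨h, h'⟩)
    · ext q
      simp only [mem_ofPred_eq, mem_singleton_iff]
      exact and_congr_right fun h => by rw [h]
    · rintro q ⟨hq1, hq2⟩
      exact isBoundaryPoint_wing hR hRρ hcl hum0 hm.deriv_u hm.cont_v (hvm ρ le_rfl) hq1 hq2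
    · rintro W' hW' q ⟨hq1, hq2⟩
      refine not_isTranslatorAt_of_horizontal (rootSpeed_eq_zero hk') hR hRρ hderiv
        (fun x h1 h2 => hW' ?_) hq1 hq2
      exact Or.inr ⟨⟨h1.le, h2⟩, rfl⟩
  · exact (continuousOn_comp_norm (J := Icc R ρ) (hm.cont_u.mono fun r hr => hr.1)).neg
  · exact (contDiffOn_comp_norm (hm.smooth_u hQs isOpen_Ioo fun r hr => hr.1)
      fun r hr => hR.trans hr.1).neg
  · intro x hx _
    linarith [hup0 _ hx, hum0 _ hx]
  · intro x hx
    simp only [hx]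
  -- On the lower branch `|x| ≤ ρ` and the height is at most `um ρ` in absolute value, so a ball of
  -- this radius contains it.
  · refine ⟨ρ + um ρ + 1, by linarith [hum0 ρ hRρ], ?_⟩
    rw [hW, union_sdiff_distrib, union_eq_left]
    rintro q ⟨⟨hq1, hq2⟩, hq3⟩
    refine absurd ?_ hq3
    obtain ⟨h1, h2⟩ := hbdd _ hq1
    have hq4 : q.snd ^ 2 ≤ um ρ ^ 2 := by
      rw [hq2, neg_sq]
      exact pow_le_pow_left₀ h1 h2 2
    have hq5 : ‖q.fst‖ ^ 2 ≤ ρ ^ 2 := pow_le_pow_left₀ (norm_nonneg _) hq1.2 2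
    have hq6 : ‖q‖ ^ 2 = ‖q.fst‖ ^ 2 + q.snd ^ 2 := by
      rw [← real_inner_self_eq_norm_sq, inner_rn1, real_inner_self_eq_norm_sq]
      ring
    have h0 := (hum0 ρ hRρ).le
    rw [mem_ball_zero_iff]
    refine lt_of_pow_lt_pow_left₀ 2 (by positivity) ?_
    rw [hq6]
    nlinarith [mul_nonneg hρ.le h0]

theorem norm_gradient_comp_norm {u : ℝ → ℝ} {d : ℝ} {x : Rn n} (hx : 0 < ‖x‖)
    (h : HasDerivAt u d ‖x‖) : ‖gradient (fun x : Rn n => u ‖x‖) x‖ = |d| := by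
  have hf : HasFDerivAt (fun x : Rn n => u ‖x‖) (d • (‖x‖⁻¹ • innerSL ℝ x)) x :=
    HasDerivAt.comp_hasFDerivAt x h (hasFDerivAt_norm_of_ne_zero (norm_pos_iff.1 hx))
  have hg : HasGradientAt (fun x : Rn n => u ‖x‖) ((d * ‖x‖⁻¹) • x) x := by
    refine hasGradientAt_iff_hasFDerivAt.2 (hf.congr_fderiv ?_)
    rw [map_smul, smul_smul]
    rfl
  rw [hg.gradient, norm_smul, norm_mul, norm_inv, norm_norm, Real.norm_eq_abs, mul_assoc,
    inv_mul_cancel₀ hx.ne', mul_one]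

theorem exists_quot_wing {k : ℕ} (hk : 2 ≤ k) (hkn : k < n) {R : ℝ} (hR : 0 < R) :
    ∃ (W : Set (Rn1 n)) (wp wm : Rn n → ℝ),
      IsWingLike (quotSpeed k) (quotDomain k) R W ∅ ∧
      HasTwoGraphicalBranches R W wp wm ∧
      (∃ C : ℝ, AsymptoticToBowl (quotSpeed k) wp C) ∧
      Tendsto (fun x => ‖gradient wm x‖) (cobounded (Rn n)) (𝓝 0) := by
  obtain ⟨m, rfl⟩ := Nat.exists_eq_add_of_le' hk
  have hn : 0 < n := by omega
  have hmn : m + 2 ≤ n - 1 := by omega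
  have hQ := isProfileEquation_quot hn m hmn
  obtain ⟨Ω, hΩA, hΩ, hΩQ, δ, hδ, g, p, hg, hgs⟩ := hQ.exists_isNeckArc hR
  have ha : (0 : ℝ) < (n - 1).choose (m + 2) := by exact_mod_cast Nat.choose_pos hmn
  have hb : (0 : ℝ) < (n - 1).choose (m + 1) := by exact_mod_cast Nat.choose_pos (by omega)
  have hc : (0 : ℝ) < (n - 1).choose m := by exact_mod_cast Nat.choose_pos (by omega)
  have habc := choose_mul_choose_lt_sq hmn
  have hL := deriv_quotSpeed_cyl hn m (Nat.choose_pos (by omega))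
  have hs : quotSpeed (m + 2) (cyl n 0) = (n - 1).choose (m + 2) / (n - 1).choose (m + 1) := by
    simp [quotSpeed_cyl hn]
  generalize ((n - 1).choose (m + 2) : ℝ) = a at *
  generalize ((n - 1).choose (m + 1) : ℝ) = b at *
  generalize ((n - 1).choose m : ℝ) = c at *
  have hQc := hQ.smooth.continuousOn
  have hQs := contDiffOn_reflectFun hQ.smooth
  have hgr : IsNeckArc (reflectFun (quotProfile a b c)) (reflectSet Ω) R δ _ _ := hg.reflect
  have hΩr : reflectSet Ω ⊆ reflectSet (quotProfileDomain b c) := reflectSet_mono hΩA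
  obtain ⟨up, vp, hp, hup⟩ := hg.exists_isBranch_quot ha hb hc habc hΩ hΩA (hQc.mono hΩA) hΩQ
    hR hδ
  -- After reflection the numerator and the denominator of the quotient profile are sums of positive
  -- terms for positive slope, so neither the zero nor the pole of `G` is met.
  obtain ⟨um, vm, hm, hvm⟩ := hgr.exists_isBranch_decay ha hb hc habc (isOpen_reflectSet hΩ)
    (hQs.continuousOn.mono hΩr) (fun x hx => hΩQ _ hx) hδ (fun x hx => (hΩr hx).1) hΩr
    (fun r v hr hv => ⟨hr, by
      have : 0 < c * (r * v⁻¹) := by positivity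
      simp only [mul_neg, sub_neg_eq_add]
      positivity⟩)
    fun r v hr hv => by
      simp only [reflectFun, quotProfile, mul_neg, sub_neg_eq_add]
      field_simp
  obtain ⟨h1, h2⟩ := isWingLike_of_entire_branches (by omega) hQ hR hδ hΩQ hg hgs hp hm
  rw [← hs, ← hL] at hup
  refine ⟨_, _, _, h1, h2, hup.asymptoticToBowl, ?_⟩
  have hlim : Tendsto (fun x : Rn n => |vm ‖x‖|) (cobounded (Rn n)) (𝓝 0) := by
    simpa using (hvm.comp tendsto_norm_cobounded_atTop).abs
  refine hlim.congr' ?_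
  filter_upwards [tendsto_norm_cobounded_atTop.eventually (eventually_gt_atTop R)] with x hx
  rw [norm_gradient_comp_norm (u := fun r => -um r) (hR.trans hx) (hm.deriv_u _ hx).neg, abs_neg]

end Existence

theorem theorem4 (n k : ℕ) (hk : 2 ≤ k) (hkn : k < n) (R : ℝ) (hR : 0 < R) :
    -- the `k`-th root of `S_k`, `k` even
    (Even k → ∃ (W : Set (Rn1 n)) (wp wm : Rn n → ℝ),
      IsWingLike (rootSpeed k) (rootDomain k) R W ∅ ∧
      HasTwoGraphicalBranches R W wp wm ∧
      (∃ C : ℝ, AsymptoticToBowl (rootSpeed k) wp C) ∧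
      (∃ C : ℝ, AsymptoticToBowl (rootSpeed k) (fun x => -wm x) C)) ∧
    -- the `k`-th root of `S_k`, `k` odd
    (Odd k → ∃ (W : Set (Rn1 n)) (wp wm : Rn n → ℝ) (ρ h : ℝ), R < ρ ∧
      IsWingLike (rootSpeed k) (rootDomain k) R W {p | ‖p.fst‖ = ρ ∧ p.snd = h} ∧
      RegularOutside R wp ∧
      ContinuousOn wm {x | R ≤ ‖x‖ ∧ ‖x‖ ≤ ρ} ∧
      ContDiffOn ℝ ∞ wm {x | R < ‖x‖ ∧ ‖x‖ < ρ} ∧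
      (∀ x, R < ‖x‖ → ‖x‖ ≤ ρ → wm x < wp x) ∧
      (∀ x, ‖x‖ = ρ → wm x = h) ∧
      W = graphOver wp {x | R ≤ ‖x‖} ∪ graphOver wm {x | R ≤ ‖x‖ ∧ ‖x‖ ≤ ρ} ∧
      (∃ R₁ > R, W \ Metric.ball 0 R₁ = graphOver wp {x | R ≤ ‖x‖} \ Metric.ball 0 R₁) ∧
      (∃ C : ℝ, AsymptoticToBowl (rootSpeed k) wp C)) ∧
    -- the quotient `S_k / S_{k-1}`
    (∃ (W : Set (Rn1 n)) (wp wm : Rn n → ℝ),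
      IsWingLike (quotSpeed k) (quotDomain k) R W ∅ ∧
      HasTwoGraphicalBranches R W wp wm ∧
      (∃ C : ℝ, AsymptoticToBowl (quotSpeed k) wp C) ∧
      Tendsto (fun x => ‖gradient wm x‖) (cobounded (Rn n)) (𝓝 0)) := by
  exact ⟨exists_root_wing_even hk hkn hR, exists_root_wing_odd hk hkn hR,
    exists_quot_wing hk hkn hR⟩
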